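/- **Theorem 4.1.** Let $\nu\in(0,2)$ and let $X$ be a stationary, isotropic Gaussian random field on $\mathbb R^2$ (constant mean, covariance depending only on $\|\mathbf x-\mathbf y\|$) whose covariance function satisfies $$K(\mathbf x,\mathbf y)=\sum_{j=0}^{\lfloor\nu\rfloor}\beta_j\|\mathbf x-\mathbf y\|^{2j}+\beta_\nu^*\,G_\nu(\|\mathbf x-\mathbf y\|)+r(\mathbf x,\mathbf y),\qquad \mathbf x,\mathbf y\in\mathbb R^2,$$ with constants $\beta_j$ and $\beta_\nu^*\ne0$, where $G_\nu(0)=0$ and, for $s>0$, $G_\nu(s)=s^{2\nu}$ if $\nu\notin\mathbb Z$ and $G_\nu(s)=s^{2\nu}\log s$ if $\nu\in\mathbb Z$, and where $r(\mathbf x,\mathbf y)=O(\|\mathbf x-\mathbf y\|^{2\nu+\tau})$ as $\|\mathbf x-\mathbf y\|\to0$ for some $\tau>0$. Write $\tilde K(\mathbf x-\mathbf y)=K(\mathbf x,\mathbf y)$ and $\tilde K^{(a_1,a_2)}=\partial^{a_1+a_2}\tilde K/\partial x_1^{a_1}\partial x_2^{a_2}$. Let $\Omega\supset[0,1]^2$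 be open in $\mathbb R^2$ and let $\tilde\varphi=(\varphi_1,\varphi_2):\Omega\to\mathbb R^2$ be a $C^1$ diffeomorphism onto its range whose second-order mixed partial derivatives exist and are continuous on $\Omega$ (in particular, $\tilde\varphi$ may be any $C^2$ diffeomorphism). Put $\varphi_j^{(1,0)}=\partial\varphi_j/\partial u$, $\varphi_j^{(0,1)}=\partial\varphi_j/\partial v$, $\Delta=\tilde\varphi([0,1]^2)$, and, for $1\le i_1,i_2\le n$, $\mathbf x^{i_1,i_2}=(x_1^{i_1,i_2},x_2^{i_1,i_2})'=\tilde\varphi(i_1/n,i_2/n)$ and $X_{i_1,i_2}=X(\mathbf x^{i_1,i_2})$. Let $\theta,\ell\in\{1,2\}$. For $1\le i_1,i_2\le n-\theta$ let $A_{\theta;i_1,i_2}$ be the $2\times2$ matrix with rows $(\mathbf x^{i_1+\theta,i_2}-\mathbf x^{i_1,i_2})'$ and $(\mathbf x^{i_1,i_2+\theta}-\mathbf x^{i_1,i_2})'$, let $B_{\theta;i_1,i_2}$ be the one with rows $(\mathbf x^{i_1+\theta,i_2}-\mathbf x^{i_1+\theta,i_2+\theta})'$ and $(\mathbf x^{i_1,i_2+\theta}-\mathbf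 x^{i_1+\theta,i_2+\theta})'$, and write $(\alpha^{j,l})=A_{\theta;i_1,i_2}^{-1}$, $(\beta^{j,l})=B_{\theta;i_1,i_2}^{-1}$ (these inverses exist for all large $n$; where an inverse does not exist it is replaced by the zero matrix). Let $$\begin{aligned}\bar\nabla_{\theta,\ell}X_{i_1,i_2}&=\beta^{\ell,1}(X_{i_1+\theta,i_2}-X_{i_1+\theta,i_2+\theta})+\beta^{\ell,2}(X_{i_1,i_2+\theta}-X_{i_1+\theta,i_2+\theta})\\&\quad-\alpha^{\ell,1}(X_{i_1+\theta,i_2}-X_{i_1,i_2})-\alpha^{\ell,2}(X_{i_1,i_2+\theta}-X_{i_1,i_2})=\sum_{0\le k_1,k_2\le1}c^{k_1,k_2}_{\theta,\ell;i_1,i_2}X_{i_1+\theta k_1,i_2+\theta k_2},\end{aligned}$$ $$\bar V_{\theta,\ell}=\sum_{1\le i_1,i_2\le n-\theta}(\bar\nabla_{\theta,\ell}X_{i_1,i_2})^2,$$ $$\bar f_{\theta,\ell}(\nu)=\beta_\nu^*\sum_{1\le i_1,i_2\le n-\theta}\ \sum_{(k_1,k_2)\ne(l_1,l_2)}c^{k_1,k_2}_{\theta,\ell;i_1,i_2}c^{l_1,l_2}_{\theta,\ell;i_1,i_2}\,G_\nu\bigl(\|\mathbf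 x^{i_1+\theta k_1,i_2+\theta k_2}-\mathbf x^{i_1+\theta l_1,i_2+\theta l_2}\|\bigr),$$ the inner sum being over $k_1,k_2,l_1,l_2\in\{0,1\}$. With $\ell^c=3-\ell$ and, at the point $(u,v)$, $\mathbf a=(\varphi_1^{(1,0)},\varphi_2^{(1,0)})'$ and $\mathbf b=(\varphi_1^{(0,1)},\varphi_2^{(0,1)})'$, let $$\mathcal J_{\nu,\ell}(u,v)=\frac{\{\varphi_{\ell^c}^{(0,1)}-\varphi_{\ell^c}^{(1,0)}\}^2}{\{\varphi_1^{(1,0)}\varphi_2^{(0,1)}-\varphi_1^{(0,1)}\varphi_2^{(1,0)}\}^2}\bigl\{-2G_\nu(\|\mathbf b\|)-2G_\nu(\|\mathbf a\|)+G_\nu(\|\mathbf a+\mathbf b\|)+G_\nu(\|\mathbf b-\mathbf a\|)\bigr\}.$$ Suppose that $\mathcal J_{\nu,\ell}$ is not identically $0$ on $[0,1]^2$. Then $\bar V_{\theta,\ell}$ is square integrable for every $n$ and, as $n\to\infty$, $$E(\bar V_{\theta,\ell})\sim\bar f_{\theta,\ell}(\nu)\asymp n^{4-2\nu},$$ where $a_n\sim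 b_n$ means $\lim a_n/b_n=1$ and $a_n\asymp b_n$ means $0<\liminf a_n/b_n\le\limsup a_n/b_n<\infty$. Suppose in addition that (i) for all nonnegative integers $a_1+a_2=4$, $\tilde K^{(a_1,a_2)}$ exists and is continuous on an open set containing $\{\mathbf x-\mathbf y:\mathbf x,\mathbf y\in\Delta,\ \mathbf x\ne\mathbf y\}$, and (ii) there is a constant $\tilde C$ with $|\tilde K^{(a_1,a_2)}(\mathbf x-\mathbf y)|\le\tilde C\|\mathbf x-\mathbf y\|^{2\nu-4}$ for all $a_1+a_2=4$ and all $\mathbf x,\mathbf y\in\Delta$ with $\mathbf x\ne\mathbf y$. Then, as $n\to\infty$, $$\operatorname{Var}\{\bar V_{\theta,\ell}/E(\bar V_{\theta,\ell})\}=\begin{cases}O(n^{-2}),&\nu\in(0,3/2),\\ O(n^{-2}\log n),&\nu=3/2,\\ O(n^{-8+4\nu}),&\nu\in(3/2,2),\end{cases}$$ and $\bar V_{\theta,\ell}/E(\bar V_{\theta,\ell})\to1$ almost surely. -/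

import Mathlib

open MeasureTheory ProbabilityTheory Filter Topology Asymptotics Set
open scoped Matrix

noncomputable section

namespace DeformedLattice

/-- The Euclidean plane. Coordinates (and all indices in `{1, 2}` of the mathematical text that
label coordinates) are numbered by `Fin 2`, so `0` is the first and `1` the second coordinate. -/
abbrev Plane : Type := EuclideanSpace ℝ (Fin 2)

/-! ### Partial derivatives -/

/-- The standard basis vector `e j`. -/
def basisVec (j : Fin 2) : Plane := EuclideanSpace.single j (1 : ℝ)

/-- The partial derivative with respect to the `j`-th coordinate. -/
def pderiv (j : Fin 2) (f : Plane → ℝ) (x : Plane) : ℝ := lineDeriv ℝ f x (basisVec j)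

/-- `∂^(a₁ + a₂) f / ∂x₁^a₁ ∂x₂^a₂`. -/
def mixedPartial (a₁ a₂ : ℕ) (f : Plane → ℝ) : Plane → ℝ :=
  (pderiv 0)^[a₁] ((pderiv 1)^[a₂] f)

/-- The derivative `∂^(a₁ + a₂) f / ∂x₁^a₁ ∂x₂^a₂` exists at every point of `U` (every one of the
successive partial derivatives exists) and is continuous on `U`. -/
structure HasContMixedPartialOn (a₁ a₂ : ℕ) (f : Plane → ℝ) (U : Set Plane) : Prop where
  exists_snd : ∀ k < a₂, ∀ x ∈ U, LineDifferentiableAt ℝ ((pderiv 1)^[k] f) x (basisVec 1)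
  exists_fst : ∀ k < a₁, ∀ x ∈ U,
    LineDifferentiableAt ℝ ((pderiv 0)^[k] ((pderiv 1)^[a₂] f)) x (basisVec 0)
  continuousOn : ContinuousOn (mixedPartial a₁ a₂ f) U

/-! ### The random field -/

section Field

variable {Ω : Type*} [MeasurableSpace Ω]

/-- The covariance function `K(x, y) = Cov(X(x), X(y))`. -/
def covFun (P : Measure Ω) (X : Plane → Ω → ℝ) (x y : Plane) : ℝ := cov[X x, X y; P]

/-- The function `h ↦ K(h, 0)`; for a stationary field it satisfies `covDiff (x - y) = K(x, y)`. -/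
def covDiff (P : Measure Ω) (X : Plane → Ω → ℝ) (h : Plane) : ℝ := covFun P X h 0

/-- A stationary, isotropic Gaussian random field on the plane: a Gaussian process, indexed by the
plane, with constant mean, whose covariance depends only on the distance of the two points. -/
structure IsStationaryIsotropicGaussian (P : Measure Ω) (X : Plane → Ω → ℝ) : Prop where
  gaussian : IsGaussianProcess X P
  mean_const : ∀ x y, P[X x] = P[X y]
  cov_dist : ∀ x y x' y', ‖x - y‖ = ‖x' - y'‖ → covFun P X x y = covFun P X x' y'

end Field

open Classical in
/-- The principal irregular term: `0` at `0`, and for `s > 0` equal to `s ^ (2 ν)` if `ν` is not an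
integer and to `s ^ (2 ν) * log s` if `ν` is an integer. -/
def G (ν s : ℝ) : ℝ :=
  if s = 0 then 0
  else if ∃ m : ℤ, (m : ℝ) = ν then s ^ (2 * ν) * Real.log s
  else s ^ (2 * ν)

/-- `K(x, y) = ∑_{j ≤ ⌊ν⌋} β j ‖x - y‖ ^ (2 j) + βs * G ν ‖x - y‖ + r(x, y)` with
`r(x, y) = O(‖x - y‖ ^ (2 ν + τ))` as `‖x - y‖ → 0`, for some `τ > 0`. -/
def HasIrregularExpansion (K : Plane → Plane → ℝ) (ν : ℝ) (β : ℕ → ℝ) (βs : ℝ) : Prop :=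
  ∃ r : Plane → Plane → ℝ,
    (∀ x y, K x y = ∑ j ∈ Finset.range (⌊ν⌋₊ + 1), β j * ‖x - y‖ ^ (2 * j)
      + βs * G ν ‖x - y‖ + r x y) ∧
    ∃ τ > 0, ∃ C : ℝ, ∃ δ > 0, ∀ x y, ‖x - y‖ < δ → |r x y| ≤ C * ‖x - y‖ ^ (2 * ν + τ)

/-! ### The deformation -/

/-- The unit square `[0, 1]²`. -/
def unitSquare : Set Plane := {x | ∀ j, x j ∈ Icc (0 : ℝ) 1}

/-- `φ` is a `C¹` diffeomorphism from the open set `D` onto its image `φ '' D` (so `φ` is `C¹` on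
`D` and has a `C¹` inverse on `φ '' D`), and the mixed second-order partial derivatives
`∂²φ_k/∂x_i∂x_j`, `i ≠ j`, of its components exist and are continuous on `D`. The
pure second-order derivatives are not needed, so every `C²` diffeomorphism is covered. -/
structure IsC2DiffeoOn (φ : Plane → Plane) (D : Set Plane) : Prop where
  isOpen : IsOpen D
  contDiffOn : ContDiffOn ℝ 1 φ D
  inverse : ∃ ψ : Plane → Plane, ContDiffOn ℝ 1 ψ (φ '' D) ∧ ∀ x ∈ D, ψ (φ x) = x
  mixed_exists : ∀ k i j : Fin 2, i ≠ j → ∀ x ∈ D,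
    LineDifferentiableAt ℝ (pderiv j fun z => φ z k) x (basisVec i)
  mixed_continuousOn : ∀ k i j : Fin 2, i ≠ j →
    ContinuousOn (pderiv i (pderiv j fun z => φ z k)) D

/-- The image `Δ` of the unit square. -/
def imageSquare (φ : Plane → Plane) : Set Plane := φ '' unitSquare

/-- The function `𝒥_{ν,ℓ}` at a point `p = (u, v)`; here `ℓ.rev` is the index other than `ℓ`. -/
def J (φ : Plane → Plane) (ν : ℝ) (ℓ : Fin 2) (p : Plane) : ℝ :=
  let du : Fin 2 → ℝ := fun j => pderiv 0 (fun z => φ z j) p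
  let dv : Fin 2 → ℝ := fun j => pderiv 1 (fun z => φ z j) p
  (dv ℓ.rev - du ℓ.rev) ^ 2 / (du 0 * dv 1 - dv 0 * du 1) ^ 2 *
    (-2 * G ν (√(∑ j, dv j ^ 2)) - 2 * G ν (√(∑ j, du j ^ 2))
      + G ν (√(∑ j, (du j + dv j) ^ 2)) + G ν (√(∑ j, (dv j - du j) ^ 2)))

/-! ### The deformed lattice and the quadratic variation -/

/-- The site `x^{i₁,i₂} = φ(i₁/n, i₂/n)`. -/
def site (φ : Plane → Plane) (n i₁ i₂ : ℕ) : Plane := φ !₂[(i₁ : ℝ) / n, (i₂ : ℝ) / n]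

/-- The matrix `A_{θ;i₁,i₂}`. -/
def matA (φ : Plane → Plane) (n θ i₁ i₂ : ℕ) : Matrix (Fin 2) (Fin 2) ℝ :=
  !![site φ n (i₁ + θ) i₂ 0 - site φ n i₁ i₂ 0, site φ n (i₁ + θ) i₂ 1 - site φ n i₁ i₂ 1;
     site φ n i₁ (i₂ + θ) 0 - site φ n i₁ i₂ 0, site φ n i₁ (i₂ + θ) 1 - site φ n i₁ i₂ 1]

/-- The matrix `B_{θ;i₁,i₂}`. -/
def matB (φ : Plane → Plane) (n θ i₁ i₂ : ℕ) : Matrix (Fin 2) (Fin 2) ℝ :=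
  !![site φ n (i₁ + θ) i₂ 0 - site φ n (i₁ + θ) (i₂ + θ) 0,
       site φ n (i₁ + θ) i₂ 1 - site φ n (i₁ + θ) (i₂ + θ) 1;
     site φ n i₁ (i₂ + θ) 0 - site φ n (i₁ + θ) (i₂ + θ) 0,
       site φ n i₁ (i₂ + θ) 1 - site φ n (i₁ + θ) (i₂ + θ) 1]

/-- The difference `∇̄_{θ,ℓ} X_{i₁,i₂}` of the two discrete gradients (`ℓ`-th coordinate). For a
singular `matA` or `matB`, which can happen for finitely many `n` only, the matrix inverse is `0`
by convention. -/
def nablaBar (φ : Plane → Plane) (n θ : ℕ) (ℓ : Fin 2) (i₁ i₂ : ℕ) (f : Plane → ℝ) : ℝ :=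
  (matB φ n θ i₁ i₂)⁻¹ ℓ 0 * (f (site φ n (i₁ + θ) i₂) - f (site φ n (i₁ + θ) (i₂ + θ)))
  + (matB φ n θ i₁ i₂)⁻¹ ℓ 1 * (f (site φ n i₁ (i₂ + θ)) - f (site φ n (i₁ + θ) (i₂ + θ)))
  - (matA φ n θ i₁ i₂)⁻¹ ℓ 0 * (f (site φ n (i₁ + θ) i₂) - f (site φ n i₁ i₂))
  - (matA φ n θ i₁ i₂)⁻¹ ℓ 1 * (f (site φ n i₁ (i₂ + θ)) - f (site φ n i₁ i₂))

/-- The coefficient `c^{k₁,k₂}_{θ,ℓ;i₁,i₂}` of `X_{i₁+θk₁,i₂+θk₂}` in `nablaBar`. -/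
def coeff (φ : Plane → Plane) (n θ : ℕ) (ℓ : Fin 2) (i₁ i₂ : ℕ) (k : Fin 2 × Fin 2) : ℝ :=
  !![(matA φ n θ i₁ i₂)⁻¹ ℓ 0 + (matA φ n θ i₁ i₂)⁻¹ ℓ 1,
       (matB φ n θ i₁ i₂)⁻¹ ℓ 1 - (matA φ n θ i₁ i₂)⁻¹ ℓ 1;
     (matB φ n θ i₁ i₂)⁻¹ ℓ 0 - (matA φ n θ i₁ i₂)⁻¹ ℓ 0,
       -(matB φ n θ i₁ i₂)⁻¹ ℓ 0 - (matB φ n θ i₁ i₂)⁻¹ ℓ 1] k.1 k.2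

theorem nablaBar_eq_sum (φ : Plane → Plane) (n θ : ℕ) (ℓ : Fin 2) (i₁ i₂ : ℕ) (f : Plane → ℝ) :
    nablaBar φ n θ ℓ i₁ i₂ f = ∑ k : Fin 2 × Fin 2,
      coeff φ n θ ℓ i₁ i₂ k * f (site φ n (i₁ + θ * k.1) (i₂ + θ * k.2)) := by
  simp [nablaBar, coeff, Fintype.sum_prod_type, Fin.sum_univ_two]
  ring

/-- The second-order quadratic variation `V̄_{θ,ℓ}` of a function `f` on the plane, from the sites
`x^{i₁,i₂}`, `1 ≤ i₁, i₂ ≤ n`. -/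
def quadVar (φ : Plane → Plane) (n θ : ℕ) (ℓ : Fin 2) (f : Plane → ℝ) : ℝ :=
  ∑ i₁ ∈ Finset.Icc 1 (n - θ), ∑ i₂ ∈ Finset.Icc 1 (n - θ), nablaBar φ n θ ℓ i₁ i₂ f ^ 2

/-- The quadratic variation of the random field `X`, as a random variable. -/
def fieldQuadVar {Ω : Type*} (X : Plane → Ω → ℝ) (φ : Plane → Plane) (n θ : ℕ) (ℓ : Fin 2)
    (ω : Ω) : ℝ :=
  quadVar φ n θ ℓ fun x => X x ω

/-- The function `f̄_{θ,ℓ}(ν)`. -/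
def fBar (φ : Plane → Plane) (ν βs : ℝ) (n θ : ℕ) (ℓ : Fin 2) : ℝ :=
  βs * ∑ i₁ ∈ Finset.Icc 1 (n - θ), ∑ i₂ ∈ Finset.Icc 1 (n - θ),
    ∑ k : Fin 2 × Fin 2, ∑ l : Fin 2 × Fin 2 with k ≠ l,
      coeff φ n θ ℓ i₁ i₂ k * coeff φ n θ ℓ i₁ i₂ l *
        G ν ‖site φ n (i₁ + θ * k.1) (i₂ + θ * k.2) - site φ n (i₁ + θ * l.1) (i₂ + θ * l.2)‖

end DeformedLattice

end

/-! ### Moments, rotation and exponential tails of Gaussian quadratic forms. -/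

section GaussianQuadraticForms

set_option linter.unusedSectionVars false

variable {Ω : Type*} [MeasurableSpace Ω] {P : Measure Ω} [IsProbabilityMeasure P]

/-! On each cell the statistic is a linear form in four field values. The two discrete gradients
agree on affine functions, so its weights annihilate constants and, once both corner triangles are
nondegenerate, the coordinates too. Everything rests on this cancellation.

Mean. The second moment of a cell statistic is a double sum of the covariance against these weights.
The polynomial part of the expansion has degree at most two in the distance and drops out, leaving
`βs * gForm` and a remainder smaller by `n ^ (-τ)`. The form `gForm` is exactly homogeneous of
degree `2 ν` under dilation: for `ν = 1` the logarithm produces only a multiple of the squared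
distance, which is cancelled (`gForm_add_smul`). Rescaled to unit size, the cells converge uniformly
to the parallelograms spanned by the partial derivatives of `φ`, where `gForm` equals `2 * J`. Each
cell therefore contributes `O(n ^ (2 - 2 * ν))`. For the lower bound, a covariance is positive
semidefinite; testing it on shrinking copies of a configuration shows `0 ≤ βs * gForm`
(`HasIrregularExpansion.mul_gForm_nonneg`). Cells thus cannot offset one another asymptotically, and
one point with `J ≠ 0` supplies a positive proportion of cells bounded away from zero.

Variance. For centred jointly Gaussian variables the variance of a sum of squares is twice the sum
of the squared covariances. For cells at lattice distance `m` the covariance is `O(n ^ (2 - 2 * ν) *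
(1 + m) ^ (2 * ν - 4))` (`IsStationaryIsotropicGaussian.exists_covariance_cellDiff_le`): near cells
by comparison with variances, far cells by a Taylor expansion in which every term of degree at most
three is cancelled. The expansion runs along segments that may leave the set of differences where
regularity is assumed; isotropy transfers regularity and bounds to every vector of the same length
(`exists_radial_fourth_deriv_bound`). Since `O(m)` cells lie at distance `m`, the relative variance
is at most a constant times `n ^ (-2)` times the sum of `m ^ (4 * ν - 7)`, whence the three regimes.

Almost sure convergence. The variance bounds are not summable for `ν ≥ 7/4`. Rotating the Gaussian
vector to independent coordinates gives an exponential tail on the scale of the Frobenius norm of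
its covariance matrix (`measureReal_abs_sum_sq_sub_integral_ge_le`). The mean exceeds that scale by
a positive power of `n`, so Borel–Cantelli applies for all `ν < 2`. -/

theorem iteratedDeriv_four_exp_sq (v : ℝ) :
    iteratedDeriv 4 (fun t : ℝ => Real.exp (v * t ^ 2 / 2)) 0 = 3 * v ^ 2 := by
  have key : ∀ p q : ℝ → ℝ, (∀ t, HasDerivAt p (q t - v * t * p t) t) →
      deriv (fun t => p t * Real.exp (v * t ^ 2 / 2)) =
        fun t => q t * Real.exp (v * t ^ 2 / 2) := by
    intro p q h
    funext t
    have h1 : HasDerivAt (fun t : ℝ => v * t ^ 2 / 2) (v * t) t := by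
      have := ((hasDerivAt_pow 2 t).const_mul v).div_const 2
      refine this.congr_deriv ?_
      push_cast
      ring
    have := (h t).mul h1.exp
    refine (this.congr_deriv ?_).deriv
    ring
  have e0 : (fun t : ℝ => Real.exp (v * t ^ 2 / 2)) =
      fun t => (fun _ => (1 : ℝ)) t * Real.exp (v * t ^ 2 / 2) := by
    simp only [one_mul]
  have hp1 : ∀ t : ℝ, HasDerivAt (fun s : ℝ => v * s) v t := fun t => by
    simpa using (hasDerivAt_id t).const_mul v
  have hp2 : ∀ t : ℝ, HasDerivAt (fun s : ℝ => v + v ^ 2 * s ^ 2) (2 * v ^ 2 * t) t := fun t => by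
    have := ((hasDerivAt_pow 2 t).const_mul (v ^ 2)).const_add v
    refine this.congr_deriv ?_
    simp; ring
  have hp3 : ∀ t : ℝ, HasDerivAt (fun s : ℝ => 3 * v ^ 2 * s + v ^ 3 * s ^ 3)
      (3 * v ^ 2 + 3 * v ^ 3 * t ^ 2) t := fun t => by
    have := ((hasDerivAt_id t).const_mul (3 * v ^ 2)).add
      ((hasDerivAt_pow 3 t).const_mul (v ^ 3))
    refine this.congr_deriv ?_
    simp; ring
  rw [iteratedDeriv_succ', iteratedDeriv_succ', iteratedDeriv_succ', iteratedDeriv_succ',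
    iteratedDeriv_zero, e0,
    key (fun _ => 1) (fun s => v * s) (fun t => by simpa using hasDerivAt_const t (1 : ℝ)),
    key (fun s => v * s) (fun s => v + v ^ 2 * s ^ 2)
      (fun t => (hp1 t).congr_deriv (by ring)),
    key (fun s => v + v ^ 2 * s ^ 2) (fun s => 3 * v ^ 2 * s + v ^ 3 * s ^ 3)
      (fun t => (hp2 t).congr_deriv (by ring)),
    key (fun s => 3 * v ^ 2 * s + v ^ 3 * s ^ 3)
      (fun s => 3 * v ^ 2 + 6 * v ^ 3 * s ^ 2 + v ^ 4 * s ^ 4)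
      (fun t => (hp3 t).congr_deriv (by ring))]
  simp

theorem integral_pow_four_of_hasGaussianLaw {Y : Ω → ℝ} (hY : HasGaussianLaw Y P)
    (h0 : P[Y] = 0) : ∫ ω, Y ω ^ 4 ∂P = 3 * (∫ ω, Y ω ^ 2 ∂P) ^ 2 := by
  have hv : Var[Y; P] = ∫ ω, Y ω ^ 2 ∂P := by
    rw [variance_of_integral_eq_zero hY.aemeasurable h0]
  have hmap := hY.map_eq_gaussianReal
  rw [h0] at hmap
  have hvn : (Var[Y; P].toNNReal : ℝ) = Var[Y; P] := Real.coe_toNNReal _ (variance_nonneg _ _)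
  have hm : mgf Y P = fun t => Real.exp (Var[Y; P] * t ^ 2 / 2) := by
    funext t
    rw [mgf_gaussianReal hmap, hvn]
    simp
  have hint : integrableExpSet Y P = univ := by
    ext t
    simp only [integrableExpSet, mem_ofPred_eq, mem_univ, iff_true]
    have := integrable_exp_mul_gaussianReal (μ := 0) (v := Var[Y; P].toNNReal) t
    rw [← hmap] at this
    exact this.comp_aemeasurable hY.aemeasurable
  have := iteratedDeriv_mgf_zero (X := Y) (μ := P) (by simp [hint]) 4
  rw [hm, iteratedDeriv_four_exp_sq, hv] at this
  simpa using this.symm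

theorem HasGaussianLaw.memLp_sq {Y : Ω → ℝ} (hY : HasGaussianLaw Y P) :
    MemLp (fun ω => Y ω ^ 2) 2 P := by
  have h4 : MemLp Y 4 P := hY.memLp (by simp)
  have : MemLp (fun ω => Y ω * Y ω) 2 P := by
    have : ENNReal.HolderTriple 4 4 2 := ⟨by
      rw [← two_mul, show (4 : ENNReal) = 2 * 2 by norm_num, ENNReal.mul_inv (by simp) (by simp),
        ← mul_assoc, ENNReal.mul_inv_cancel (by simp) (by simp), one_mul]⟩
    exact h4.mul h4
  simpa [sq] using this

/-- Polarization: `12 Y² Z² = (Y + Z)⁴ + (Y - Z)⁴ - 2 Y⁴ - 2 Z⁴`, and each of the four variables on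
the right is centred Gaussian, with fourth moment three times its squared variance. -/
theorem covariance_sq_sq {Y Z : Ω → ℝ} (h : HasGaussianLaw (fun ω => (Y ω, Z ω)) P)
    (hY : P[Y] = 0) (hZ : P[Z] = 0) :
    cov[fun ω => Y ω ^ 2, fun ω => Z ω ^ 2; P] = 2 * cov[Y, Z; P] ^ 2 := by
  have gY := h.fst
  have gZ := h.snd
  have y2 := gY.memLp_two
  have z2 := gZ.memLp_two
  have iY := y2.integrable one_le_two
  have iZ := z2.integrable one_le_two
  have qY := HasGaussianLaw.memLp_sq gY
  have qZ := HasGaussianLaw.memLp_sq gZ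
  rw [covariance_eq_sub qY qZ, covariance_eq_sub y2 z2, hY, hZ]
  have hp : ∫ ω, (Y ω + Z ω) ^ 4 ∂P = 3 * (∫ ω, (Y ω + Z ω) ^ 2 ∂P) ^ 2 :=
    integral_pow_four_of_hasGaussianLaw h.fun_add (by
      change ∫ ω, (Y ω + Z ω) ∂P = 0
      rw [integral_add iY iZ, hY, hZ, add_zero])
  have hm : ∫ ω, (Y ω - Z ω) ^ 4 ∂P = 3 * (∫ ω, (Y ω - Z ω) ^ 2 ∂P) ^ 2 :=
    integral_pow_four_of_hasGaussianLaw h.fun_sub (by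
      change ∫ ω, (Y ω - Z ω) ∂P = 0
      rw [integral_sub iY iZ, hY, hZ, sub_zero])
  have h4Y := integral_pow_four_of_hasGaussianLaw gY hY
  have h4Z := integral_pow_four_of_hasGaussianLaw gZ hZ
  have iYZ : Integrable (fun ω => Y ω * Z ω) P := y2.integrable_mul z2
  have iY2 : Integrable (fun ω => Y ω ^ 2) P := qY.integrable one_le_two
  have iZ2 : Integrable (fun ω => Z ω ^ 2) P := qZ.integrable one_le_two
  have iY4 : Integrable (fun ω => Y ω ^ 4) P := by
    have := qY.integrable_sq
    simpa [← pow_mul] using this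
  have iZ4 : Integrable (fun ω => Z ω ^ 4) P := by
    have := qZ.integrable_sq
    simpa [← pow_mul] using this
  have iYZ2 : Integrable (fun ω => Y ω ^ 2 * Z ω ^ 2) P := qY.integrable_mul qZ
  have iP4 : Integrable (fun ω => (Y ω + Z ω) ^ 4) P := by
    have := (HasGaussianLaw.memLp_sq h.fun_add).integrable_sq
    simpa [← pow_mul] using this
  have iM4 : Integrable (fun ω => (Y ω - Z ω) ^ 4) P := by
    have := (HasGaussianLaw.memLp_sq h.fun_sub).integrable_sq
    simpa [← pow_mul] using this
  have e1 : ∫ ω, (Y ω + Z ω) ^ 2 ∂P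
      = ∫ ω, Y ω ^ 2 ∂P + 2 * ∫ ω, Y ω * Z ω ∂P + ∫ ω, Z ω ^ 2 ∂P := by
    rw [← integral_const_mul, ← integral_add iY2 (iYZ.const_mul 2),
      ← integral_add (by exact iY2.add (iYZ.const_mul 2)) iZ2]
    congr 1; funext ω; ring
  have e2 : ∫ ω, (Y ω - Z ω) ^ 2 ∂P
      = ∫ ω, Y ω ^ 2 ∂P - 2 * ∫ ω, Y ω * Z ω ∂P + ∫ ω, Z ω ^ 2 ∂P := by
    rw [← integral_const_mul, ← integral_sub iY2 (iYZ.const_mul 2),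
      ← integral_add (by exact iY2.sub (iYZ.const_mul 2)) iZ2]
    congr 1; funext ω; ring
  have e3 : 12 * ∫ ω, Y ω ^ 2 * Z ω ^ 2 ∂P = ∫ ω, (Y ω + Z ω) ^ 4 ∂P + ∫ ω, (Y ω - Z ω) ^ 4 ∂P
      - 2 * ∫ ω, Y ω ^ 4 ∂P - 2 * ∫ ω, Z ω ^ 4 ∂P := by
    rw [← integral_const_mul, ← integral_const_mul, ← integral_const_mul,
      ← integral_add iP4 iM4, ← integral_sub (by exact iP4.add iM4) (iY4.const_mul 2),
      ← integral_sub (by exact (iP4.add iM4).sub (iY4.const_mul 2)) (iZ4.const_mul 2)]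
    congr 1; funext ω; ring
  rw [hp, hm, h4Y, h4Z, e1, e2] at e3
  have e4 : ∫ ω, ((fun ω => Y ω ^ 2) * fun ω => Z ω ^ 2) ω ∂P = ∫ ω, Y ω ^ 2 * Z ω ^ 2 ∂P := rfl
  have e5 : ∫ ω, (Y * Z) ω ∂P = ∫ ω, Y ω * Z ω ∂P := rfl
  rw [e4, e5]
  linarith

variable {ι : Type*} [Fintype ι]

theorem variance_sum_sq {Y : ι → Ω → ℝ} (hY : HasGaussianLaw (fun ω i => Y i ω) P)
    (h0 : ∀ i, P[Y i] = 0) :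
    Var[fun ω => ∑ i, Y i ω ^ 2; P] = 2 * ∑ i, ∑ j, cov[Y i, Y j; P] ^ 2 := by
  have hm : ∀ i, MemLp (fun ω => Y i ω ^ 2) 2 P := fun i => HasGaussianLaw.memLp_sq (hY.eval i)
  rw [variance_fun_sum hm, Finset.mul_sum]
  refine Finset.sum_congr rfl fun i _ => ?_
  rw [Finset.mul_sum]
  exact Finset.sum_congr rfl fun j _ => covariance_sq_sq (hY.prodMk i j) (h0 i) (h0 j)

theorem integral_exp_mul_sq_gaussianReal {v : NNReal} {s : ℝ} (hs : 2 * s * v < 1) :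
    ∫ x, Real.exp (s * x ^ 2) ∂(gaussianReal 0 v) = (√(1 - 2 * s * v))⁻¹ := by
  by_cases hv : v = 0
  · simp [hv]
  have hv' : (0 : ℝ) < v := by positivity
  rw [integral_gaussianReal_eq_integral_smul hv]
  have : ∀ x : ℝ, gaussianPDFReal 0 v x • Real.exp (s * x ^ 2)
      = (√(2 * Real.pi * v))⁻¹ * Real.exp (-((1 - 2 * s * v) / (2 * v)) * x ^ 2) := by
    intro x
    rw [gaussianPDFReal, smul_eq_mul, mul_assoc, ← Real.exp_add]
    congr 2
    field_simp
    ring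
  simp_rw [this]
  rw [integral_const_mul, integral_gaussian, ← Real.sqrt_inv, ← Real.sqrt_inv,
    ← Real.sqrt_mul (by positivity)]
  congr 1
  have : 1 - 2 * s * v ≠ 0 := by linarith
  field_simp

/-- First-order expansion of `log (1 - 2 x)`: its error is at most `8 x²` for `|x| ≤ 1/4`, and the
square root halves it. -/
theorem inv_sqrt_le_exp {x : ℝ} (hx : |x| ≤ 1 / 4) :
    (√(1 - 2 * x))⁻¹ ≤ Real.exp (x + 4 * x ^ 2) := by
  obtain ⟨h1, h2⟩ := abs_le.1 hx
  have h := Real.abs_log_sub_add_sum_range_le (x := 2 * x) (by rw [abs_mul]; norm_num; linarith) 1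
  have h3 : |2 * x| ^ (1 + 1) / (1 - |2 * x|) ≤ 8 * x ^ 2 := by
    rw [abs_mul, abs_two, div_le_iff₀ (by linarith)]
    have : |x| ^ 2 = x ^ 2 := sq_abs x
    have e : (2 * |x|) ^ (1 + 1) = 4 * x ^ 2 := by rw [← this]; ring
    rw [e]
    nlinarith [mul_nonneg (sq_nonneg x) (sub_nonneg.2 hx)]
  have h4 := (abs_le.1 (h.trans h3)).1
  simp only [Finset.range_one, Finset.sum_singleton, zero_add, pow_one, Nat.cast_zero,
    div_one] at h4
  have hp : 0 < 1 - 2 * x := by linarith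
  rw [← Real.log_le_iff_le_exp (by positivity), Real.log_inv, Real.log_sqrt hp.le]
  linarith

/-- Centring cancels the linear term of the exponent in `inv_sqrt_le_exp`, so only a term quadratic
in `s` survives. -/
theorem mgf_sq_sub_variance_le {Z : Ω → ℝ} (hZ : HasGaussianLaw Z P) (h0 : P[Z] = 0) {s : ℝ}
    (hs : |s * Var[Z; P]| ≤ 1 / 4) :
    0 < mgf (fun ω => Z ω ^ 2 - Var[Z; P]) P s ∧
    mgf (fun ω => Z ω ^ 2 - Var[Z; P]) P s ≤ Real.exp (4 * s ^ 2 * Var[Z; P] ^ 2) := by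
  set v := Var[Z; P] with hv
  have hvn : (v.toNNReal : ℝ) = v := Real.coe_toNNReal _ (variance_nonneg _ _)
  have hmap := hZ.map_eq_gaussianReal
  rw [h0] at hmap
  have hlt : 2 * s * (v.toNNReal : ℝ) < 1 := by
    rw [hvn]; have := (abs_le.1 hs).2; linarith
  have e : mgf (fun ω => Z ω ^ 2 - v) P s = Real.exp (-(s * v)) * (√(1 - 2 * (s * v)))⁻¹ := by
    have h1 : ∫ ω, Real.exp (s * Z ω ^ 2) ∂P = (√(1 - 2 * (s * v)))⁻¹ := by
      have := integral_exp_mul_sq_gaussianReal hlt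
      rw [hvn, ← hmap, integral_map hZ.aemeasurable (by fun_prop)] at this
      rw [this, mul_assoc]
    rw [mgf, ← h1, ← integral_const_mul]
    congr 1; funext ω
    rw [← Real.exp_add]; ring_nf
  have hpos : 0 < 1 - 2 * (s * v) := by rw [hvn] at hlt; linarith
  rw [e]
  refine ⟨by positivity, ?_⟩
  calc _ ≤ Real.exp (-(s * v)) * Real.exp (s * v + 4 * (s * v) ^ 2) := by
        gcongr; exact inv_sqrt_le_exp hs
    _ = _ := by rw [← Real.exp_add]; congr 1; ring

/-- A centred Gaussian vector, rotated to have independent coordinates. -/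
theorem exists_independent_rotation [DecidableEq ι] {Y : ι → Ω → ℝ}
    (hY : HasGaussianLaw (fun ω i => Y i ω) P) (h0 : ∀ i, P[Y i] = 0) :
    ∃ Z : ι → Ω → ℝ, iIndepFun Z P ∧ (∀ k, HasGaussianLaw (Z k) P) ∧ (∀ k, P[Z k] = 0) ∧
      (∀ ω, ∑ k, Z k ω ^ 2 = ∑ i, Y i ω ^ 2) ∧
      ∑ k, Var[Z k; P] ^ 2 = ∑ i, ∑ j, cov[Y i, Y j; P] ^ 2 := by
  have m2 : ∀ i, MemLp (Y i) 2 P := fun i => (hY.eval i).memLp_two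
  let S : Matrix ι ι ℝ := Matrix.of fun i j => cov[Y i, Y j; P]
  have hSa : ∀ i j, S i j = cov[Y i, Y j; P] := fun i j => rfl
  have hS : S.IsHermitian := by
    ext i j
    simp [hSa, Matrix.conjTranspose_apply, covariance_comm (Y i)]
  -- In an orthonormal eigenbasis of the covariance matrix the coordinates are uncorrelated, hence
  -- independent by joint Gaussianity; orthogonality preserves the sum of squares.
  let U : Matrix ι ι ℝ := (hS.eigenvectorUnitary : Matrix ι ι ℝ)
  have hUU : U * Uᵀ = 1 := by
    have := Unitary.coe_mul_star_self hS.eigenvectorUnitary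
    simpa [U, Matrix.star_eq_conjTranspose, Matrix.conjTranspose_eq_transpose_of_trivial] using this
  have hUU' : Uᵀ * U = 1 := mul_eq_one_comm.1 hUU
  have hspec : S = U * Matrix.diagonal hS.eigenvalues * Uᵀ := by
    have := hS.spectral_theorem
    rw [Unitary.conjStarAlgAut_apply] at this
    simpa [U, Matrix.star_eq_conjTranspose, Matrix.conjTranspose_eq_transpose_of_trivial,
      Function.comp_def] using this
  have hdiag : Uᵀ * S * U = Matrix.diagonal hS.eigenvalues := by
    calc Uᵀ * S * U = (Uᵀ * U) * Matrix.diagonal hS.eigenvalues * (Uᵀ * U) := by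
          conv_lhs => rw [hspec]
          simp only [Matrix.mul_assoc]
      _ = _ := by simp [hUU']
  let Z : ι → Ω → ℝ := fun k ω => ∑ i, U i k * Y i ω
  have hcov : ∀ k l, cov[Z k, Z l; P] = (Matrix.diagonal hS.eigenvalues : Matrix ι ι ℝ) k l := by
    intro k l
    rw [← hdiag]
    simp only [Z]
    rw [covariance_fun_sum_fun_sum (fun i => (m2 i).const_mul _) (fun i => (m2 i).const_mul _)]
    simp only [covariance_const_mul_left, covariance_const_mul_right, Matrix.mul_apply,
      Finset.sum_mul, Matrix.transpose_apply, hSa]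
    rw [Finset.sum_comm]
    refine Finset.sum_congr rfl fun i _ => Finset.sum_congr rfl fun j _ => ?_
    ring
  have hZ : HasGaussianLaw (fun ω k => Z k ω) P := by
    have := hY.map_fun (LinearMap.toContinuousLinearMap (Matrix.toLin' Uᵀ))
    have e : (fun ω k => Z k ω) = fun ω =>
        LinearMap.toContinuousLinearMap (Matrix.toLin' Uᵀ) fun i => Y i ω := by
      funext ω k
      simp [Z, Matrix.mulVec, dotProduct]
    rw [e]
    exact this
  have hvar : ∀ k, Var[Z k; P] = hS.eigenvalues k := fun k => by
    rw [← covariance_self (hZ.eval k).aemeasurable]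
    rw [hcov]; simp
  refine ⟨Z, hZ.iIndepFun_of_covariance_eq_zero fun i j hij => ?_, fun k => hZ.eval k,
    fun k => ?_, fun ω => ?_, ?_⟩
  · rw [hcov, Matrix.diagonal_apply_ne _ hij]
  · simp only [Z]
    rw [integral_finsetSum _ fun i _ => ((m2 i).integrable one_le_two).const_mul _]
    refine Finset.sum_eq_zero fun i _ => ?_
    rw [integral_const_mul, h0, mul_zero]
  · have : ∀ y : ι → ℝ, (Uᵀ *ᵥ y) ⬝ᵥ (Uᵀ *ᵥ y) = y ⬝ᵥ y := fun y => by
      rw [Matrix.dotProduct_mulVec, Matrix.vecMul_mulVec, Matrix.transpose_transpose, hUU,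
        Matrix.vecMul_one]
    simpa [dotProduct, Matrix.mulVec, sq, Z] using this (fun i => Y i ω)
  -- The squared Frobenius norm is the trace of `S * S`, evaluated once in the original basis and
  -- once in the eigenbasis.
  · have h1 : (S * S).trace = ∑ i, ∑ j, cov[Y i, Y j; P] ^ 2 := by
      simp only [Matrix.trace, Matrix.diag_apply, Matrix.mul_apply, hSa]
      refine Finset.sum_congr rfl fun i _ => Finset.sum_congr rfl fun j _ => ?_
      rw [sq, covariance_comm (Y j) (Y i)]
    have h2 : (S * S).trace =
        (Matrix.diagonal hS.eigenvalues * Matrix.diagonal hS.eigenvalues).trace := by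
      rw [← hdiag]
      calc (S * S).trace = (U * (Uᵀ * S * U * (Uᵀ * S))).trace := by
            congr 1
            calc S * S = (U * Uᵀ) * S * (U * Uᵀ) * S := by rw [hUU]; simp
              _ = _ := by simp only [Matrix.mul_assoc]
        _ = _ := by rw [Matrix.trace_mul_comm]; simp only [Matrix.mul_assoc]
    rw [← h1, h2, Matrix.diagonal_mul_diagonal, Matrix.trace_diagonal]
    exact Finset.sum_congr rfl fun k _ => by rw [hvar, sq]

/-- Chernoff's bound at `s = ±1 / (4 F)`. As `F` dominates every eigenvalue, each factor of the
moment generating function is within range, and their product is at most `exp (4 s² F²) = exp (1/4)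
≤ 2`. The two tails give the factor `4`. -/
theorem measureReal_abs_sum_sq_sub_integral_ge_le {Y : ι → Ω → ℝ}
    (hY : HasGaussianLaw (fun ω i => Y i ω) P) (h0 : ∀ i, P[Y i] = 0) {F : ℝ} (hF : 0 < F)
    (hcov : ∑ i, ∑ j, cov[Y i, Y j; P] ^ 2 ≤ F ^ 2) (t : ℝ) :
    P.real {ω | t ≤ |∑ i, Y i ω ^ 2 - ∫ ω', ∑ i, Y i ω' ^ 2 ∂P|} ≤
      4 * Real.exp (-t / (4 * F)) := by
  classical
  obtain ⟨Z, hind, hG, hZ0, hsum, hvar⟩ := exists_independent_rotation hY h0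
  rw [← hvar] at hcov
  simp_rw [← hsum]
  have hq : ∀ k, MemLp (fun ω => Z k ω ^ 2) 2 P := fun k => HasGaussianLaw.memLp_sq (hG k)
  have hE : ∫ ω', ∑ k, Z k ω' ^ 2 ∂P = ∑ k, Var[Z k; P] := by
    rw [integral_finsetSum _ fun k _ => (hq k).integrable one_le_two]
    refine Finset.sum_congr rfl fun k _ => ?_
    rw [variance_of_integral_eq_zero (hG k).aemeasurable (hZ0 k)]
  rw [hE]
  let W : ι → Ω → ℝ := fun k ω => Z k ω ^ 2 - Var[Z k; P]
  have hW : iIndepFun W P :=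
    hind.comp (fun k x => x ^ 2 - Var[Z k; P]) fun k => by fun_prop
  have hWm : ∀ k, AEMeasurable (W k) P := fun k =>
    ((hG k).aemeasurable.pow_const 2).sub_const _
  have hsmall : ∀ k, Var[Z k; P] ≤ F := fun k => by
    refine le_of_sq_le_sq ?_ hF.le
    exact (Finset.single_le_sum (f := fun k => Var[Z k; P] ^ 2) (fun _ _ => sq_nonneg _)
      (Finset.mem_univ k)).trans hcov
  have hmgf : ∀ s : ℝ, |s| = 1 / (4 * F) →
      0 < mgf (∑ k, W k) P s ∧ mgf (∑ k, W k) P s ≤ 2 := by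
    intro s hs
    have hk : ∀ k, |s * Var[Z k; P]| ≤ 1 / 4 := fun k => by
      rw [abs_mul, hs, abs_of_nonneg (variance_nonneg _ _), div_mul_eq_mul_div, one_mul,
        div_le_iff₀ (by positivity)]
      linarith [hsmall k]
    rw [hW.mgf_sum₀ hWm]
    refine ⟨Finset.prod_pos fun k _ => (mgf_sq_sub_variance_le (hG k) (hZ0 k) (hk k)).1, ?_⟩
    calc ∏ k, mgf (W k) P s ≤ ∏ k, Real.exp (4 * s ^ 2 * Var[Z k; P] ^ 2) :=
          Finset.prod_le_prod (fun k _ => (mgf_sq_sub_variance_le (hG k) (hZ0 k) (hk k)).1.le)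
            fun k _ => (mgf_sq_sub_variance_le (hG k) (hZ0 k) (hk k)).2
      _ = Real.exp (4 * s ^ 2 * ∑ k, Var[Z k; P] ^ 2) := by rw [← Real.exp_sum, Finset.mul_sum]
      _ ≤ Real.exp (1 / 4) := by
          gcongr
          rw [← sq_abs s, hs]
          calc 4 * (1 / (4 * F)) ^ 2 * ∑ k, Var[Z k; P] ^ 2
              ≤ 4 * (1 / (4 * F)) ^ 2 * F ^ 2 := by gcongr
            _ = 1 / 4 := by field_simp
      _ ≤ 2 := by
          rw [← Real.le_log_iff_exp_le (by norm_num)]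
          linarith [Real.log_two_gt_d9]
  -- A non-integrable function has integral `0` by convention, so positivity of the moment
  -- generating function already proves integrability.
  have hint : ∀ s : ℝ, |s| = 1 / (4 * F) →
      Integrable (fun ω => Real.exp (s * (∑ k, W k) ω)) P := fun s hs => by
    by_contra hni
    exact (hmgf s hs).1.ne' (integral_undef hni)
  have hs1 : |1 / (4 * F)| = 1 / (4 * F) := abs_of_pos (by positivity)
  have hs2 : |-(1 / (4 * F))| = 1 / (4 * F) := by rw [abs_neg, hs1]
  have b1 := measure_ge_le_exp_mul_mgf (X := ∑ k, W k) (μ := P) t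
    (by positivity : 0 ≤ 1 / (4 * F)) (hint _ hs1)
  have b2 := measure_le_le_exp_mul_mgf (X := ∑ k, W k) (μ := P) (-t)
    (by have : 0 < 1 / (4 * F) := by positivity
        linarith : -(1 / (4 * F)) ≤ 0) (hint _ hs2)
  have hsub : {ω | t ≤ |∑ k, Z k ω ^ 2 - ∑ k, Var[Z k; P]|} ⊆
      {ω | t ≤ (∑ k, W k) ω} ∪ {ω | (∑ k, W k) ω ≤ -t} := by
    intro ω hω
    have e : (∑ k, W k) ω = ∑ k, Z k ω ^ 2 - ∑ k, Var[Z k; P] := by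
      simp [W, Finset.sum_apply]
    simp only [mem_ofPred_eq, mem_union, e] at hω ⊢
    rcases le_abs.1 hω with h | h
    · exact Or.inl h
    · exact Or.inr (by linarith)
  have e1 : -(1 / (4 * F)) * t = -t / (4 * F) := by ring
  have e2 : - -(1 / (4 * F)) * -t = -t / (4 * F) := by ring
  rw [e1] at b1
  rw [e2] at b2
  have hexp := Real.exp_pos (-t / (4 * F))
  calc _ ≤ P.real ({ω | t ≤ (∑ k, W k) ω} ∪ {ω | (∑ k, W k) ω ≤ -t}) := measureReal_mono hsub
    _ ≤ _ := measureReal_union_le _ _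
    _ ≤ Real.exp (-t / (4 * F)) * 2 + Real.exp (-t / (4 * F)) * 2 := by
        refine add_le_add (b1.trans ?_) (b2.trans ?_)
        · gcongr; exact (hmgf _ hs1).2
        · gcongr; exact (hmgf _ hs2).2
    _ = _ := by ring

end GaussianQuadraticForms

namespace DeformedLattice

/-! ### Iterated directional derivatives in terms of coordinate partial derivatives. -/

section DirectionalDerivatives

variable {f g : Plane → ℝ} {V : Set Plane}

theorem pderiv_eq_fderiv {x : Plane} (j : Fin 2) (h : DifferentiableAt ℝ f x) :
    pderiv j f x = fderiv ℝ f x (basisVec j) :=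
  h.lineDeriv_eq_fderiv

theorem pderiv_congr {x : Plane} (j : Fin 2) (hV : IsOpen V) (hx : x ∈ V) (h : EqOn f g V) :
    pderiv j f x = pderiv j g x :=
  (h.eventuallyEq_of_mem (hV.mem_nhds hx)).lineDeriv_eq

theorem contDiffOn_pderiv {n : ℕ} (j : Fin 2) (hV : IsOpen V)
    (hf : ContDiffOn ℝ (n + 1 : ℕ) f V) : ContDiffOn ℝ n (pderiv j f) V := by
  have h : ContDiffOn ℝ n (fun x => fderiv ℝ f x (basisVec j)) V :=
    (hf.fderiv_of_isOpen hV (by push_cast; exact le_rfl)).clm_apply contDiffOn_const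
  refine h.congr fun x hx => pderiv_eq_fderiv j ?_
  exact (hf.differentiableOn (by simp)).differentiableAt (hV.mem_nhds hx)

theorem pderiv_comm {x : Plane} (i j : Fin 2) (hV : IsOpen V) (hf : ContDiffOn ℝ 2 f V)
    (hx : x ∈ V) : pderiv i (pderiv j f) x = pderiv j (pderiv i f) x := by
  have hd : ∀ y ∈ V, DifferentiableAt ℝ f y := fun y hy =>
    (hf.differentiableOn (by simp)).differentiableAt (hV.mem_nhds hy)
  have h1 : ContDiffOn ℝ 1 (fderiv ℝ f) V := hf.fderiv_of_isOpen hV (by norm_num)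
  have hd1 : DifferentiableAt ℝ (fderiv ℝ f) x :=
    (h1.differentiableOn (by simp)).differentiableAt (hV.mem_nhds hx)
  have key : ∀ a b : Fin 2, pderiv a (pderiv b f) x
      = fderiv ℝ (fderiv ℝ f) x (basisVec a) (basisVec b) := by
    intro a b
    rw [pderiv_congr a hV hx (fun y hy => pderiv_eq_fderiv b (hd y hy)),
      pderiv_eq_fderiv a (hd1.clm_apply (differentiableAt_const _)),
      fderiv_clm_apply hd1 (differentiableAt_const _)]
    simp
  rw [key, key]
  exact (hf.contDiffAt (hV.mem_nhds hx)).isSymmSndFDerivAt (by simp) _ _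

/-- The derivative of `f` in the direction `ζ`, in terms of the partial derivatives. -/
noncomputable def dirDeriv (ζ : Plane) (f : Plane → ℝ) (x : Plane) : ℝ :=
  ∑ i, ζ i * pderiv i f x

theorem plane_eq_sum (ζ : Plane) : ζ = ∑ i, ζ i • basisVec i := by
  ext k
  fin_cases k <;> simp [basisVec]

theorem dirDeriv_eq_fderiv {x : Plane} (ζ : Plane) (h : DifferentiableAt ℝ f x) :
    dirDeriv ζ f x = fderiv ℝ f x ζ := by
  conv_rhs => rw [plane_eq_sum ζ]
  simp [dirDeriv, pderiv_eq_fderiv _ h]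

theorem hasDerivAt_comp_line {w ζ : Plane} {t : ℝ} (h : DifferentiableAt ℝ f (w + t • ζ)) :
    HasDerivAt (fun s : ℝ => f (w + s • ζ)) (dirDeriv ζ f (w + t • ζ)) t := by
  have h1 : HasDerivAt (fun s : ℝ => w + s • ζ) ζ t := by
    simpa using ((hasDerivAt_id t).smul_const ζ).const_add w
  rw [dirDeriv_eq_fderiv ζ h]
  exact h.hasFDerivAt.comp_hasDerivAt t h1

theorem contDiffOn_dirDeriv {n : ℕ} (ζ : Plane) (hV : IsOpen V)
    (hf : ContDiffOn ℝ (n + 1 : ℕ) f V) : ContDiffOn ℝ n (dirDeriv ζ f) V :=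
  ContDiffOn.sum fun i _ => contDiffOn_const.mul (contDiffOn_pderiv i hV hf)

theorem contDiffOn_iterate_dirDeriv {n : ℕ} (ζ : Plane) (hV : IsOpen V) (m : ℕ) :
    ∀ {f : Plane → ℝ}, ContDiffOn ℝ (n + m : ℕ) f V → ContDiffOn ℝ n ((dirDeriv ζ)^[m] f) V := by
  induction m with
  | zero => intro f hf; exact hf
  | succ m ih => intro f hf; exact ih (contDiffOn_dirDeriv ζ hV hf)

theorem iteratedDeriv_comp_line {w ζ : Plane} (hV : IsOpen V) (m : ℕ) :
    ∀ {f : Plane → ℝ}, ContDiffOn ℝ m f V → ∀ {t : ℝ}, w + t • ζ ∈ V →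
      iteratedDeriv m (fun s : ℝ => f (w + s • ζ)) t = (dirDeriv ζ)^[m] f (w + t • ζ) := by
  induction m with
  | zero => intro f _ t _; simp
  | succ m ih =>
    intro f hf t ht
    rw [iteratedDeriv_succ', Function.iterate_succ_apply, ← ih (contDiffOn_dirDeriv ζ hV hf) ht]
    refine Filter.EventuallyEq.iteratedDeriv_eq m ?_
    have hc : ContinuousAt (fun s : ℝ => w + s • ζ) t := by fun_prop
    filter_upwards [hc.preimage_mem_nhds (hV.mem_nhds ht)] with s hs
    exact (hasDerivAt_comp_line
      ((hf.differentiableOn (by simp)).differentiableAt (hV.mem_nhds hs))).deriv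

theorem iterate_dirDeriv_congr (ζ : Plane) (hV : IsOpen V) (m : ℕ) (h : EqOn f g V) :
    EqOn ((dirDeriv ζ)^[m] f) ((dirDeriv ζ)^[m] g) V := by
  induction m generalizing f g with
  | zero => exact h
  | succ m ih =>
    simp only [Function.iterate_succ_apply]
    exact ih fun x hx => Finset.sum_congr rfl fun i _ => by rw [pderiv_congr i hV hx h]

theorem iterate_dirDeriv_sum (ζ : Plane) (hV : IsOpen V) (m : ℕ) :
    ∀ (a : Fin 2 → ℝ) (F : Fin 2 → Plane → ℝ), (∀ i, ContDiffOn ℝ m (F i) V) →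
      EqOn ((dirDeriv ζ)^[m] fun x => ∑ i, a i * F i x)
        (fun x => ∑ i, a i * (dirDeriv ζ)^[m] (F i) x) V := by
  induction m with
  | zero => intro a F _ x _; rfl
  | succ m ih =>
    intro a F hF x hx
    have hd : ∀ i, ∀ y ∈ V, DifferentiableAt ℝ (F i) y := fun i y hy =>
      ((hF i).differentiableOn (by simp)).differentiableAt (hV.mem_nhds hy)
    simp only [Function.iterate_succ_apply]
    refine Eq.trans ?_ (ih a (fun i => dirDeriv ζ (F i))
      (fun i => contDiffOn_dirDeriv ζ hV (hF i)) hx)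
    refine iterate_dirDeriv_congr ζ hV m (fun y hy => ?_) hx
    rw [dirDeriv_eq_fderiv ζ (DifferentiableAt.fun_sum fun i _ => (hd i y hy).const_mul _),
      fderiv_fun_sum fun i _ => (hd i y hy).const_mul _]
    simp only [sum_apply]
    refine Finset.sum_congr rfl fun i _ => ?_
    rw [fderiv_const_mul (hd i y hy), dirDeriv_eq_fderiv ζ (hd i y hy)]
    simp

/-- The innermost derivative is a constant-coefficient combination of partials and so passes through
the outer ones; this is what lets inductions replace `f` by `pderiv i f`. -/
theorem iterate_dirDeriv_succ {x : Plane} (ζ : Plane) (hV : IsOpen V) (m : ℕ)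
    (hf : ContDiffOn ℝ (m + 1 : ℕ) f V) (hx : x ∈ V) :
    (dirDeriv ζ)^[m + 1] f x = ∑ i, ζ i * (dirDeriv ζ)^[m] (pderiv i f) x := by
  rw [Function.iterate_succ_apply]
  exact iterate_dirDeriv_sum ζ hV m ζ (fun i => pderiv i f)
    (fun i => contDiffOn_pderiv i hV hf) hx

/-- The successive partial derivative of `f` along a list of coordinates. -/
noncomputable def wordDeriv (l : List (Fin 2)) (f : Plane → ℝ) : Plane → ℝ := l.foldr pderiv f

theorem contDiffOn_wordDeriv (hV : IsOpen V) (l : List (Fin 2)) :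
    ∀ {n : ℕ}, ContDiffOn ℝ (n + l.length : ℕ) f V → ContDiffOn ℝ n (wordDeriv l f) V := by
  induction l with
  | nil => intro n h; simpa [wordDeriv] using h
  | cons i l ih =>
    intro n h
    refine contDiffOn_pderiv i hV (ih (n := n + 1) ?_)
    convert h using 2
    simp; ring

theorem wordDeriv_perm (hV : IsOpen V) {l l' : List (Fin 2)} (h : l.Perm l')
    (hf : ContDiffOn ℝ l.length f V) : EqOn (wordDeriv l f) (wordDeriv l' f) V := by
  induction h with
  | nil => exact fun _ _ => rfl
  | cons i _ ih =>
    intro x hx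
    exact pderiv_congr i hV hx (ih (hf.of_le (by simp)))
  | swap i j l =>
    intro x hx
    refine pderiv_comm j i hV ?_ hx
    refine contDiffOn_wordDeriv (n := 2) hV l (hf.of_le ?_)
    simp only [List.length_cons]
    norm_cast
    omega
  | trans h₁ _ ih₁ ih₂ => exact (ih₁ hf).trans (ih₂ (h₁.length_eq ▸ hf))

/-- Bounds are available only for partials taken in the order of `mixedPartial`; symmetry of second
derivatives sorts any other order into it. -/
theorem wordDeriv_eq_mixedPartial (hV : IsOpen V) (l : List (Fin 2))
    (hf : ContDiffOn ℝ l.length f V) :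
    EqOn (wordDeriv l f) (mixedPartial (l.count 0) (l.count 1) f) V := by
  have hp : l.Perm (List.replicate (l.count 0) 0 ++ List.replicate (l.count 1) 1) := by
    rw [List.perm_iff_count]
    intro a
    fin_cases a <;> simp [List.count_replicate]
  have hr : ∀ (a : ℕ) (i : Fin 2) (g : Plane → ℝ),
      wordDeriv (List.replicate a i) g = (pderiv i)^[a] g := by
    intro a i g
    induction a with
    | zero => rfl
    | succ a ih =>
      rw [Function.iterate_succ_apply', ← ih]
      rfl
  intro x hx
  rw [wordDeriv_perm hV hp hf hx, mixedPartial, ← hr, ← hr]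
  simp only [wordDeriv, List.foldr_append]

/-- Expansion into `2 ^ m` words, each with a coefficient of size at most `‖ζ‖ ^ m`. -/
theorem abs_iterate_dirDeriv_le {x ζ : Plane} {M : ℝ} (hV : IsOpen V) (hx : x ∈ V) (m : ℕ) :
    ∀ {f : Plane → ℝ}, ContDiffOn ℝ m f V →
      (∀ l : List (Fin 2), l.length = m → |wordDeriv l f x| ≤ M) →
      |(dirDeriv ζ)^[m] f x| ≤ M * (2 * ‖ζ‖) ^ m := by
  induction m with
  | zero => intro f _ h; simpa [wordDeriv] using h [] rfl
  | succ m ih =>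
    intro f hf h
    rw [iterate_dirDeriv_succ ζ hV m hf hx]
    have hb : ∀ i : Fin 2, |ζ i * (dirDeriv ζ)^[m] (pderiv i f) x|
        ≤ ‖ζ‖ * (M * (2 * ‖ζ‖) ^ m) := by
      intro i
      rw [abs_mul]
      refine mul_le_mul (EuclideanSpace.norm_eq ζ ▸ ?_) (ih (contDiffOn_pderiv i hV hf)
        fun l hl => ?_) (abs_nonneg _) (norm_nonneg _)
      · rw [← EuclideanSpace.norm_eq, ← Real.norm_eq_abs]
        exact PiLp.norm_apply_le ζ i
      · have := h (l ++ [i]) (by simp [hl])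
        simpa [wordDeriv] using this
    calc _ ≤ ∑ i : Fin 2, |ζ i * (dirDeriv ζ)^[m] (pderiv i f) x| := Finset.abs_sum_le_sum_abs _ _
      _ ≤ ∑ _i : Fin 2, ‖ζ‖ * (M * (2 * ‖ζ‖) ^ m) := Finset.sum_le_sum fun i _ => hb i
      _ = _ := by simp; ring

end DirectionalDerivatives

/-! ### Cancellation of cubic Taylor polynomials by doubly affine-annihilating weights. -/

section Taylor

theorem abs_sub_le_of_hasDerivAt_unit {u u' : ℝ → ℝ} {M : ℝ}
    (hu : ∀ t ∈ Icc (0 : ℝ) 1, HasDerivAt u (u' t) t) (hb : ∀ t ∈ Icc (0 : ℝ) 1, |u' t| ≤ M) :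
    ∀ t ∈ Icc (0 : ℝ) 1, |u t - u 0| ≤ M := by
  intro t ht
  have h0 : (0 : ℝ) ∈ Icc (0 : ℝ) 1 := by simp
  have := (convex_Icc (0 : ℝ) 1).norm_image_sub_le_of_norm_hasDerivWithin_le
    (fun s hs => (hu s hs).hasDerivWithinAt) hb h0 ht
  have hM : 0 ≤ M := (abs_nonneg _).trans (hb 0 h0)
  calc |u t - u 0| ≤ M * ‖t - 0‖ := this
    _ ≤ M * 1 := by
        gcongr
        rw [sub_zero, Real.norm_eq_abs, abs_of_nonneg ht.1]; exact ht.2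
    _ = M := mul_one M

/-- The mean value inequality is applied four times, subtracting the accumulated polynomial each
time. The sharp factor `1/24` is not needed. -/
theorem abs_taylor_four_le {g : ℕ → ℝ → ℝ} {M : ℝ}
    (hg : ∀ m < 4, ∀ t ∈ Icc (0 : ℝ) 1, HasDerivAt (g m) (g (m + 1) t) t)
    (hb : ∀ t ∈ Icc (0 : ℝ) 1, |g 4 t| ≤ M) :
    |g 0 1 - (g 0 0 + g 1 0 + g 2 0 / 2 + g 3 0 / 6)| ≤ M := by
  have a3 := abs_sub_le_of_hasDerivAt_unit (hg 3 (by norm_num)) hb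
  have a2 := abs_sub_le_of_hasDerivAt_unit (u := fun t => g 2 t - t * g 3 0)
    (fun t ht => ((hg 2 (by norm_num) t ht).sub ((hasDerivAt_id t).mul_const _)).congr_deriv
      (by rw [one_mul])) a3
  have a1 := abs_sub_le_of_hasDerivAt_unit (u := fun t => g 1 t - t * g 2 0 - t ^ 2 / 2 * g 3 0)
    (u' := fun t => g 2 t - t * g 3 0 - (g 2 0 - 0 * g 3 0))
    (fun t ht => (((hg 1 (by norm_num) t ht).sub ((hasDerivAt_id t).mul_const _)).sub
      (((hasDerivAt_pow 2 t).div_const 2).mul_const _)).congr_deriv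
      (by push_cast; ring)) a2
  have a0 := abs_sub_le_of_hasDerivAt_unit
    (u := fun t => g 0 t - t * g 1 0 - t ^ 2 / 2 * g 2 0 - t ^ 3 / 6 * g 3 0)
    (u' := fun t => g 1 t - t * g 2 0 - t ^ 2 / 2 * g 3 0
      - (g 1 0 - 0 * g 2 0 - 0 ^ 2 / 2 * g 3 0))
    (fun t ht => ((((hg 0 (by norm_num) t ht).sub ((hasDerivAt_id t).mul_const _)).sub
      (((hasDerivAt_pow 2 t).div_const 2).mul_const _)).sub
      (((hasDerivAt_pow 3 t).div_const 6).mul_const _)).congr_deriv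
      (by push_cast; ring)) a1 1 (by simp)
  refine le_of_eq_of_le ?_ a0
  congr 1; ring

variable {K L : Type*} [Fintype K] [Fintype L]

/-- Every summand is affine in one of the two points with coefficients depending only on the other
index, so one of the two sums vanishes. -/
theorem sum_sum_affine_eq_zero (c : K → ℝ) (d : L → ℝ) (ξ : K → Plane) (η : L → Plane)
    (hc : ∑ k, c k = 0) (hcξ : ∀ j, ∑ k, c k * ξ k j = 0)
    (hd : ∑ l, d l = 0) (hdη : ∀ j, ∑ l, d l * η l j = 0)
    (A₀ A₁ A₂ : L → ℝ) (B₀ B₁ B₂ : K → ℝ) :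
    ∑ k, ∑ l, c k * d l * (A₀ l + A₁ l * ξ k 0 + A₂ l * ξ k 1
      + B₀ k + B₁ k * η l 0 + B₂ k * η l 1) = 0 := by
  have e : ∀ k l, c k * d l * (A₀ l + A₁ l * ξ k 0 + A₂ l * ξ k 1
      + B₀ k + B₁ k * η l 0 + B₂ k * η l 1) =
      c k * (d l * A₀ l) + (c k * ξ k 0) * (d l * A₁ l) + (c k * ξ k 1) * (d l * A₂ l)
      + (c k * B₀ k) * d l + (c k * B₁ k) * (d l * η l 0) + (c k * B₂ k) * (d l * η l 1) :=
    fun k l => by ring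
  simp_rw [e, Finset.sum_add_distrib, ← Finset.mul_sum, ← Finset.sum_mul, hc, hcξ, hd, hdη]
  simp

/-- A monomial of total degree at most three in `ξ` and `η` has degree at most one in one of them.
Hence the cubic Taylor polynomial at `z` is cancelled and only the fourth-order remainder counts. -/
theorem abs_sum_sum_le_of_fourth_deriv {f : Plane → ℝ} {z : Plane} {M : ℝ}
    (c : K → ℝ) (d : L → ℝ) (ξ : K → Plane) (η : L → Plane)
    (hc : ∑ k, c k = 0) (hcξ : ∀ j, ∑ k, c k * ξ k j = 0)
    (hd : ∑ l, d l = 0) (hdη : ∀ j, ∑ l, d l * η l j = 0)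
    (hz : ContDiffAt ℝ 4 f z)
    (hf : ∀ k l, ∀ t ∈ Icc (0 : ℝ) 1, ContDiffAt ℝ 4 f (z + t • (ξ k - η l)))
    (hM : ∀ k l, ∀ t ∈ Icc (0 : ℝ) 1,
      |iteratedDeriv 4 (fun s : ℝ => f (z + t • (ξ k - η l) + s • (ξ k - η l))) 0| ≤ M) :
    |∑ k, ∑ l, c k * d l * f (z + (ξ k - η l))| ≤ (∑ k, |c k|) * (∑ l, |d l|) * M := by
  let V : Set Plane := {x | ContDiffAt ℝ 4 f x}
  have hV : IsOpen V := isOpen_iff_mem_nhds.2 fun x hx =>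
    ContDiffAt.eventually (n := 4) hx (by simp)
  have hfV : ContDiffOn ℝ (4 : ℕ) f V := fun x hx => ContDiffAt.contDiffWithinAt hx
  let p : Plane → ℝ := fun ζ => f z + dirDeriv ζ f z + (dirDeriv ζ)^[2] f z / 2
    + (dirDeriv ζ)^[3] f z / 6
  have hrem : ∀ k l, |f (z + (ξ k - η l)) - p (ξ k - η l)| ≤ M := by
    intro k l
    have := abs_taylor_four_le (M := M)
      (g := fun m t => (dirDeriv (ξ k - η l))^[m] f (z + t • (ξ k - η l)))
      (fun m hm t ht => by
        rw [Function.iterate_succ_apply']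
        refine hasDerivAt_comp_line ?_
        have h1 : ContDiffOn ℝ (1 + m : ℕ) f V := hfV.of_le (by norm_cast; omega)
        exact ((contDiffOn_iterate_dirDeriv _ hV m h1).differentiableOn (by simp)).differentiableAt
          (hV.mem_nhds (hf k l t ht)))
      (fun t ht => by
        have h1 := iteratedDeriv_comp_line (w := z + t • (ξ k - η l)) (ζ := ξ k - η l) (t := 0)
          hV 4 hfV (by rw [zero_smul, add_zero]; exact hf k l t ht)
        rw [zero_smul, add_zero] at h1
        rw [← h1]
        exact hM k l t ht)
    simpa [p] using this
  have hp : ∑ k, ∑ l, c k * d l * p (ξ k - η l) = 0 := by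
    have h1 : ContDiffOn ℝ (0 + 1 : ℕ) f V := hfV.of_le (by norm_num)
    have h2 : ContDiffOn ℝ (1 + 1 : ℕ) f V := hfV.of_le (by norm_num)
    have h3 : ContDiffOn ℝ (2 + 1 : ℕ) f V := hfV.of_le (by norm_num)
    let D := fun i => pderiv i f z
    let D2 := fun i j => pderiv j (pderiv i f) z
    let D3 := fun i j k => pderiv k (pderiv j (pderiv i f)) z
    have e : ∀ ζ : Plane, p ζ = f z + ∑ i, ζ i * D i + (∑ i, ζ i * ∑ j, ζ j * D2 i j) / 2
        + (∑ i, ζ i * ∑ j, ζ j * ∑ k, ζ k * D3 i j k) / 6 := by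
      intro ζ
      have e2 : ∀ g, ContDiffOn ℝ (1 + 1 : ℕ) g V →
          (dirDeriv ζ)^[2] g z = ∑ i, ζ i * ∑ j, ζ j * pderiv j (pderiv i g) z :=
        fun g hg => iterate_dirDeriv_succ ζ hV 1 hg hz
      simp only [p]
      rw [e2 f h2, iterate_dirDeriv_succ ζ hV 2 h3 hz]
      simp only [e2 _ (contDiffOn_pderiv _ hV h3), D, D2, D3]
      rfl
    -- Expansion of the cubic `p (ξ k - η l)`: terms of degree at most one in `ξ` go into the
    -- functions of `l`; those of degree at least two in `ξ` are at most linear in `η` and go into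
    -- the functions of `k`.
    have hs := sum_sum_affine_eq_zero c d ξ η hc hcξ hd hdη
      (fun l => p (-η l))
      (fun l => D 0 - (∑ j, η l j * (D2 0 j + D2 j 0)) / 2
        + (∑ i, ∑ j, η l i * η l j * (D3 0 i j + D3 i 0 j + D3 i j 0)) / 6)
      (fun l => D 1 - (∑ j, η l j * (D2 1 j + D2 j 1)) / 2
        + (∑ i, ∑ j, η l i * η l j * (D3 1 i j + D3 i 1 j + D3 i j 1)) / 6)
      (fun k => p (ξ k) - f z - ∑ i, ξ k i * D i)
      (fun k => -(∑ i, ∑ j, ξ k i * ξ k j * (D3 0 i j + D3 i 0 j + D3 i j 0)) / 6)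
      (fun k => -(∑ i, ∑ j, ξ k i * ξ k j * (D3 1 i j + D3 i 1 j + D3 i j 1)) / 6)
    rw [← hs]
    refine Finset.sum_congr rfl fun k _ => Finset.sum_congr rfl fun l _ => ?_
    congr 1
    simp only [e, Fin.sum_univ_two, PiLp.sub_apply, PiLp.neg_apply]
    ring
  have hsub : ∑ k, ∑ l, c k * d l * f (z + (ξ k - η l)) =
      ∑ k, ∑ l, c k * d l * (f (z + (ξ k - η l)) - p (ξ k - η l)) := by
    simp_rw [mul_sub, Finset.sum_sub_distrib, hp, sub_zero]
  rw [hsub, Finset.sum_mul_sum, Finset.sum_mul]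
  refine (Finset.abs_sum_le_sum_abs _ _).trans (Finset.sum_le_sum fun k _ => ?_)
  rw [Finset.sum_mul]
  refine (Finset.abs_sum_le_sum_abs _ _).trans (Finset.sum_le_sum fun l _ => ?_)
  rw [abs_mul, abs_mul]
  exact mul_le_mul_of_nonneg_left (hrem k l) (by positivity)

end Taylor

/-! ### Regularity of radial functions from pure partial derivatives. -/

section RadialFunctions

theorem contDiffOn_nat_of_hasDerivAt_chain {T : Set ℝ} (hT : IsOpen T) (n : ℕ) :
    ∀ {g : ℕ → ℝ → ℝ}, (∀ m < n, ∀ t ∈ T, HasDerivAt (g m) (g (m + 1) t) t) →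
      ContinuousOn (g n) T → ContDiffOn ℝ n (g 0) T := by
  induction n with
  | zero => intro g _ hc; simpa using hc
  | succ n ih =>
    intro g hg hc
    have h := ih (g := fun m => g (m + 1)) (fun m hm t ht => hg (m + 1) (by omega) t ht) hc
    rw [Nat.cast_succ, contDiffOn_succ_iff_deriv_of_isOpen hT]
    exact ⟨fun t ht => (hg 0 (by omega) t ht).differentiableAt.differentiableWithinAt,
      fun h => absurd h (by simp),
      h.congr fun t ht => (hg 0 (by omega) t ht).deriv⟩

theorem inner_basisVec (x : Plane) (j : Fin 2) : inner ℝ x (basisVec j) = x j := by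
  simp [basisVec, EuclideanSpace.inner_single_right]

theorem norm_basisVec (j : Fin 2) : ‖basisVec j‖ = 1 := by
  simp [basisVec]

theorem norm_add_smul_basisVec_sq (x : Plane) (t : ℝ) (j : Fin 2) :
    ‖x + t • basisVec j‖ ^ 2 = ‖x‖ ^ 2 - x j ^ 2 + (x j + t) ^ 2 := by
  rw [norm_add_sq_real, inner_smul_right, inner_basisVec, norm_smul, norm_basisVec,
    Real.norm_eq_abs, mul_one, sq_abs]
  ring

/-- Where `x j ≠ 0`, the coordinate line through `x` crosses the circles about the origin
transversally. Near `x` the function is therefore its restriction to that line composed with a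
smooth parameter depending only on the radius. -/
theorem contDiffAt_of_radial_of_pderiv {f : Plane → ℝ} (hf : ∀ x y, ‖x‖ = ‖y‖ → f x = f y)
    {U : Set Plane} (hU : IsOpen U) {j : Fin 2}
    (hd : ∀ k < 4, ∀ x ∈ U, LineDifferentiableAt ℝ ((pderiv j)^[k] f) x (basisVec j))
    (hc : ContinuousOn ((pderiv j)^[4] f) U) {x : Plane} (hx : x ∈ U) (hj : x j ≠ 0) :
    ContDiffAt ℝ 4 f x := by
  let T : Set ℝ := {t | x + t • basisVec j ∈ U}
  have hline : Continuous fun t : ℝ => x + t • basisVec j := by fun_prop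
  have hT : IsOpen T := hU.preimage hline
  have h0T : (0 : ℝ) ∈ T := by simpa [T] using hx
  have hg : ContDiffOn ℝ (4 : ℕ) (fun t : ℝ => f (x + t • basisVec j)) T := by
    refine contDiffOn_nat_of_hasDerivAt_chain hT 4
      (g := fun m t => (pderiv j)^[m] f (x + t • basisVec j)) (fun m hm t ht => ?_)
      (hc.comp hline.continuousOn fun t ht => ht)
    have h := (hd m hm _ ht).hasLineDerivAt
    rw [HasLineDerivAt] at h
    rw [Function.iterate_succ_apply']
    have h' := HasDerivAt.comp_sub_const t t (by rw [sub_self]; exact h)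
    refine h'.congr_of_eventuallyEq (Eventually.of_forall fun s => ?_)
    have e : x + t • basisVec j + (s - t) • basisVec j = x + s • basisVec j := by module
    simp only [e]
  obtain ⟨σ, hσ, hσj⟩ : ∃ σ : ℝ, σ ^ 2 = 1 ∧ σ * |x j| = x j := by
    rcases lt_or_gt_of_ne hj with h | h
    · exact ⟨-1, by norm_num, by rw [abs_of_neg h]; ring⟩
    · exact ⟨1, by norm_num, by rw [abs_of_pos h]; ring⟩
  -- `q w` is the square of the `j`-th coordinate of the point of the line at radius `‖w‖`; the sign
  -- `σ` selects the branch through `x`.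
  let q : Plane → ℝ := fun w => ‖w‖ ^ 2 - ‖x‖ ^ 2 + x j ^ 2
  have hqx : q x = x j ^ 2 := by simp [q]
  have hqpos : 0 < q x := by rw [hqx]; positivity
  have hqc : ContDiff ℝ 4 q := ((contDiff_norm_sq ℝ).sub contDiff_const).add contDiff_const
  let τ : Plane → ℝ := fun w => σ * √(q w) - x j
  have hτ : ContDiffAt ℝ 4 τ x :=
    (contDiffAt_const.mul (hqc.contDiffAt.sqrt hqpos.ne')).sub contDiffAt_const
  have hτx : τ x = 0 := by simp only [τ, hqx, Real.sqrt_sq_eq_abs, hσj, sub_self]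
  have hcomp : ContDiffAt ℝ 4 ((fun t : ℝ => f (x + t • basisVec j)) ∘ τ) x := by
    refine ContDiffAt.comp x ?_ hτ
    rw [hτx]
    exact hg.contDiffAt (hT.mem_nhds h0T)
  refine hcomp.congr_of_eventuallyEq ?_
  filter_upwards [hqc.continuous.continuousAt.eventually (lt_mem_nhds hqpos)] with w hw
  refine hf _ _ ?_
  rw [← sq_eq_sq₀ (norm_nonneg _) (norm_nonneg _), norm_add_smul_basisVec_sq]
  have : x j + τ w = σ * √(q w) := by simp only [τ]; ring
  rw [this, mul_pow, hσ, Real.sq_sqrt hw.le]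
  simp only [q]
  ring

theorem exists_linearIsometryEquiv_map {v w : Plane} (h : ‖v‖ = ‖w‖) :
    ∃ R : Plane ≃ₗᵢ[ℝ] Plane, R v = w :=
  ⟨_, Submodule.reflection_sub h⟩

/-- A nonzero `x` has a nonzero coordinate, and the pure fourth derivative in that direction gives
smoothness at `x`. A linear isometry taking `w` to `x` leaves `f` unchanged and carries smoothness
and bound back to `w`, which need not lie in `S`. The `16` is the number of words of length four. -/
theorem exists_radial_fourth_deriv_bound {f : Plane → ℝ} (hf : ∀ x y, ‖x‖ = ‖y‖ → f x = f y)
    {S : Set Plane} (h0 : ∀ x ∈ S, x ≠ 0) {b : Plane → ℝ}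
    (hb : ∀ x y, ‖x‖ = ‖y‖ → b x = b y)
    (hreg : ∀ a₁ a₂ : ℕ, a₁ + a₂ = 4 → ∃ U : Set Plane, IsOpen U ∧ S ⊆ U ∧
      HasContMixedPartialOn a₁ a₂ f U)
    (hbound : ∀ a₁ a₂ : ℕ, a₁ + a₂ = 4 → ∀ x ∈ S, |mixedPartial a₁ a₂ f x| ≤ b x)
    {w : Plane} (hw : ∃ x ∈ S, ‖w‖ = ‖x‖) :
    ContDiffAt ℝ 4 f w ∧
      ∀ ζ : Plane, |iteratedDeriv 4 (fun s : ℝ => f (w + s • ζ)) 0| ≤ 16 * b w * ‖ζ‖ ^ 4 := by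
  obtain ⟨x, hx, hwx⟩ := hw
  have hsm : ContDiffAt ℝ 4 f x := by
    have hne := h0 x hx
    by_cases hx0 : x 0 = 0
    · have hx1 : x 1 ≠ 0 := fun h => hne (by ext i; fin_cases i <;> simp [hx0, h])
      obtain ⟨U, hU, hSU, h⟩ := hreg 0 4 rfl
      exact contDiffAt_of_radial_of_pderiv hf hU h.exists_snd h.continuousOn (hSU hx) hx1
    · obtain ⟨U, hU, hSU, h⟩ := hreg 4 0 rfl
      exact contDiffAt_of_radial_of_pderiv hf hU h.exists_fst h.continuousOn (hSU hx) hx0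
  obtain ⟨R, hR⟩ := exists_linearIsometryEquiv_map hwx
  have hfR : ∀ y, f y = f (R y) := fun y => hf _ _ (R.norm_map y).symm
  constructor
  · have : f = f ∘ R := funext hfR
    rw [this]
    exact ContDiffAt.comp w (hR ▸ hsm) R.contDiff.contDiffAt
  · intro ζ
    let V : Set Plane := {x | ContDiffAt ℝ 4 f x}
    have hV : IsOpen V := isOpen_iff_mem_nhds.2 fun x hx =>
      ContDiffAt.eventually (n := 4) hx (by simp)
    have hfV : ContDiffOn ℝ (4 : ℕ) f V := fun x hx => ContDiffAt.contDiffWithinAt hx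
    have e : (fun s : ℝ => f (w + s • ζ)) = fun s : ℝ => f (x + s • R ζ) := by
      funext s
      rw [hfR, map_add, map_smul, hR]
    rw [e, iteratedDeriv_comp_line hV 4 hfV (by simpa [V] using hsm), zero_smul, add_zero]
    refine (abs_iterate_dirDeriv_le (M := b x) hV hsm 4 hfV fun l hl => ?_).trans_eq ?_
    · rw [wordDeriv_eq_mixedPartial hV l (hl ▸ hfV) hsm]
      refine hbound _ _ ?_ x hx
      rw [← hl]
      clear hl
      induction l with
      | nil => rfl
      | cons a l ih => fin_cases a <;> simp <;> omega
    · rw [R.norm_map, hb w x hwx]; ring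

end RadialFunctions

/-! ### Uniform estimates for the deformation on the unit square. -/

section Diffeomorphism

theorem convex_unitSquare : Convex ℝ unitSquare := by
  intro x hx y hy a b ha hb hab j
  exact (convex_Icc (0 : ℝ) 1) (hx j) (hy j) ha hb hab

theorem norm_le_two_of_mem_unitSquare {x : Plane} (hx : x ∈ unitSquare) : ‖x‖ ≤ 2 := by
  have h0 := hx 0
  have h1 := hx 1
  rw [EuclideanSpace.norm_eq, Real.sqrt_le_left (by norm_num)]
  simp only [Fin.sum_univ_two, Real.norm_eq_abs, sq_abs]
  nlinarith [h0.1, h0.2, h1.1, h1.2]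

theorem isCompact_unitSquare : IsCompact unitSquare := by
  refine Metric.isCompact_of_isClosed_isBounded ?_ ?_
  · have : unitSquare = ⋂ j : Fin 2, (fun x : Plane => x j) ⁻¹' Icc (0 : ℝ) 1 := by
      ext x; simp [unitSquare]
    rw [this]
    exact isClosed_iInter fun j => isClosed_Icc.preimage (by fun_prop)
  · exact Metric.isBounded_closedBall.subset fun x hx => by
      rw [mem_closedBall_zero_iff]
      exact norm_le_two_of_mem_unitSquare hx

variable {φ : Plane → Plane} {D : Set Plane}

theorem IsC2DiffeoOn.differentiableAt (hφ : IsC2DiffeoOn φ D) {x : Plane} (hx : x ∈ D) :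
    DifferentiableAt ℝ φ x :=
  (hφ.contDiffOn.differentiableOn (by simp)).differentiableAt (hφ.isOpen.mem_nhds hx)

theorem IsC2DiffeoOn.continuousOn_fderiv (hφ : IsC2DiffeoOn φ D) :
    ContinuousOn (fderiv ℝ φ) D :=
  hφ.contDiffOn.continuousOn_fderiv_of_isOpen hφ.isOpen (by simp)

theorem IsC2DiffeoOn.injOn (hφ : IsC2DiffeoOn φ D) : InjOn φ D := by
  obtain ⟨ψ, -, h⟩ := hφ.inverse
  intro x hx y hy hxy
  rw [← h x hx, hxy, h y hy]

theorem IsC2DiffeoOn.fderiv_injective (hφ : IsC2DiffeoOn φ D) {x : Plane} (hx : x ∈ D)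
    {v : Plane} (hv : fderiv ℝ φ x v = 0) : v = 0 := by
  obtain ⟨ψ, hψ, h⟩ := hφ.inverse
  have h1 := ((hψ.differentiableOn (by simp)) (φ x) (mem_image_of_mem φ hx)).hasFDerivWithinAt
  have h2 := (hφ.differentiableAt hx).hasFDerivAt
  have h3 : HasFDerivWithinAt (ψ ∘ φ) _ D x :=
    h1.comp x h2.hasFDerivWithinAt (mapsTo_image φ D)
  have h4 := h3.hasFDerivAt (hφ.isOpen.mem_nhds hx)
  have h5 : HasFDerivAt (ψ ∘ φ) (ContinuousLinearMap.id ℝ Plane) x :=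
    (hasFDerivAt_id x).congr_of_eventuallyEq
      (by filter_upwards [hφ.isOpen.mem_nhds hx] with y hy using h y hy)
  have h6 := congrArg (fun L : Plane →L[ℝ] Plane => L v) (h4.unique h5)
  simpa [hv] using h6.symm

theorem pderiv_apply_eq_fderiv (hφ : IsC2DiffeoOn φ D) {x : Plane} (hx : x ∈ D) (i j : Fin 2) :
    pderiv i (fun z => φ z j) x = fderiv ℝ φ x (basisVec i) j := by
  have hd := hφ.differentiableAt hx
  have h1 : HasFDerivAt (fun z => φ z j)
      ((EuclideanSpace.proj j : Plane →L[ℝ] ℝ).comp (fderiv ℝ φ x)) x :=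
    (EuclideanSpace.proj j : Plane →L[ℝ] ℝ).hasFDerivAt.comp x hd.hasFDerivAt
  rw [pderiv_eq_fderiv i h1.differentiableAt, h1.fderiv]
  rfl

theorem IsC2DiffeoOn.jacobian_ne_zero (hφ : IsC2DiffeoOn φ D) {x : Plane} (hx : x ∈ D) :
    fderiv ℝ φ x (basisVec 0) 0 * fderiv ℝ φ x (basisVec 1) 1
      - fderiv ℝ φ x (basisVec 0) 1 * fderiv ℝ φ x (basisVec 1) 0 ≠ 0 := by
  intro h
  set a := fderiv ℝ φ x (basisVec 0) with ha
  set b := fderiv ℝ φ x (basisVec 1) with hb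
  have key : ∀ s t : ℝ, s • a + t • b = 0 → s = 0 ∧ t = 0 := by
    intro s t hst
    have := hφ.fderiv_injective hx (v := s • basisVec 0 + t • basisVec 1)
      (by rw [map_add, map_smul, map_smul]; exact hst)
    constructor
    · simpa [basisVec] using congrArg (fun v : Plane => v 0) this
    · simpa [basisVec] using congrArg (fun v : Plane => v 1) this
  have h1 := key (b 1) (-a 1) (by
    ext i; fin_cases i
    · simp; linarith
    · simp; ring)
  have h0 := key (b 0) (-a 0) (by
    ext i; fin_cases i
    · simp; ring
    · simp; linarith)
  have := key 1 0 (by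
    ext i; fin_cases i
    · simpa using h0.2
    · simpa using h1.2)
  exact one_ne_zero this.1

/-- Uniform continuity of the derivative on the compact square, fed into the mean value inequality
on a segment, which convexity keeps inside the square. -/
theorem IsC2DiffeoOn.uniform_fderiv (hφ : IsC2DiffeoOn φ D) (hD : unitSquare ⊆ D) {ε : ℝ}
    (hε : 0 < ε) : ∃ δ > 0, ∀ x ∈ unitSquare, ∀ y ∈ unitSquare, ‖x - y‖ < δ →
      ‖φ x - φ y - fderiv ℝ φ y (x - y)‖ ≤ ε * ‖x - y‖ := by
  have huc := isCompact_unitSquare.uniformContinuousOn_of_continuous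
    (hφ.continuousOn_fderiv.mono hD)
  obtain ⟨δ, hδ, h⟩ := Metric.uniformContinuousOn_iff.1 huc ε hε
  refine ⟨δ, hδ, fun x hx y hy hxy => ?_⟩
  have hsub : segment ℝ y x ⊆ unitSquare := convex_unitSquare.segment_subset hy hx
  refine (convex_segment y x).norm_image_sub_le_of_norm_hasFDerivWithin_le'
    (f' := fderiv ℝ φ)
    (fun z hz => (hφ.differentiableAt (hD (hsub hz))).hasFDerivAt.hasFDerivWithinAt)
    (fun z hz => ?_) (left_mem_segment ℝ y x) (right_mem_segment ℝ y x)
  rw [← dist_eq_norm]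
  refine (h z (hsub hz) y hy ?_).le
  obtain ⟨a, b, ha, hb, hab, rfl⟩ := hz
  have : a • y + b • x - y = b • (x - y) := by
    rw [show a = 1 - b by linarith]; module
  rw [dist_eq_norm, this, norm_smul, Real.norm_eq_abs, abs_of_nonneg hb]
  nlinarith [norm_nonneg (x - y)]

theorem IsC2DiffeoOn.exists_fderiv_lower_bound (hφ : IsC2DiffeoOn φ D) (hD : unitSquare ⊆ D) :
    ∃ c > 0, ∀ x ∈ unitSquare, ∀ v, c * ‖v‖ ≤ ‖fderiv ℝ φ x v‖ := by
  have hK : IsCompact (unitSquare ×ˢ Metric.sphere (0 : Plane) 1) :=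
    isCompact_unitSquare.prod (isCompact_sphere _ _)
  have hc : ContinuousOn (fun q : Plane × Plane => ‖fderiv ℝ φ q.1 q.2‖)
      (unitSquare ×ˢ Metric.sphere (0 : Plane) 1) := by
    refine ContinuousOn.norm (ContinuousOn.clm_apply ?_ continuousOn_snd)
    exact (hφ.continuousOn_fderiv.mono hD).comp continuousOn_fst fun q hq => hq.1
  obtain ⟨c, hc0, hcb⟩ := hK.exists_forall_le' (a := 0) hc (fun q hq => by
    rw [norm_pos_iff]
    intro h
    have := hφ.fderiv_injective (hD hq.1) h
    have h1 := hq.2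
    rw [this] at h1
    simp at h1)
  refine ⟨c, hc0, fun x hx v => ?_⟩
  by_cases hv : v = 0
  · simp [hv]
  have hvn : 0 < ‖v‖ := norm_pos_iff.2 hv
  have := hcb (x, ‖v‖⁻¹ • v) ⟨hx, by simp [norm_smul, hvn.ne']⟩
  simp only [map_smul, norm_smul, norm_inv, norm_norm] at this
  rwa [inv_mul_eq_div, le_div_iff₀ hvn] at this

/-- For close points the lower bound on the derivative beats the first-order error; for pairs at
distance at least `δ`, compactness and injectivity give a positive minimum, compared with `4` as a
bound on the diameter. -/
theorem IsC2DiffeoOn.exists_lower_lipschitz (hφ : IsC2DiffeoOn φ D) (hD : unitSquare ⊆ D) :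
    ∃ c > 0, ∀ x ∈ unitSquare, ∀ y ∈ unitSquare, c * ‖x - y‖ ≤ ‖φ x - φ y‖ := by
  obtain ⟨c, hc, hcb⟩ := hφ.exists_fderiv_lower_bound hD
  obtain ⟨δ, hδ, hδb⟩ := hφ.uniform_fderiv hD (half_pos hc)
  let K : Set (Plane × Plane) := (unitSquare ×ˢ unitSquare) ∩ {q | δ ≤ ‖q.1 - q.2‖}
  have hK : IsCompact K := (isCompact_unitSquare.prod isCompact_unitSquare).inter_right
    (isClosed_le continuous_const (by fun_prop))
  have hcont : ContinuousOn φ unitSquare := hφ.contDiffOn.continuousOn.mono hD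
  obtain ⟨m, hm0, hmb⟩ := hK.exists_forall_le' (a := 0)
    (f := fun q : Plane × Plane => ‖φ q.1 - φ q.2‖)
    (((hcont.comp continuousOn_fst fun q hq => hq.1.1).sub
      (hcont.comp continuousOn_snd fun q hq => hq.1.2)).norm) (fun q hq => by
    rw [norm_pos_iff, sub_ne_zero]
    intro h
    have e := hφ.injOn (hD hq.1.1) (hD hq.1.2) h
    have : δ ≤ ‖q.1 - q.2‖ := hq.2
    rw [e, sub_self, norm_zero] at this
    linarith)
  refine ⟨min (c / 2) (m / 4), by positivity, fun x hx y hy => ?_⟩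
  rcases lt_or_ge ‖x - y‖ δ with h | h
  · have h1 := hδb x hx y hy h
    have h2 := hcb y hy (x - y)
    have h3 : ‖fderiv ℝ φ y (x - y)‖ ≤ ‖φ x - φ y‖ + ‖φ x - φ y - fderiv ℝ φ y (x - y)‖ := by
      have := norm_sub_le (φ x - φ y) (φ x - φ y - fderiv ℝ φ y (x - y))
      simpa using this
    have h4 : min (c / 2) (m / 4) * ‖x - y‖ ≤ c / 2 * ‖x - y‖ := by
      gcongr; exact min_le_left _ _
    linarith
  · have h1 := hmb (x, y) ⟨⟨hx, hy⟩, h⟩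
    have h2 : ‖x - y‖ ≤ 4 := (norm_sub_le x y).trans (by
      linarith [norm_le_two_of_mem_unitSquare hx, norm_le_two_of_mem_unitSquare hy])
    calc min (c / 2) (m / 4) * ‖x - y‖ ≤ m / 4 * 4 := by
          gcongr; exact min_le_right _ _
      _ = m := by ring
      _ ≤ _ := h1

theorem IsC2DiffeoOn.exists_upper_lipschitz (hφ : IsC2DiffeoOn φ D) (hD : unitSquare ⊆ D) :
    ∃ C > 0, ∀ x ∈ unitSquare, ∀ y ∈ unitSquare, ‖φ x - φ y‖ ≤ C * ‖x - y‖ := by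
  obtain ⟨C, hC⟩ := isCompact_unitSquare.exists_bound_of_continuousOn
    (hφ.continuousOn_fderiv.mono hD)
  refine ⟨max C 1, by positivity, fun x hx y hy => ?_⟩
  exact convex_unitSquare.norm_image_sub_le_of_norm_hasFDerivWithin_le (f' := fderiv ℝ φ)
    (fun z hz => (hφ.differentiableAt (hD hz)).hasFDerivAt.hasFDerivWithinAt)
    (fun z hz => (hC z hz).trans (le_max_left _ _)) hy hx

/-- Every distance up to a distance attained in `imageSquare φ` is attained there. -/
theorem IsC2DiffeoOn.exists_norm_sub_eq (hφ : IsC2DiffeoOn φ D) (hD : unitSquare ⊆ D)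
    {x y : Plane} (hx : x ∈ imageSquare φ) (hy : y ∈ imageSquare φ) {s : ℝ} (hs : 0 ≤ s)
    (hsxy : s ≤ ‖x - y‖) : ∃ x' ∈ imageSquare φ, ‖x' - y‖ = s := by
  have hcont : ContinuousOn φ unitSquare := hφ.contDiffOn.continuousOn.mono hD
  have hconn : IsPreconnected (imageSquare φ) := convex_unitSquare.isPreconnected.image φ hcont
  have := hconn.intermediate_value hy hx (f := fun z => ‖z - y‖)
    (by fun_prop : Continuous fun z : Plane => ‖z - y‖).continuousOn
  obtain ⟨x', hx', h⟩ := this (show s ∈ Icc ‖y - y‖ ‖x - y‖ by simp [hs, hsxy])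
  exact ⟨x', hx', h⟩

end Diffeomorphism

/-! ### Algebra of the weights attached to the corners of a cell. -/

section CornerCoefficients

/-- The determinant of the matrix with rows `a` and `b`. -/
def cross (a b : Plane) : ℝ := a 0 * b 1 - a 1 * b 0

/-- The entries of the inverse of the matrix with rows `a` and `b`. -/
noncomputable def invEntry (a b : Plane) (i j : Fin 2) : ℝ :=
  (cross a b)⁻¹ * !![b 1, -a 1; -b 0, a 0] i j

theorem inv_apply_eq_invEntry (a b : Plane) (i j : Fin 2) :
    (!![a 0, a 1; b 0, b 1] : Matrix (Fin 2) (Fin 2) ℝ)⁻¹ i j = invEntry a b i j := by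
  rw [Matrix.inv_def, Matrix.det_fin_two_of, Matrix.adjugate_fin_two_of, Ring.inverse_eq_inv',
    Matrix.smul_apply, smul_eq_mul]
  rfl

/-- The coefficients of the difference of the two discrete gradients attached to the corners `w`
of a deformed cell. -/
noncomputable def cornerCoeff (ℓ : Fin 2) (w : Fin 2 × Fin 2 → Plane) (k : Fin 2 × Fin 2) : ℝ :=
  let α := invEntry (w (1, 0) - w (0, 0)) (w (0, 1) - w (0, 0)) ℓ
  let β := invEntry (w (1, 0) - w (1, 1)) (w (0, 1) - w (1, 1)) ℓ
  !![α 0 + α 1, β 1 - α 1; β 0 - α 0, -β 0 - β 1] k.1 k.2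

/-- The corners of the cell with lower left corner `(i₁, i₂)`. -/
noncomputable def corners (φ : Plane → Plane) (n θ i₁ i₂ : ℕ) (k : Fin 2 × Fin 2) : Plane :=
  site φ n (i₁ + θ * k.1) (i₂ + θ * k.2)

theorem coeff_eq_cornerCoeff (φ : Plane → Plane) (n θ : ℕ) (ℓ : Fin 2) (i₁ i₂ : ℕ) :
    coeff φ n θ ℓ i₁ i₂ = cornerCoeff ℓ (corners φ n θ i₁ i₂) := by
  have hA : ∀ j, (matA φ n θ i₁ i₂)⁻¹ ℓ j = invEntry
      (corners φ n θ i₁ i₂ (1, 0) - corners φ n θ i₁ i₂ (0, 0))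
      (corners φ n θ i₁ i₂ (0, 1) - corners φ n θ i₁ i₂ (0, 0)) ℓ j := fun j => by
    rw [← inv_apply_eq_invEntry]
    simp [matA, corners]
  have hB : ∀ j, (matB φ n θ i₁ i₂)⁻¹ ℓ j = invEntry
      (corners φ n θ i₁ i₂ (1, 0) - corners φ n θ i₁ i₂ (1, 1))
      (corners φ n θ i₁ i₂ (0, 1) - corners φ n θ i₁ i₂ (1, 1)) ℓ j := fun j => by
    rw [← inv_apply_eq_invEntry]
    simp [matB, corners]
  funext k
  simp only [coeff, cornerCoeff, hA, hB]

theorem sum_cornerCoeff (ℓ : Fin 2) (w : Fin 2 × Fin 2 → Plane) : ∑ k, cornerCoeff ℓ w k = 0 := by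
  simp [cornerCoeff, Fintype.sum_prod_type, Fin.sum_univ_two]
  ring

/-- Both corner triangles of the cell are nondegenerate. -/
def IsNondegenerate (w : Fin 2 × Fin 2 → Plane) : Prop :=
  cross (w (1, 0) - w (0, 0)) (w (0, 1) - w (0, 0)) ≠ 0 ∧
    cross (w (1, 0) - w (1, 1)) (w (0, 1) - w (1, 1)) ≠ 0

theorem sum_invEntry_mul {a b : Plane} (h : cross a b ≠ 0) (i j : Fin 2) :
    invEntry a b i 0 * a j + invEntry a b i 1 * b j = if i = j then 1 else 0 := by
  have h' := h
  unfold cross at h'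
  fin_cases i <;> fin_cases j <;> simp [invEntry, cross] <;> field_simp <;> ring

/-- Both discrete gradients compute the gradient of a coordinate function exactly, so their
difference vanishes on it. -/
theorem sum_cornerCoeff_mul {w : Fin 2 × Fin 2 → Plane} (hw : IsNondegenerate w) (ℓ j : Fin 2) :
    ∑ k, cornerCoeff ℓ w k * w k j = 0 := by
  have h1 := sum_invEntry_mul hw.1 ℓ j
  have h2 := sum_invEntry_mul hw.2 ℓ j
  simp only [PiLp.sub_apply] at h1 h2
  simp [cornerCoeff, Fintype.sum_prod_type, Fin.sum_univ_two]
  linarith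

theorem invEntry_smul {h : ℝ} (hh : h ≠ 0) (a b : Plane) (i j : Fin 2) :
    invEntry (h • a) (h • b) i j = h⁻¹ * invEntry a b i j := by
  have : cross (h • a) (h • b) = h ^ 2 * cross a b := by simp [cross]; ring
  simp only [invEntry, this, mul_inv]
  fin_cases i <;> fin_cases j <;> simp <;> field_simp

theorem cornerCoeff_add_smul {h : ℝ} (hh : h ≠ 0) (ℓ : Fin 2) (x : Plane)
    (w : Fin 2 × Fin 2 → Plane) (k : Fin 2 × Fin 2) :
    cornerCoeff ℓ (fun k => x + h • w k) k = h⁻¹ * cornerCoeff ℓ w k := by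
  have e : ∀ k l, x + h • w k - (x + h • w l) = h • (w k - w l) := fun k l => by module
  obtain ⟨k₁, k₂⟩ := k
  simp only [cornerCoeff, e, invEntry_smul hh]
  fin_cases k₁ <;> fin_cases k₂ <;> simp <;> ring

theorem isNondegenerate_add_smul {h : ℝ} (hh : h ≠ 0) (x : Plane) {w : Fin 2 × Fin 2 → Plane}
    (hw : IsNondegenerate w) : IsNondegenerate (fun k => x + h • w k) := by
  have e : ∀ k l, x + h • w k - (x + h • w l) = h • (w k - w l) := fun k l => by module
  have : ∀ a b, cross (h • a) (h • b) = h ^ 2 * cross a b := fun a b => by simp [cross]; ring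
  simp only [IsNondegenerate, e, this]
  exact ⟨mul_ne_zero (pow_ne_zero 2 hh) hw.1, mul_ne_zero (pow_ne_zero 2 hh) hw.2⟩

theorem isOpen_isNondegenerate : IsOpen {w : Fin 2 × Fin 2 → Plane | IsNondegenerate w} := by
  refine IsOpen.inter ?_ ?_ <;>
  · refine isOpen_ne_fun ?_ continuous_const
    unfold cross
    fun_prop

theorem continuousAt_cornerCoeff {w : Fin 2 × Fin 2 → Plane} (hw : IsNondegenerate w) (ℓ : Fin 2)
    (k : Fin 2 × Fin 2) : ContinuousAt (fun w => cornerCoeff ℓ w k) w := by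
  have h : ∀ a b : (Fin 2 × Fin 2 → Plane) → Plane, Continuous a → Continuous b →
      cross (a w) (b w) ≠ 0 → ∀ i j, ContinuousAt (fun w => invEntry (a w) (b w) i j) w := by
    intro a b ha hb hab i j
    have hc : Continuous fun w => cross (a w) (b w) := by unfold cross; fun_prop
    unfold invEntry
    refine (hc.continuousAt.inv₀ hab).mul ?_
    fin_cases i <;> fin_cases j <;> simp <;> fun_prop
  have hα := h (fun w => w (1, 0) - w (0, 0)) (fun w => w (0, 1) - w (0, 0)) (by fun_prop)
    (by fun_prop) hw.1 ℓ
  have hβ := h (fun w => w (1, 0) - w (1, 1)) (fun w => w (0, 1) - w (1, 1)) (by fun_prop)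
    (by fun_prop) hw.2 ℓ
  obtain ⟨k₁, k₂⟩ := k
  unfold cornerCoeff
  fin_cases k₁ <;> fin_cases k₂
  · exact (hα 0).add (hα 1)
  · exact (hβ 1).sub (hα 1)
  · exact (hβ 0).sub (hα 0)
  · exact (hβ 0).neg.sub (hβ 1)

end CornerCoefficients

/-! ### The irregular kernel: homogeneity, continuity and its value on parallelograms. -/

section IrregularTerm

variable {ν : ℝ}

theorem G_zero (ν : ℝ) : G ν 0 = 0 := by simp [G]

theorem eq_one_of_exists_int (hν : ν ∈ Ioo (0 : ℝ) 2) (h : ∃ m : ℤ, (m : ℝ) = ν) : ν = 1 := by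
  obtain ⟨m, rfl⟩ := h
  have h0 : (0 : ℤ) < m := by exact_mod_cast hν.1
  have h2 : m < 2 := by exact_mod_cast hν.2
  have : m = 1 := by omega
  simp [this]

/-- The only integer in the range is `ν = 1`, where splitting `log (h s)` leaves a multiple of `s ^
2`; cancelling weights later remove that defect. -/
theorem G_mul (hν : ν ∈ Ioo (0 : ℝ) 2) {h : ℝ} (hh : 0 < h) :
    ∃ κ : ℝ, ∀ s, 0 ≤ s → G ν (h * s) = h ^ (2 * ν) * G ν s + κ * s ^ 2 := by
  by_cases hm : ∃ m : ℤ, (m : ℝ) = ν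
  · have h1 := eq_one_of_exists_int hν hm
    refine ⟨h ^ (2 * ν) * Real.log h, fun s hs => ?_⟩
    rcases hs.eq_or_lt with rfl | hs
    · simp [G]
    · rw [G, G, if_neg (by positivity), if_neg hs.ne', if_pos hm, if_pos hm,
        Real.mul_rpow hh.le hs.le, Real.log_mul hh.ne' hs.ne', h1]
      norm_num
      ring
  · refine ⟨0, fun s hs => ?_⟩
    rcases hs.eq_or_lt with rfl | hs
    · simp [G]
    · rw [G, G, if_neg (by positivity), if_neg hs.ne', if_neg hm, if_neg hm,
        Real.mul_rpow hh.le hs.le]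
      ring

theorem continuous_G (hν : ν ∈ Ioo (0 : ℝ) 2) : Continuous (G ν) := by
  by_cases hm : ∃ m : ℤ, (m : ℝ) = ν
  · have h1 := eq_one_of_exists_int hν hm
    have : G ν = fun s => s * (s * Real.log s) := by
      funext s
      by_cases hs : s = 0
      · simp [G, hs]
      · rw [G, if_neg hs, if_pos hm, h1]
        norm_num
        ring
    rw [this]
    exact continuous_id.mul Real.continuous_mul_log
  · have : G ν = fun s => s ^ (2 * ν) := by
      funext s
      by_cases hs : s = 0
      · rw [hs, G_zero, Real.zero_rpow (by linarith [hν.1])]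
      · rw [G, if_neg hs, if_neg hm]
    rw [this]
    exact Real.continuous_rpow_const (by linarith [hν.1])

variable {K : Type*} [Fintype K]

/-- The quadratic form with kernel `G ν ‖x - y‖`, for weights `c` at the points `w`. -/
noncomputable def gForm (ν : ℝ) (c : K → ℝ) (w : K → Plane) : ℝ :=
  ∑ k, ∑ l, c k * c l * G ν ‖w k - w l‖

theorem sum_sum_mul_norm_sq_eq_zero {c : K → ℝ} {w : K → Plane} (hc : ∑ k, c k = 0)
    (hw : ∀ j, ∑ k, c k * w k j = 0) : ∑ k, ∑ l, c k * c l * ‖w k - w l‖ ^ 2 = 0 := by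
  rw [← sum_sum_affine_eq_zero c c w w hc hw hc hw (fun l => ‖w l‖ ^ 2) (fun l => -2 * w l 0)
    (fun l => -2 * w l 1) (fun k => ‖w k‖ ^ 2) (fun _ => 0) (fun _ => 0)]
  refine Finset.sum_congr rfl fun k _ => Finset.sum_congr rfl fun l _ => ?_
  congr 1
  simp only [EuclideanSpace.real_norm_sq_eq, Fin.sum_univ_two, PiLp.sub_apply]
  ring

theorem gForm_add_smul (hν : ν ∈ Ioo (0 : ℝ) 2) {h : ℝ} (hh : 0 < h) {c : K → ℝ} {w : K → Plane}
    (hc : ∑ k, c k = 0) (hw : ∀ j, ∑ k, c k * w k j = 0) (x : Plane) :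
    gForm ν c (fun k => x + h • w k) = h ^ (2 * ν) * gForm ν c w := by
  obtain ⟨κ, hκ⟩ := G_mul hν hh
  have e : ∀ k l, G ν ‖x + h • w k - (x + h • w l)‖
      = h ^ (2 * ν) * G ν ‖w k - w l‖ + κ * ‖w k - w l‖ ^ 2 := fun k l => by
    rw [show x + h • w k - (x + h • w l) = h • (w k - w l) by module, norm_smul,
      Real.norm_eq_abs, abs_of_pos hh, hκ _ (norm_nonneg _)]
  calc gForm ν c (fun k => x + h • w k)
      = ∑ k, ∑ l, (h ^ (2 * ν) * (c k * c l * G ν ‖w k - w l‖)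
          + κ * (c k * c l * ‖w k - w l‖ ^ 2)) := by
        simp only [gForm, e]
        refine Finset.sum_congr rfl fun k _ => Finset.sum_congr rfl fun l _ => ?_
        ring
    _ = _ := by
        simp_rw [Finset.sum_add_distrib, ← Finset.mul_sum]
        rw [sum_sum_mul_norm_sq_eq_zero hc hw, mul_zero, add_zero, gForm]

theorem gForm_const_mul (ν a : ℝ) (c : K → ℝ) (w : K → Plane) :
    gForm ν (fun k => a * c k) w = a ^ 2 * gForm ν c w := by
  simp only [gForm, Finset.mul_sum]
  refine Finset.sum_congr rfl fun k _ => Finset.sum_congr rfl fun l _ => ?_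
  ring

theorem continuousAt_gForm_cornerCoeff (hν : ν ∈ Ioo (0 : ℝ) 2) {w : Fin 2 × Fin 2 → Plane}
    (hw : IsNondegenerate w) (ℓ : Fin 2) :
    ContinuousAt (fun w => gForm ν (cornerCoeff ℓ w) w) w := by
  unfold gForm
  have h : ∀ k l : Fin 2 × Fin 2, ContinuousAt (fun w : Fin 2 × Fin 2 → Plane =>
      cornerCoeff ℓ w k * cornerCoeff ℓ w l * G ν ‖w k - w l‖) w := fun k l =>
    ((continuousAt_cornerCoeff hw ℓ k).mul (continuousAt_cornerCoeff hw ℓ l)).mul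
      ((continuous_G hν).comp (by fun_prop : Continuous fun w : Fin 2 × Fin 2 → Plane =>
        ‖w k - w l‖)).continuousAt
  exact tendsto_finsetSum _ fun k _ => tendsto_finsetSum _ fun l _ => h k l

/-- The diagonal pairs may be restored because `G ν 0 = 0`. -/
theorem fBar_eq_sum_gForm (φ : Plane → Plane) (ν βs : ℝ) (n θ : ℕ) (ℓ : Fin 2) :
    fBar φ ν βs n θ ℓ = βs * ∑ i₁ ∈ Finset.Icc 1 (n - θ), ∑ i₂ ∈ Finset.Icc 1 (n - θ),
      gForm ν (coeff φ n θ ℓ i₁ i₂) (corners φ n θ i₁ i₂) := by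
  simp only [fBar, gForm]
  congr 1
  refine Finset.sum_congr rfl fun i₁ _ => Finset.sum_congr rfl fun i₂ _ =>
    Finset.sum_congr rfl fun k _ => ?_
  rw [Finset.sum_filter]
  refine Finset.sum_congr rfl fun l _ => ?_
  split_ifs with h
  · rfl
  · rw [not_not] at h
    rw [h, sub_self, norm_zero, G_zero, mul_zero]

/-- The corners of the parallelogram spanned by `a` and `b`. -/
def parallelogram (a b : Plane) (k : Fin 2 × Fin 2) : Plane :=
  ((k.1 : ℕ) : ℝ) • a + ((k.2 : ℕ) : ℝ) • b

theorem isNondegenerate_parallelogram {a b : Plane} (h : cross a b ≠ 0) :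
    IsNondegenerate (parallelogram a b) := by
  constructor
  · simpa [parallelogram] using h
  · have : cross (-b) (-a) = -cross a b := by simp [cross]; ring
    simpa [parallelogram, this] using h

/-- The edge vectors at opposite corners are negatives of each other, so the weights reduce to `±t`
in a checkerboard pattern: edges enter with weight `-t²`, diagonals with `t²`. -/
theorem gForm_parallelogram {a b : Plane} (ℓ : Fin 2) :
    gForm ν (cornerCoeff ℓ (parallelogram a b)) (parallelogram a b) =
      2 * ((b ℓ.rev - a ℓ.rev) ^ 2 / cross a b ^ 2 *
        (-2 * G ν ‖b‖ - 2 * G ν ‖a‖ + G ν ‖a + b‖ + G ν ‖b - a‖)) := by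
  have hx : cross (-b) (-a) = -cross a b := by simp [cross]; ring
  obtain ⟨t, ht, hc⟩ : ∃ t : ℝ, t ^ 2 = (b ℓ.rev - a ℓ.rev) ^ 2 / cross a b ^ 2 ∧
      cornerCoeff ℓ (parallelogram a b) = fun k => !![t, -t; -t, t] k.1 k.2 := by
    fin_cases ℓ
    · refine ⟨(b 1 - a 1) / cross a b, by simp [div_pow], ?_⟩
      funext k
      obtain ⟨k₁, k₂⟩ := k
      fin_cases k₁ <;> fin_cases k₂ <;> simp [cornerCoeff, parallelogram, invEntry, hx, inv_neg] <;>
        ring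
    · refine ⟨(a 0 - b 0) / cross a b, by simp [div_pow]; ring, ?_⟩
      funext k
      obtain ⟨k₁, k₂⟩ := k
      fin_cases k₁ <;> fin_cases k₂ <;> simp [cornerCoeff, parallelogram, invEntry, hx, inv_neg] <;>
        ring
  rw [← ht, hc]
  have n3 : ‖a - b‖ = ‖b - a‖ := norm_sub_rev a b
  have n4 : ‖-b + -a‖ = ‖a + b‖ := by rw [← norm_neg]; congr 1; abel
  simp [gForm, parallelogram, Fintype.sum_prod_type, Fin.sum_univ_two, G_zero, n3, n4]
  ring

theorem gForm_lin_eq_J {φ : Plane → Plane} {D : Set Plane} (hφ : IsC2DiffeoOn φ D) (ν : ℝ)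
    (ℓ : Fin 2) {p : Plane} (hp : p ∈ D) :
    gForm ν (cornerCoeff ℓ (parallelogram (fderiv ℝ φ p (basisVec 0)) (fderiv ℝ φ p (basisVec 1))))
      (parallelogram (fderiv ℝ φ p (basisVec 0)) (fderiv ℝ φ p (basisVec 1))) =
      2 * J φ ν ℓ p := by
  rw [gForm_parallelogram, J]
  simp only [pderiv_apply_eq_fderiv hφ hp, EuclideanSpace.norm_eq, Real.norm_eq_abs, sq_abs,
    PiLp.add_apply, PiLp.sub_apply]
  congr 3
  simp only [cross]
  ring

end IrregularTerm

/-! ### Rescaled lattice cells and their uniform convergence to tangent parallelograms. -/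

section Lattice

variable {φ : Plane → Plane} {D : Set Plane}

/-- The images of the corners of the unit square under the derivative of `φ` at `p`. -/
noncomputable def frame (φ : Plane → Plane) (p : Plane) : Fin 2 × Fin 2 → Plane :=
  parallelogram (fderiv ℝ φ p (basisVec 0)) (fderiv ℝ φ p (basisVec 1))

/-- The corners of the deformed cell at `p` of side `h`, relative to `φ p` and rescaled. -/
noncomputable def rescaledCell (φ : Plane → Plane) (h : ℝ) (p : Plane) (k : Fin 2 × Fin 2) :
    Plane :=
  h⁻¹ • (φ (p + h • parallelogram (basisVec 0) (basisVec 1) k) - φ p)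

theorem frame_eq (φ : Plane → Plane) (p : Plane) (k : Fin 2 × Fin 2) :
    frame φ p k = fderiv ℝ φ p (parallelogram (basisVec 0) (basisVec 1) k) := by
  simp [frame, parallelogram]

theorem norm_le_abs_add_abs (x : Plane) : ‖x‖ ≤ |x 0| + |x 1| := by
  rw [EuclideanSpace.norm_eq, Real.sqrt_le_left (by positivity)]
  simp only [Fin.sum_univ_two, Real.norm_eq_abs]
  nlinarith [mul_nonneg (abs_nonneg (x 0)) (abs_nonneg (x 1))]

theorem norm_parallelogram_le (k : Fin 2 × Fin 2) :
    ‖parallelogram (basisVec 0) (basisVec 1) k‖ ≤ 2 := by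
  refine (norm_le_abs_add_abs _).trans ?_
  obtain ⟨k₁, k₂⟩ := k
  fin_cases k₁ <;> fin_cases k₂ <;> (simp [parallelogram, basisVec]; try norm_num)

theorem IsC2DiffeoOn.cross_ne_zero (hφ : IsC2DiffeoOn φ D) {p : Plane} (hp : p ∈ D) :
    cross (fderiv ℝ φ p (basisVec 0)) (fderiv ℝ φ p (basisVec 1)) ≠ 0 :=
  hφ.jacobian_ne_zero hp

theorem IsC2DiffeoOn.isNondegenerate_frame (hφ : IsC2DiffeoOn φ D) {p : Plane} (hp : p ∈ D) :
    IsNondegenerate (frame φ p) :=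
  isNondegenerate_parallelogram (hφ.cross_ne_zero hp)

theorem IsC2DiffeoOn.continuousOn_frame (hφ : IsC2DiffeoOn φ D) : ContinuousOn (frame φ) D := by
  refine continuousOn_pi.2 fun k => ?_
  simp only [frame_eq]
  exact hφ.continuousOn_fderiv.clm_apply continuousOn_const

theorem IsC2DiffeoOn.dist_rescaledCell_frame_lt (hφ : IsC2DiffeoOn φ D) (hD : unitSquare ⊆ D)
    {ε : ℝ} (hε : 0 < ε) : ∃ δ > 0, ∀ h : ℝ, 0 < h → h < δ → ∀ p ∈ unitSquare,
      (∀ k, p + h • parallelogram (basisVec 0) (basisVec 1) k ∈ unitSquare) →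
      dist (rescaledCell φ h p) (frame φ p) < ε := by
  obtain ⟨δ, hδ, hb⟩ := hφ.uniform_fderiv hD (show 0 < ε / 4 by positivity)
  refine ⟨δ / 4, by positivity, fun h h0 hlt p hp hk => ?_⟩
  refine (dist_pi_lt_iff hε).2 fun k => ?_
  set v := parallelogram (basisVec 0) (basisVec 1) k with hv
  have hv2 : ‖v‖ ≤ 2 := norm_parallelogram_le k
  have hn : ‖h • v‖ ≤ h * 2 := by
    rw [norm_smul, Real.norm_eq_abs, abs_of_pos h0]
    gcongr
  have h1 := hb (p + h • v) (hk k) p hp (by rw [add_sub_cancel_left]; linarith)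
  rw [add_sub_cancel_left, map_smul] at h1
  have e : rescaledCell φ h p k - frame φ p k =
      h⁻¹ • (φ (p + h • v) - φ p - h • fderiv ℝ φ p v) := by
    rw [frame_eq, rescaledCell, smul_sub h⁻¹ _ (h • _), inv_smul_smul₀ h0.ne']
  rw [dist_eq_norm, e, norm_smul, norm_inv, Real.norm_eq_abs, abs_of_pos h0,
    inv_mul_lt_iff₀ h0]
  calc _ ≤ ε / 4 * ‖h • v‖ := h1
    _ ≤ ε / 4 * (h * 2) := by gcongr
    _ < h * ε := by nlinarith [mul_pos h0 hε]

theorem IsC2DiffeoOn.isCompact_range_frame (hφ : IsC2DiffeoOn φ D) (hD : unitSquare ⊆ D) :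
    IsCompact (frame φ '' unitSquare) :=
  isCompact_unitSquare.image_of_continuousOn (hφ.continuousOn_frame.mono hD)

/-- The lattice point `(i₁ / n, i₂ / n)`. -/
noncomputable def latticePoint (n i₁ i₂ : ℕ) : Plane := !₂[(i₁ : ℝ) / n, (i₂ : ℝ) / n]

theorem latticePoint_add (n θ i₁ i₂ : ℕ) (k : Fin 2 × Fin 2) :
    latticePoint n (i₁ + θ * k.1) (i₂ + θ * k.2) =
      latticePoint n i₁ i₂ + ((θ : ℝ) / n) • parallelogram (basisVec 0) (basisVec 1) k := by
  ext j
  fin_cases j <;> simp [latticePoint, parallelogram, basisVec] <;> ring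

theorem latticePoint_mem_unitSquare {n i₁ i₂ : ℕ} (h₁ : i₁ ≤ n) (h₂ : i₂ ≤ n) :
    latticePoint n i₁ i₂ ∈ unitSquare := by
  have h : ∀ i : ℕ, i ≤ n → (i : ℝ) / n ∈ Icc (0 : ℝ) 1 := fun i hi =>
    ⟨by positivity, div_le_one_of_le₀ (by exact_mod_cast hi) (by positivity)⟩
  intro j
  fin_cases j
  · exact h i₁ h₁
  · exact h i₂ h₂

theorem add_mul_fin_le {n θ i : ℕ} (hi : i ∈ Finset.Icc 1 (n - θ)) (a : Fin 2) :
    i + θ * a ≤ n := by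
  rw [Finset.mem_Icc] at hi
  have ha : (a : ℕ) ≤ 1 := by omega
  calc i + θ * a ≤ i + θ * 1 := by gcongr
    _ ≤ n := by omega

theorem latticePoint_add_mem {n θ i₁ i₂ : ℕ} (h₁ : i₁ ∈ Finset.Icc 1 (n - θ))
    (h₂ : i₂ ∈ Finset.Icc 1 (n - θ)) (k : Fin 2 × Fin 2) :
    latticePoint n (i₁ + θ * k.1) (i₂ + θ * k.2) ∈ unitSquare :=
  latticePoint_mem_unitSquare (add_mul_fin_le h₁ _) (add_mul_fin_le h₂ _)

theorem corners_eq (φ : Plane → Plane) (n θ i₁ i₂ : ℕ) (k : Fin 2 × Fin 2) :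
    corners φ n θ i₁ i₂ k = φ (latticePoint n (i₁ + θ * k.1) (i₂ + θ * k.2)) := rfl

theorem corners_mem {n θ i₁ i₂ : ℕ} (h₁ : i₁ ∈ Finset.Icc 1 (n - θ))
    (h₂ : i₂ ∈ Finset.Icc 1 (n - θ)) (k : Fin 2 × Fin 2) :
    corners φ n θ i₁ i₂ k ∈ imageSquare φ :=
  mem_image_of_mem φ (latticePoint_add_mem h₁ h₂ k)

theorem corners_eq_add_smul (φ : Plane → Plane) {n θ : ℕ} (hn : 0 < n) (hθ : 0 < θ) (i₁ i₂ : ℕ) :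
    corners φ n θ i₁ i₂ = fun k => φ (latticePoint n i₁ i₂) +
      ((θ : ℝ) / n) • rescaledCell φ (θ / n) (latticePoint n i₁ i₂) k := by
  funext k
  have h : (θ : ℝ) / n ≠ 0 := by positivity
  rw [corners_eq, rescaledCell, ← latticePoint_add, smul_inv_smul₀ h]
  abel

theorem IsC2DiffeoOn.eventually_dist_lt (hφ : IsC2DiffeoOn φ D) (hD : unitSquare ⊆ D) {θ : ℕ}
    (hθ : 0 < θ) {ε : ℝ} (hε : 0 < ε) :
    ∀ᶠ n : ℕ in atTop, 0 < n ∧ ∀ i₁ ∈ Finset.Icc 1 (n - θ), ∀ i₂ ∈ Finset.Icc 1 (n - θ),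
      latticePoint n i₁ i₂ ∈ unitSquare ∧
      dist (rescaledCell φ (θ / n) (latticePoint n i₁ i₂)) (frame φ (latticePoint n i₁ i₂)) < ε := by
  obtain ⟨δ, hδ, h⟩ := hφ.dist_rescaledCell_frame_lt hD hε
  have hlim : Tendsto (fun n : ℕ => (θ : ℝ) / n) atTop (𝓝 0) := tendsto_const_div_atTop_nhds_zero_nat _
  filter_upwards [hlim.eventually (gt_mem_nhds hδ), eventually_gt_atTop 0] with n hn hn0
  refine ⟨hn0, fun i₁ h₁ i₂ h₂ => ?_⟩
  have hp : latticePoint n i₁ i₂ ∈ unitSquare := by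
    simpa using latticePoint_add_mem h₁ h₂ (0, 0)
  refine ⟨hp, h _ (by positivity) hn _ hp fun k => ?_⟩
  rw [← latticePoint_add]
  exact latticePoint_add_mem h₁ h₂ k

/-- Rescaled cells need not be frames, so continuity along the set of frames would not do;
continuity of `F` at each point of this compact set is uniform with respect to nearby points outside
it. -/
theorem IsC2DiffeoOn.eventually_abs_sub_lt (hφ : IsC2DiffeoOn φ D) (hD : unitSquare ⊆ D) {θ : ℕ}
    (hθ : 0 < θ) {F : (Fin 2 × Fin 2 → Plane) → ℝ}
    (hF : ∀ p ∈ unitSquare, ContinuousAt F (frame φ p)) {ε : ℝ} (hε : 0 < ε) :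
    ∀ᶠ n : ℕ in atTop, ∀ i₁ ∈ Finset.Icc 1 (n - θ), ∀ i₂ ∈ Finset.Icc 1 (n - θ),
      |F (rescaledCell φ (θ / n) (latticePoint n i₁ i₂)) - F (frame φ (latticePoint n i₁ i₂))|
        < ε := by
  have := (hφ.isCompact_range_frame hD).uniformContinuousAt_of_continuousAt F
    (by rintro _ ⟨p, hp, rfl⟩; exact hF p hp) (Metric.dist_mem_uniformity hε)
  obtain ⟨δ, hδ, h⟩ := Metric.mem_uniformity_dist.1 this
  filter_upwards [hφ.eventually_dist_lt hD hθ hδ] with n hn i₁ h₁ i₂ h₂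
  obtain ⟨hp, hd⟩ := hn.2 i₁ h₁ i₂ h₂
  have h2 := h (a := frame φ (latticePoint n i₁ i₂)) (by rw [dist_comm]; exact hd)
    (mem_image_of_mem _ hp)
  rw [← Real.dist_eq, dist_comm]
  exact h2

theorem IsC2DiffeoOn.exists_eventually_abs_le (hφ : IsC2DiffeoOn φ D) (hD : unitSquare ⊆ D) {θ : ℕ}
    (hθ : 0 < θ) {F : (Fin 2 × Fin 2 → Plane) → ℝ}
    (hF : ∀ p ∈ unitSquare, ContinuousAt F (frame φ p)) :
    ∃ C > 0, ∀ᶠ n : ℕ in atTop, ∀ i₁ ∈ Finset.Icc 1 (n - θ), ∀ i₂ ∈ Finset.Icc 1 (n - θ),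
      |F (rescaledCell φ (θ / n) (latticePoint n i₁ i₂))| ≤ C := by
  have hc : ContinuousOn (fun p => F (frame φ p)) unitSquare := fun p hp =>
    (hF p hp).comp_continuousWithinAt (hφ.continuousOn_frame.mono hD p hp)
  obtain ⟨C, hC⟩ := isCompact_unitSquare.exists_bound_of_continuousOn hc
  refine ⟨|C| + 1, by positivity, ?_⟩
  filter_upwards [hφ.eventually_abs_sub_lt hD hθ hF one_pos,
    hφ.eventually_dist_lt hD hθ one_pos] with n hn hn' i₁ h₁ i₂ h₂
  have h1 := hn i₁ h₁ i₂ h₂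
  have h2 := hC _ (hn'.2 i₁ h₁ i₂ h₂).1
  rw [Real.norm_eq_abs] at h2
  have h3 := abs_sub_abs_le_abs_sub (F (rescaledCell φ (θ / n) (latticePoint n i₁ i₂)))
    (F (frame φ (latticePoint n i₁ i₂)))
  linarith [le_abs_self C]

theorem IsC2DiffeoOn.eventually_isNondegenerate (hφ : IsC2DiffeoOn φ D) (hD : unitSquare ⊆ D)
    {θ : ℕ} (hθ : 0 < θ) :
    ∀ᶠ n : ℕ in atTop, ∀ i₁ ∈ Finset.Icc 1 (n - θ), ∀ i₂ ∈ Finset.Icc 1 (n - θ),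
      IsNondegenerate (rescaledCell φ (θ / n) (latticePoint n i₁ i₂)) := by
  obtain ⟨δ, hδ, h⟩ := (hφ.isCompact_range_frame hD).exists_thickening_subset_open
    isOpen_isNondegenerate
    (by rintro _ ⟨p, hp, rfl⟩; exact hφ.isNondegenerate_frame (hD hp))
  filter_upwards [hφ.eventually_dist_lt hD hθ hδ] with n hn i₁ h₁ i₂ h₂
  obtain ⟨hp, hd⟩ := hn.2 i₁ h₁ i₂ h₂
  exact h (Metric.mem_thickening_iff.2 ⟨_, mem_image_of_mem _ hp, hd⟩)

/-- Size and cancellation properties of the coefficients for all large `n`. -/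
theorem IsC2DiffeoOn.exists_eventually_coeff (hφ : IsC2DiffeoOn φ D) (hD : unitSquare ⊆ D)
    {θ : ℕ} (hθ : 0 < θ) (ℓ : Fin 2) :
    ∃ C > 0, ∀ᶠ n : ℕ in atTop, ∀ i₁ ∈ Finset.Icc 1 (n - θ), ∀ i₂ ∈ Finset.Icc 1 (n - θ),
      (∀ j, ∑ k, coeff φ n θ ℓ i₁ i₂ k * corners φ n θ i₁ i₂ k j = 0) ∧
      (∀ k, |coeff φ n θ ℓ i₁ i₂ k| ≤ C * n) ∧
      (∀ k l, ‖corners φ n θ i₁ i₂ k - corners φ n θ i₁ i₂ l‖ ≤ C / n) := by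
  have hF : ∀ k, ∀ p ∈ unitSquare, ContinuousAt (fun w => cornerCoeff ℓ w k) (frame φ p) :=
    fun k p hp => continuousAt_cornerCoeff (hφ.isNondegenerate_frame (hD hp)) ℓ k
  choose C hC hCb using fun k => hφ.exists_eventually_abs_le hD hθ (hF k)
  obtain ⟨L, hL, hLb⟩ := hφ.exists_upper_lipschitz hD
  have hθ1 : (1 : ℝ) ≤ θ := by exact_mod_cast hθ
  refine ⟨∑ k, C k + L * (4 * θ), add_pos (Finset.sum_pos (fun k _ => hC k) ⟨(0, 0), by simp⟩)
    (by positivity), ?_⟩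
  have hsum : ∀ k, C k ≤ ∑ k, C k := fun k =>
    Finset.single_le_sum (fun k _ => (hC k).le) (Finset.mem_univ k)
  filter_upwards [eventually_all.2 hCb, hφ.eventually_isNondegenerate hD hθ,
    eventually_gt_atTop 0] with n hn hnd hn0 i₁ h₁ i₂ h₂
  have hh : (θ : ℝ) / n ≠ 0 := by positivity
  have hn0' : (0 : ℝ) < n := by exact_mod_cast hn0
  refine ⟨fun j => ?_, fun k => ?_, fun k l => ?_⟩
  · rw [coeff_eq_cornerCoeff]
    refine sum_cornerCoeff_mul ?_ ℓ j
    rw [corners_eq_add_smul φ hn0 hθ]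
    exact isNondegenerate_add_smul hh _ (hnd i₁ h₁ i₂ h₂)
  -- The weights scale as an inverse length, here `n / θ ≤ n`.
  · rw [coeff_eq_cornerCoeff, corners_eq_add_smul φ hn0 hθ, cornerCoeff_add_smul hh, abs_mul,
      inv_div, abs_of_nonneg (by positivity), mul_comm]
    refine mul_le_mul ((hn k i₁ h₁ i₂ h₂).trans ((hsum k).trans ?_))
      (div_le_self hn0'.le hθ1) (by positivity)
      (add_nonneg (Finset.sum_nonneg fun k _ => (hC k).le) (by positivity))
    linarith [show 0 ≤ L * (4 * θ) by positivity]
  · refine (hLb _ (latticePoint_add_mem h₁ h₂ k) _ (latticePoint_add_mem h₁ h₂ l)).trans ?_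
    rw [latticePoint_add, latticePoint_add, add_sub_add_left_eq_sub, ← smul_sub, norm_smul,
      Real.norm_eq_abs, abs_of_nonneg (by positivity)]
    have h4 := (norm_sub_le (parallelogram (basisVec 0) (basisVec 1) k)
      (parallelogram (basisVec 0) (basisVec 1) l)).trans
      (add_le_add (norm_parallelogram_le k) (norm_parallelogram_le l))
    have hs : 0 ≤ ∑ k, C k := Finset.sum_nonneg fun k _ => (hC k).le
    calc L * (θ / n * _) ≤ L * (θ / n * (2 + 2)) := by gcongr
      _ = L * (4 * θ) / n := by ring
      _ ≤ _ := by gcongr; linarith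

theorem IsC2DiffeoOn.exists_corner_separation (hφ : IsC2DiffeoOn φ D) (hD : unitSquare ⊆ D)
    (θ : ℕ) : ∃ c > 0, ∀ n : ℕ, 0 < n → ∀ i₁ ∈ Finset.Icc 1 (n - θ), ∀ i₂ ∈ Finset.Icc 1 (n - θ),
      ∀ j₁ ∈ Finset.Icc 1 (n - θ), ∀ j₂ ∈ Finset.Icc 1 (n - θ),
      c * max |(i₁ : ℝ) - j₁| |(i₂ : ℝ) - j₂| / n ≤
        ‖corners φ n θ i₁ i₂ (0, 0) - corners φ n θ j₁ j₂ (0, 0)‖ := by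
  obtain ⟨c, hc, h⟩ := hφ.exists_lower_lipschitz hD
  refine ⟨c, hc, fun n hn i₁ hi₁ i₂ hi₂ j₁ hj₁ j₂ hj₂ => ?_⟩
  have hn0' : (0 : ℝ) < n := by exact_mod_cast hn
  refine le_trans ?_ (h _ (latticePoint_add_mem hi₁ hi₂ (0, 0)) _
    (latticePoint_add_mem hj₁ hj₂ (0, 0)))
  rw [mul_div_assoc]
  gcongr
  have e : ∀ j : Fin 2, |(latticePoint n i₁ i₂ - latticePoint n j₁ j₂) j| ≤
      ‖latticePoint n i₁ i₂ - latticePoint n j₁ j₂‖ := fun j => by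
    rw [← Real.norm_eq_abs]; exact PiLp.norm_apply_le _ j
  rw [← max_div_div_right hn0'.le]
  have e0 := e 0
  have e1 := e 1
  simp only [latticePoint, PiLp.sub_apply] at e0 e1
  simp only [Matrix.cons_val_zero, Matrix.cons_val_one, ← sub_div, abs_div, Nat.abs_cast] at e0 e1
  simpa [latticePoint] using ⟨e0, e1⟩

end Lattice

/-! ### The covariance expansion tested against cancelling weights. -/

section Expansion

variable {K : Type*} [Fintype K] {ν βs : ℝ} {β : ℕ → ℝ} {κ : Plane → Plane → ℝ}

/-- Since `⌊ν⌋₊ ≤ 1`, the polynomial part is a constant plus at most a multiple of the squared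
distance, and the weights cancel both. -/
theorem HasIrregularExpansion.abs_sum_sum_sub_le (hν : ν ∈ Ioo (0 : ℝ) 2)
    (hκ : HasIrregularExpansion κ ν β βs) :
    ∃ τ > 0, ∃ C > 0, ∃ δ > 0, ∀ (c : K → ℝ) (x : K → Plane), ∑ k, c k = 0 →
      (∀ j, ∑ k, c k * x k j = 0) → ∀ ρ < δ, (∀ k l, ‖x k - x l‖ ≤ ρ) →
      |∑ k, ∑ l, c k * c l * κ (x k) (x l) - βs * gForm ν c x| ≤
        (∑ k, |c k|) ^ 2 * (C * ρ ^ (2 * ν + τ)) := by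
  obtain ⟨r, hr, τ, hτ, C, δ, hδ, hC⟩ := hκ
  refine ⟨τ, hτ, |C| + 1, by positivity, δ, hδ, fun c x hc hx ρ hρ hxρ => ?_⟩
  have hfl : ⌊ν⌋₊ = 0 ∨ ⌊ν⌋₊ = 1 := by
    have : ⌊ν⌋₊ < 2 := (Nat.floor_lt hν.1.le).2 (by exact_mod_cast hν.2)
    omega
  have hpoly : ∑ k, ∑ l, c k * c l * ∑ j ∈ Finset.range (⌊ν⌋₊ + 1), β j * ‖x k - x l‖ ^ (2 * j)
      = 0 := by
    have h0 : ∑ k, ∑ l, c k * c l * β 0 = 0 := by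
      simp_rw [mul_assoc, ← Finset.mul_sum, ← Finset.sum_mul, hc, zero_mul]
    have h1 : ∑ k, ∑ l, c k * c l * (β 1 * ‖x k - x l‖ ^ 2) = 0 := by
      have := sum_sum_mul_norm_sq_eq_zero hc hx
      calc _ = β 1 * ∑ k, ∑ l, c k * c l * ‖x k - x l‖ ^ 2 := by
            simp only [Finset.mul_sum]
            refine Finset.sum_congr rfl fun k _ => Finset.sum_congr rfl fun l _ => by ring
        _ = 0 := by rw [this, mul_zero]
    rcases hfl with h | h
    · simp [h, h0]
    · simp [h, Finset.sum_range_succ, mul_add, Finset.sum_add_distrib, h0, h1]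
  have e : ∑ k, ∑ l, c k * c l * κ (x k) (x l) - βs * gForm ν c x =
      ∑ k, ∑ l, c k * c l * r (x k) (x l) := by
    simp_rw [hr, mul_add, Finset.sum_add_distrib]
    rw [hpoly, gForm, zero_add, Finset.mul_sum]
    simp_rw [Finset.mul_sum]
    rw [add_sub_right_comm, sub_eq_zero.2, zero_add]
    refine Finset.sum_congr rfl fun k _ => Finset.sum_congr rfl fun l _ => by ring
  rw [e, sq, Finset.sum_mul_sum, Finset.sum_mul]
  refine (Finset.abs_sum_le_sum_abs _ _).trans (Finset.sum_le_sum fun k _ => ?_)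
  rw [Finset.sum_mul]
  refine (Finset.abs_sum_le_sum_abs _ _).trans (Finset.sum_le_sum fun l _ => ?_)
  rw [abs_mul, abs_mul]
  refine mul_le_mul_of_nonneg_left ?_ (by positivity)
  have hexp : 0 ≤ 2 * ν + τ := by linarith [hν.1]
  calc |r (x k) (x l)| ≤ C * ‖x k - x l‖ ^ (2 * ν + τ) := hC _ _ ((hxρ k l).trans_lt hρ)
    _ ≤ (|C| + 1) * ‖x k - x l‖ ^ (2 * ν + τ) := by
        gcongr; linarith [le_abs_self C]
    _ ≤ _ := by
        gcongr
        exact hxρ k l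

/-- Positive semidefiniteness of the kernel determines the sign of the irregular term. -/
theorem HasIrregularExpansion.mul_gForm_nonneg (hν : ν ∈ Ioo (0 : ℝ) 2)
    (hκ : HasIrregularExpansion κ ν β βs)
    (hpos : ∀ (c : K → ℝ) (x : K → Plane), 0 ≤ ∑ k, ∑ l, c k * c l * κ (x k) (x l))
    {c : K → ℝ} {w : K → Plane} (hc : ∑ k, c k = 0) (hw : ∀ j, ∑ k, c k * w k j = 0) :
    0 ≤ βs * gForm ν c w := by
  obtain ⟨τ, hτ, C, hC, δ, hδ, h⟩ := hκ.abs_sum_sum_sub_le (K := K) hν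
  obtain ⟨R, hR0, hR⟩ : ∃ R > 0, ∀ k l, ‖w k - w l‖ ≤ R := by
    refine ⟨∑ k, ∑ l, ‖w k - w l‖ + 1, by positivity, fun k l => ?_⟩
    have h1 := Finset.single_le_sum (f := fun l => ‖w k - w l‖) (fun _ _ => norm_nonneg _)
      (Finset.mem_univ l)
    have h2 := Finset.single_le_sum (f := fun k => ∑ l, ‖w k - w l‖)
      (fun _ _ => Finset.sum_nonneg fun _ _ => norm_nonneg _) (Finset.mem_univ k)
    linarith
  set A := (∑ k, |c k|) ^ 2 * (C * R ^ (2 * ν + τ)) with hA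
  -- The configuration is shrunk by `t`: the irregular term scales as `t ^ (2 * ν)` and the
  -- remainder is smaller by `t ^ τ`, so dividing by `t ^ (2 * ν)` and letting `t` tend to `0`
  -- leaves the sign.
  have key : ∀ t : ℝ, 0 < t → t * R < δ → -(A * t ^ τ) ≤ βs * gForm ν c w := by
    intro t ht htR
    have hc' : ∀ j, ∑ k, c k * (fun k => (0 : Plane) + t • w k) k j = 0 := fun j => by
      have : ∀ k, c k * ((0 : Plane) + t • w k) j = t * (c k * w k j) := fun k => by simp; ring
      simp_rw [this, ← Finset.mul_sum, hw, mul_zero]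
    have h1 := h c (fun k => 0 + t • w k) hc hc' (t * R) htR (fun k l => by
      rw [zero_add, zero_add, ← smul_sub, norm_smul, Real.norm_eq_abs, abs_of_pos ht]
      gcongr
      exact hR k l)
    rw [gForm_add_smul hν ht hc hw] at h1
    have h2 := (abs_le.1 h1).2
    have h3 := hpos c (fun k => 0 + t • w k)
    have e : (∑ k, |c k|) ^ 2 * (C * (t * R) ^ (2 * ν + τ)) = t ^ (2 * ν) * (A * t ^ τ) := by
      rw [Real.mul_rpow ht.le hR0.le, Real.rpow_add ht, hA]; ring
    rw [e] at h2
    have ht2 : 0 < t ^ (2 * ν) := by positivity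
    have h4 : 0 ≤ t ^ (2 * ν) * (A * t ^ τ + βs * gForm ν c w) := by linarith
    have := nonneg_of_mul_nonneg_right h4 ht2
    linarith
  have hlim : Tendsto (fun t : ℝ => -(A * t ^ τ)) (𝓝[>] 0) (𝓝 0) := by
    have : Tendsto (fun t : ℝ => -(A * t ^ τ)) (𝓝 0) (𝓝 (-(A * 0 ^ τ))) :=
      ((Real.continuous_rpow_const hτ.le).const_mul A).neg.tendsto 0
    rw [Real.zero_rpow hτ.ne', mul_zero, neg_zero] at this
    exact this.mono_left nhdsWithin_le_nhds
  refine le_of_tendsto hlim ?_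
  filter_upwards [self_mem_nhdsWithin, Ioo_mem_nhdsGT (div_pos hδ hR0)] with t ht ht2
  exact key t ht ((lt_div_iff₀ hR0).1 ht2.2)

end Expansion

/-! ### Finite linear combinations of the field and the quadratic variation as a sum over cells. -/

section Field

set_option linter.unusedSectionVars false

variable {Ω : Type*} [MeasurableSpace Ω] {P : Measure Ω} [IsProbabilityMeasure P]
  {X : Plane → Ω → ℝ}

/-- The linear combination of the values of the field at the points `x` with weights `c`. -/
def fieldSum {K : Type*} [Fintype K] (X : Plane → Ω → ℝ) (c : K → ℝ) (x : K → Plane) (ω : Ω) : ℝ :=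
  ∑ k, c k * X (x k) ω

theorem IsStationaryIsotropicGaussian.memLp (hX : IsStationaryIsotropicGaussian P X) (x : Plane) :
    MemLp (X x) 2 P :=
  (hX.gaussian.hasGaussianLaw_eval x).memLp_two

variable {K L : Type*} [Fintype K] [Fintype L]

theorem IsStationaryIsotropicGaussian.covariance_fieldSum (hX : IsStationaryIsotropicGaussian P X)
    (c : K → ℝ) (x : K → Plane) (d : L → ℝ) (y : L → Plane) :
    cov[fieldSum X c x, fieldSum X d y; P] = ∑ k, ∑ l, c k * d l * covFun P X (x k) (y l) := by
  have := covariance_fun_sum_fun_sum (μ := P) (X := fun k ω => c k * X (x k) ω)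
    (Y := fun l ω => d l * X (y l) ω) (fun k => (hX.memLp _).const_mul _)
    (fun l => (hX.memLp _).const_mul _)
  simp only [covariance_const_mul_left, covariance_const_mul_right] at this
  refine this.trans ?_
  refine Finset.sum_congr rfl fun k _ => Finset.sum_congr rfl fun l _ => ?_
  rw [covFun]; ring

theorem IsStationaryIsotropicGaussian.hasGaussianLaw_fieldSum {ι : Type*} [Fintype ι]
    (hX : IsStationaryIsotropicGaussian P X) (c : ι → K → ℝ) (x : ι → K → Plane) :
    HasGaussianLaw (fun ω i => fieldSum X (c i) (x i) ω) P := by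
  classical
  -- Different cells share sites, so joint Gaussianity is taken on the finite set of sites and
  -- pushed through one linear map.
  let I : Finset Plane := Finset.univ.biUnion fun i => Finset.univ.image (x i)
  have hI : ∀ i k, x i k ∈ I := fun i k => by
    simp only [I, Finset.mem_biUnion, Finset.mem_image]
    exact ⟨i, Finset.mem_univ _, k, Finset.mem_univ _, rfl⟩
  let T : (I → ℝ) →L[ℝ] (ι → ℝ) := ContinuousLinearMap.pi fun i =>
    ∑ k, c i k • ContinuousLinearMap.proj (R := ℝ) (φ := fun _ : I => ℝ) ⟨x i k, hI i k⟩
  have h := (hX.gaussian.hasGaussianLaw I).map_fun T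
  have e : (fun ω i => fieldSum X (c i) (x i) ω) =
      fun ω => T (I.restrict fun x => X x ω) := by
    funext ω i
    simp [T, fieldSum, Finset.restrict]
  rw [e]
  exact h

theorem IsStationaryIsotropicGaussian.hasGaussianLaw_fieldSum_single
    (hX : IsStationaryIsotropicGaussian P X) (c : K → ℝ) (x : K → Plane) :
    HasGaussianLaw (fieldSum X c x) P :=
  (hX.hasGaussianLaw_fieldSum (ι := Unit) (fun _ => c) (fun _ => x)).eval ()

theorem IsStationaryIsotropicGaussian.integral_fieldSum (hX : IsStationaryIsotropicGaussian P X)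
    {c : K → ℝ} (hc : ∑ k, c k = 0) (x : K → Plane) : P[fieldSum X c x] = 0 := by
  unfold fieldSum
  rw [integral_finsetSum _ fun k _ => ((hX.memLp _).integrable one_le_two).const_mul _]
  have : ∀ k, ∫ ω, c k * X (x k) ω ∂P = c k * P[X 0] := fun k => by
    rw [integral_const_mul, hX.mean_const (x k) 0]
  simp_rw [this, ← Finset.sum_mul, hc, zero_mul]

theorem IsStationaryIsotropicGaussian.integral_fieldSum_sq (hX : IsStationaryIsotropicGaussian P X)
    {c : K → ℝ} (hc : ∑ k, c k = 0) (x : K → Plane) :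
    ∫ ω, fieldSum X c x ω ^ 2 ∂P = ∑ k, ∑ l, c k * c l * covFun P X (x k) (x l) := by
  have hm := (hX.hasGaussianLaw_fieldSum_single c x).aemeasurable
  rw [← hX.covariance_fieldSum, covariance_self hm,
    variance_of_integral_eq_zero hm (hX.integral_fieldSum hc x)]

theorem IsStationaryIsotropicGaussian.sum_sum_covFun_nonneg
    (hX : IsStationaryIsotropicGaussian P X) (c : K → ℝ) (x : K → Plane) :
    0 ≤ ∑ k, ∑ l, c k * c l * covFun P X (x k) (x l) := by
  rw [← hX.covariance_fieldSum,
    covariance_self (hX.hasGaussianLaw_fieldSum_single c x).aemeasurable]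
  exact variance_nonneg _ _

theorem IsStationaryIsotropicGaussian.covFun_eq_covDiff (hX : IsStationaryIsotropicGaussian P X)
    (x y : Plane) : covFun P X x y = covDiff P X (x - y) :=
  hX.cov_dist _ _ _ _ (by rw [sub_zero])

theorem IsStationaryIsotropicGaussian.covDiff_radial (hX : IsStationaryIsotropicGaussian P X)
    (x y : Plane) (h : ‖x‖ = ‖y‖) : covDiff P X x = covDiff P X y :=
  hX.cov_dist _ _ _ _ (by rw [sub_zero, sub_zero, h])

theorem sum_coeff (φ : Plane → Plane) (n θ : ℕ) (ℓ : Fin 2) (i₁ i₂ : ℕ) :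
    ∑ k, coeff φ n θ ℓ i₁ i₂ k = 0 := by
  rw [coeff_eq_cornerCoeff, sum_cornerCoeff]

/-- The cells of the lattice. -/
def cells (n θ : ℕ) : Finset (ℕ × ℕ) := Finset.Icc 1 (n - θ) ×ˢ Finset.Icc 1 (n - θ)

theorem mem_cells {n θ : ℕ} {i : ℕ × ℕ} :
    i ∈ cells n θ ↔ i.1 ∈ Finset.Icc 1 (n - θ) ∧ i.2 ∈ Finset.Icc 1 (n - θ) :=
  Finset.mem_product

theorem card_cells_le (n θ : ℕ) : ((cells n θ).card : ℝ) ≤ (n : ℝ) ^ 2 := by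
  rw [cells, Finset.card_product, Nat.card_Icc, sq]
  push_cast
  have : ((n - θ + 1 - 1 : ℕ) : ℝ) ≤ n := by
    rw [Nat.add_sub_cancel]
    exact_mod_cast Nat.sub_le n θ
  exact mul_self_le_mul_self (by positivity) this

/-- The difference of discrete gradients of the field on a cell. -/
noncomputable def cellDiff (X : Plane → Ω → ℝ) (φ : Plane → Plane) (n θ : ℕ) (ℓ : Fin 2)
    (i : ℕ × ℕ) : Ω → ℝ :=
  fieldSum X (coeff φ n θ ℓ i.1 i.2) (corners φ n θ i.1 i.2)

theorem fieldQuadVar_eq_sum_cells (X : Plane → Ω → ℝ) (φ : Plane → Plane) (n θ : ℕ) (ℓ : Fin 2)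
    (ω : Ω) : fieldQuadVar X φ n θ ℓ ω = ∑ i : cells n θ, cellDiff X φ n θ ℓ i ω ^ 2 := by
  rw [Finset.sum_coe_sort (cells n θ) (fun i => cellDiff X φ n θ ℓ i ω ^ 2), cells,
    Finset.sum_product]
  simp only [fieldQuadVar, quadVar, nablaBar_eq_sum]
  rfl

theorem IsStationaryIsotropicGaussian.hasGaussianLaw_cellDiff
    (hX : IsStationaryIsotropicGaussian P X) (φ : Plane → Plane) (n θ : ℕ) (ℓ : Fin 2) :
    HasGaussianLaw (fun ω (i : cells n θ) => cellDiff X φ n θ ℓ i ω) P :=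
  hX.hasGaussianLaw_fieldSum (ι := cells n θ) _ _

theorem IsStationaryIsotropicGaussian.integral_cellDiff
    (hX : IsStationaryIsotropicGaussian P X) (φ : Plane → Plane) (n θ : ℕ) (ℓ : Fin 2)
    (i : ℕ × ℕ) : P[cellDiff X φ n θ ℓ i] = 0 :=
  hX.integral_fieldSum (sum_coeff φ n θ ℓ i.1 i.2) _

theorem IsStationaryIsotropicGaussian.memLp_fieldQuadVar
    (hX : IsStationaryIsotropicGaussian P X) (φ : Plane → Plane) (n θ : ℕ) (ℓ : Fin 2) :
    MemLp (fieldQuadVar X φ n θ ℓ) 2 P := by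
  have e : fieldQuadVar X φ n θ ℓ = fun ω => ∑ i : cells n θ, cellDiff X φ n θ ℓ i ω ^ 2 :=
    funext (fieldQuadVar_eq_sum_cells X φ n θ ℓ)
  rw [e]
  exact memLp_finsetSum _ fun i _ => HasGaussianLaw.memLp_sq
    ((hX.hasGaussianLaw_cellDiff φ n θ ℓ).eval i)

theorem IsStationaryIsotropicGaussian.integral_fieldQuadVar
    (hX : IsStationaryIsotropicGaussian P X) (φ : Plane → Plane) (n θ : ℕ) (ℓ : Fin 2) :
    P[fieldQuadVar X φ n θ ℓ] = ∑ i ∈ cells n θ, ∑ k, ∑ l,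
      coeff φ n θ ℓ i.1 i.2 k * coeff φ n θ ℓ i.1 i.2 l *
        covFun P X (corners φ n θ i.1 i.2 k) (corners φ n θ i.1 i.2 l) := by
  simp_rw [fieldQuadVar_eq_sum_cells]
  rw [integral_finsetSum _ fun i _ => (HasGaussianLaw.memLp_sq
    ((hX.hasGaussianLaw_cellDiff φ n θ ℓ).eval i)).integrable one_le_two, ← Finset.sum_coe_sort (cells n θ)]
  exact Finset.sum_congr rfl fun i _ => hX.integral_fieldSum_sq (sum_coeff φ n θ ℓ i.1.1 i.1.2) _

theorem fBar_eq_sum_cells (φ : Plane → Plane) (ν βs : ℝ) (n θ : ℕ) (ℓ : Fin 2) :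
    fBar φ ν βs n θ ℓ = ∑ i ∈ cells n θ,
      βs * gForm ν (coeff φ n θ ℓ i.1 i.2) (corners φ n θ i.1 i.2) := by
  rw [fBar_eq_sum_gForm, ← Finset.mul_sum, cells, Finset.sum_product]

end Field

/-! ### Size of the mean of the quadratic variation. -/

section Asymptotics

variable {φ : Plane → Plane} {D : Set Plane} {ν βs : ℝ} {β : ℕ → ℝ} {θ : ℕ}

/-- With `h = θ / n`, the two weights contribute `h ^ (-2)` and homogeneity of the kernel form
contributes `h ^ (2 * ν)`. -/
theorem IsC2DiffeoOn.eventually_gForm_eq (hν : ν ∈ Ioo (0 : ℝ) 2) (hφ : IsC2DiffeoOn φ D)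
    (hD : unitSquare ⊆ D) (hθ : 0 < θ) (ℓ : Fin 2) :
    ∀ᶠ n : ℕ in atTop, ∀ i ∈ cells n θ,
      gForm ν (coeff φ n θ ℓ i.1 i.2) (corners φ n θ i.1 i.2) =
        (θ : ℝ) ^ (2 * ν - 2) * (n : ℝ) ^ (2 - 2 * ν) *
          gForm ν (cornerCoeff ℓ (rescaledCell φ (θ / n) (latticePoint n i.1 i.2)))
            (rescaledCell φ (θ / n) (latticePoint n i.1 i.2)) := by
  filter_upwards [hφ.eventually_isNondegenerate hD hθ, eventually_gt_atTop 0] with n hn hn0 i hi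
  rw [mem_cells] at hi
  have hw := hn i.1 hi.1 i.2 hi.2
  have hn0' : (0 : ℝ) < n := by exact_mod_cast hn0
  have hθ' : (0 : ℝ) < θ := by exact_mod_cast hθ
  have hh : 0 < (θ : ℝ) / n := by positivity
  have e : coeff φ n θ ℓ i.1 i.2 = fun k => ((θ : ℝ) / n)⁻¹ *
      cornerCoeff ℓ (rescaledCell φ (θ / n) (latticePoint n i.1 i.2)) k := by
    rw [coeff_eq_cornerCoeff, corners_eq_add_smul φ hn0 hθ]
    funext k
    exact cornerCoeff_add_smul hh.ne' ℓ _ _ k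
  rw [e, gForm_const_mul, corners_eq_add_smul φ hn0 hθ,
    gForm_add_smul hν hh (sum_cornerCoeff _ _) (sum_cornerCoeff_mul hw ℓ), ← mul_assoc]
  congr 1
  rw [inv_pow, ← Real.rpow_natCast, ← Real.rpow_neg hh.le, ← Real.rpow_add hh,
    Real.div_rpow hθ'.le hn0'.le, div_eq_mul_inv, ← Real.rpow_neg hn0'.le]
  push_cast
  congr 2 <;> ring

theorem IsC2DiffeoOn.exists_gForm_le (hν : ν ∈ Ioo (0 : ℝ) 2) (hφ : IsC2DiffeoOn φ D)
    (hD : unitSquare ⊆ D) (hθ : 0 < θ) (ℓ : Fin 2) :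
    ∃ C > 0, ∀ᶠ n : ℕ in atTop, ∀ i ∈ cells n θ,
      |gForm ν (coeff φ n θ ℓ i.1 i.2) (corners φ n θ i.1 i.2)| ≤ C * (n : ℝ) ^ (2 - 2 * ν) := by
  obtain ⟨C, hC, hb⟩ := hφ.exists_eventually_abs_le hD hθ
    (F := fun w => gForm ν (cornerCoeff ℓ w) w)
    (fun p hp => continuousAt_gForm_cornerCoeff hν (hφ.isNondegenerate_frame (hD hp)) ℓ)
  have hθ' : (0 : ℝ) < θ := by exact_mod_cast hθ
  refine ⟨(θ : ℝ) ^ (2 * ν - 2) * C, by positivity, ?_⟩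
  filter_upwards [hb, hφ.eventually_gForm_eq hν hD hθ ℓ] with n hn he i hi
  rw [he i hi, abs_mul, abs_of_nonneg (by positivity)]
  rw [mem_cells] at hi
  calc _ ≤ (θ : ℝ) ^ (2 * ν - 2) * (n : ℝ) ^ (2 - 2 * ν) * C := by
        gcongr; exact hn i.1 hi.1 i.2 hi.2
    _ = _ := by ring

theorem exists_card_near_ge (θ : ℕ) {u δ : ℝ} (hu : u ∈ Icc (0 : ℝ) 1) (hδ : 0 < δ) :
    ∃ c > 0, ∀ᶠ n : ℕ in atTop,
      c * (n : ℝ) ≤ ((Finset.Icc 1 (n - θ)).filter fun i : ℕ => |(i : ℝ) / n - u| < δ).card := by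
  -- Keeping `t < 1` leaves room for the shift by `θ` once `n` is large; the side of `u` on which
  -- the interval lies depends on which half of `[0, 1]` contains `u`.
  obtain ⟨s, t, hs, hst, ht, hsu, htu⟩ :
      ∃ s t : ℝ, 0 ≤ s ∧ s < t ∧ t < 1 ∧ u - δ < s ∧ t < u + δ := by
    have hm : 0 < min δ (1 / 2) := by positivity
    have hm1 := min_le_left δ (1 / 2)
    have hm2 := min_le_right δ (1 / 2)
    rcases le_or_gt u (1 / 2) with h | h
    · exact ⟨u, u + min δ (1 / 2) / 2, hu.1, by linarith, by linarith, by linarith, by linarith⟩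
    · exact ⟨u - min δ (1 / 2) / 2, u - min δ (1 / 2) / 4, by linarith, by linarith,
        by linarith [hu.2], by linarith, by linarith⟩
  refine ⟨(t - s) / 2, by linarith, ?_⟩
  have hlim : Tendsto (fun n : ℕ => (n : ℝ)) atTop atTop := tendsto_natCast_atTop_atTop
  filter_upwards [hlim.eventually_ge_atTop (2 / (t - s)), hlim.eventually_ge_atTop (θ / (1 - t)),
    eventually_gt_atTop 0] with n h1 h2 hn0
  rw [div_le_iff₀ (by linarith)] at h1 h2
  have hn0' : (0 : ℝ) < n := by exact_mod_cast hn0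
  have hsub : Finset.Ioc ⌊s * n⌋₊ ⌊t * n⌋₊ ⊆
      (Finset.Icc 1 (n - θ)).filter fun i : ℕ => |(i : ℝ) / n - u| < δ := by
    intro i hi
    rw [Finset.mem_Ioc] at hi
    have hi1 : s * n < i := (Nat.floor_lt (by positivity)).1 hi.1
    have hi2 : (i : ℝ) ≤ t * n := (Nat.le_floor_iff (by nlinarith)).1 hi.2
    have hi3 : i + θ ≤ n := by
      have : (i : ℝ) + θ ≤ n := by nlinarith
      exact_mod_cast this
    rw [Finset.mem_filter, Finset.mem_Icc]
    refine ⟨⟨by omega, by omega⟩, ?_⟩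
    have a1 : s < (i : ℝ) / n := by rwa [lt_div_iff₀ hn0']
    have a2 : (i : ℝ) / n ≤ t := by rwa [div_le_iff₀ hn0']
    rw [abs_lt]
    constructor <;> linarith
  refine le_trans ?_ (Nat.cast_le.2 (Finset.card_le_card hsub))
  rw [Nat.card_Ioc, Nat.cast_sub (Nat.floor_le_floor (by nlinarith))]
  have f1 := Nat.lt_floor_add_one (t * n)
  have f2 := Nat.floor_le (show 0 ≤ s * n by positivity)
  nlinarith

variable {κ : Plane → Plane → ℝ}

/-- All contributions are nonnegative once the cells are nondegenerate, so it suffices to keep those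
near a point where `J ≠ 0`. There continuity costs `η / 2` and replacing the frame by the rescaled
cell another `η / 4`. -/
theorem HasIrregularExpansion.exists_fBar_ge (hν : ν ∈ Ioo (0 : ℝ) 2) (hβs : βs ≠ 0)
    (hκ : HasIrregularExpansion κ ν β βs)
    (hpos : ∀ (c : Fin 2 × Fin 2 → ℝ) (x : Fin 2 × Fin 2 → Plane),
      0 ≤ ∑ k, ∑ l, c k * c l * κ (x k) (x l))
    (hφ : IsC2DiffeoOn φ D) (hD : unitSquare ⊆ D) (hθ : 0 < θ) (ℓ : Fin 2)
    (hJ : ∃ p ∈ unitSquare, J φ ν ℓ p ≠ 0) :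
    ∃ c > 0, ∀ᶠ n : ℕ in atTop, c * (n : ℝ) ^ (4 - 2 * ν) ≤ fBar φ ν βs n θ ℓ := by
  obtain ⟨p₀, hp₀, hJ₀⟩ := hJ
  let F : (Fin 2 × Fin 2 → Plane) → ℝ := fun w => βs * gForm ν (cornerCoeff ℓ w) w
  have hF : ∀ p ∈ unitSquare, ContinuousAt F (frame φ p) := fun p hp =>
    (continuousAt_gForm_cornerCoeff hν (hφ.isNondegenerate_frame (hD hp)) ℓ).const_mul βs
  have hFpos : ∀ w, IsNondegenerate w → 0 ≤ F w := fun w hw =>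
    hκ.mul_gForm_nonneg hν hpos (sum_cornerCoeff ℓ w) (sum_cornerCoeff_mul hw ℓ)
  set η := F (frame φ p₀) with hη
  have hη0 : 0 < η := by
    refine lt_of_le_of_ne (hFpos _ (hφ.isNondegenerate_frame (hD hp₀))) (Ne.symm ?_)
    have : η = βs * (2 * J φ ν ℓ p₀) := by
      simp only [hη, F]
      rw [← gForm_lin_eq_J hφ ν ℓ (hD hp₀)]
      rfl
    rw [this]
    exact mul_ne_zero hβs (mul_ne_zero two_ne_zero hJ₀)
  have hcont : ContinuousOn (fun p => F (frame φ p)) unitSquare := fun p hp =>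
    (hF p hp).comp_continuousWithinAt (hφ.continuousOn_frame.mono hD p hp)
  obtain ⟨δ, hδ, hball⟩ := Metric.continuousWithinAt_iff.1 (hcont p₀ hp₀) (η / 2) (by positivity)
  obtain ⟨c₀, hc₀, hcard₀⟩ := exists_card_near_ge θ (hp₀ 0) (half_pos hδ)
  obtain ⟨c₁, hc₁, hcard₁⟩ := exists_card_near_ge θ (hp₀ 1) (half_pos hδ)
  have hθ' : (0 : ℝ) < θ := by exact_mod_cast hθ
  refine ⟨(θ : ℝ) ^ (2 * ν - 2) * (c₀ * c₁ * (η / 4)), by positivity, ?_⟩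
  filter_upwards [hcard₀, hcard₁, hφ.eventually_isNondegenerate hD hθ,
    hφ.eventually_gForm_eq hν hD hθ ℓ,
    hφ.eventually_abs_sub_lt hD hθ hF (show 0 < η / 4 by positivity),
    eventually_gt_atTop 0] with n hn₀ hn₁ hnd he happ hn0
  have hn0' : (0 : ℝ) < n := by exact_mod_cast hn0
  set T := fun j : Fin 2 =>
    (Finset.Icc 1 (n - θ)).filter fun i : ℕ => |(i : ℝ) / n - p₀ j| < δ / 2 with hT
  let cell : ℕ × ℕ → Fin 2 × Fin 2 → Plane := fun i =>
    rescaledCell φ (θ / n) (latticePoint n i.1 i.2)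
  have hsub : T 0 ×ˢ T 1 ⊆ cells n θ :=
    Finset.product_subset_product (Finset.filter_subset _ _) (Finset.filter_subset _ _)
  have hgood : ∀ i ∈ T 0 ×ˢ T 1, η / 4 ≤ F (cell i) := by
    intro i hi
    have hi' := mem_cells.1 (hsub hi)
    rw [Finset.mem_product, Finset.mem_filter, Finset.mem_filter] at hi
    have hmem : latticePoint n i.1 i.2 ∈ unitSquare := by
      simpa using latticePoint_add_mem hi'.1 hi'.2 (0, 0)
    have hd : dist (latticePoint n i.1 i.2) p₀ < δ := by
      rw [dist_eq_norm]
      refine (norm_le_abs_add_abs _).trans_lt ?_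
      have h1 := hi.1.2
      have h2 := hi.2.2
      simp only [latticePoint, PiLp.sub_apply, Matrix.cons_val_zero, Matrix.cons_val_one]
      linarith
    have h1 := hball hmem hd
    rw [Real.dist_eq] at h1
    have h2 := happ i.1 hi'.1 i.2 hi'.2
    have h3 := (abs_lt.1 h1).1
    have h4 := (abs_lt.1 h2).1
    simp only [cell]
    linarith
  have hsum : c₀ * c₁ * (η / 4) * (n : ℝ) ^ 2 ≤ ∑ i ∈ cells n θ, F (cell i) := by
    calc c₀ * c₁ * (η / 4) * (n : ℝ) ^ 2 = (c₀ * n) * (c₁ * n) * (η / 4) := by ring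
      _ ≤ ((T 0).card : ℝ) * ((T 1).card : ℝ) * (η / 4) := by gcongr
      _ = ∑ i ∈ T 0 ×ˢ T 1, η / 4 := by
          rw [Finset.sum_const, Finset.card_product, nsmul_eq_mul]; push_cast; ring
      _ ≤ ∑ i ∈ T 0 ×ˢ T 1, F (cell i) := Finset.sum_le_sum hgood
      _ ≤ _ := Finset.sum_le_sum_of_subset_of_nonneg hsub fun i hi _ =>
          hFpos _ (hnd i.1 (mem_cells.1 hi).1 i.2 (mem_cells.1 hi).2)
  have hfb : fBar φ ν βs n θ ℓ = (θ : ℝ) ^ (2 * ν - 2) * (n : ℝ) ^ (2 - 2 * ν) *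
      ∑ i ∈ cells n θ, F (cell i) := by
    rw [fBar_eq_sum_cells, Finset.mul_sum]
    refine Finset.sum_congr rfl fun i hi => ?_
    rw [he i hi]
    simp only [F, cell]
    ring
  have hpow : (n : ℝ) ^ (4 - 2 * ν) = (n : ℝ) ^ (2 - 2 * ν) * (n : ℝ) ^ 2 := by
    rw [← Real.rpow_natCast, ← Real.rpow_add hn0']
    congr 1; push_cast; ring
  rw [hfb, hpow]
  calc _ = (θ : ℝ) ^ (2 * ν - 2) * (n : ℝ) ^ (2 - 2 * ν) *
        (c₀ * c₁ * (η / 4) * (n : ℝ) ^ 2) := by ring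
    _ ≤ _ := by gcongr

theorem IsC2DiffeoOn.exists_fBar_le (hν : ν ∈ Ioo (0 : ℝ) 2) (hφ : IsC2DiffeoOn φ D)
    (hD : unitSquare ⊆ D) (hθ : 0 < θ) (ℓ : Fin 2) (βs : ℝ) :
    ∃ C : ℝ, ∀ᶠ n : ℕ in atTop, fBar φ ν βs n θ ℓ ≤ C * (n : ℝ) ^ (4 - 2 * ν) := by
  obtain ⟨C, hC, hb⟩ := hφ.exists_gForm_le hν hD hθ ℓ
  refine ⟨|βs| * C, ?_⟩
  filter_upwards [hb, eventually_gt_atTop 0] with n hn hn0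
  have hn0' : (0 : ℝ) < n := by exact_mod_cast hn0
  have hpow : (n : ℝ) ^ (4 - 2 * ν) = (n : ℝ) ^ 2 * (n : ℝ) ^ (2 - 2 * ν) := by
    rw [← Real.rpow_natCast, ← Real.rpow_add hn0']
    congr 1; push_cast; ring
  rw [fBar_eq_sum_cells]
  calc _ ≤ ∑ i ∈ cells n θ, |βs| * (C * (n : ℝ) ^ (2 - 2 * ν)) := by
        refine Finset.sum_le_sum fun i hi => (le_abs_self _).trans ?_
        rw [abs_mul]
        gcongr
        exact hn i hi
    _ = (cells n θ).card * (|βs| * (C * (n : ℝ) ^ (2 - 2 * ν))) := by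
        rw [Finset.sum_const, nsmul_eq_mul]
    _ ≤ (n : ℝ) ^ 2 * (|βs| * (C * (n : ℝ) ^ (2 - 2 * ν))) := by
        gcongr; exact card_cells_le n θ
    _ = _ := by rw [hpow]; ring

/-- The squared total weight is `O(n ^ 2)` and the corners are `O(1 / n)` apart, which turns the
remainder of order `2 * ν + τ` into the stated power. -/
theorem HasIrregularExpansion.exists_cell_remainder (hν : ν ∈ Ioo (0 : ℝ) 2)
    (hκ : HasIrregularExpansion κ ν β βs) (hφ : IsC2DiffeoOn φ D) (hD : unitSquare ⊆ D)
    (hθ : 0 < θ) (ℓ : Fin 2) :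
    ∃ τ > 0, ∃ C > 0, ∀ᶠ n : ℕ in atTop, ∀ i ∈ cells n θ,
      |∑ k, ∑ l, coeff φ n θ ℓ i.1 i.2 k * coeff φ n θ ℓ i.1 i.2 l *
          κ (corners φ n θ i.1 i.2 k) (corners φ n θ i.1 i.2 l) -
        βs * gForm ν (coeff φ n θ ℓ i.1 i.2) (corners φ n θ i.1 i.2)| ≤
      C * (n : ℝ) ^ (2 - 2 * ν - τ) := by
  obtain ⟨τ, hτ, C, hC, δ, hδ, h⟩ := hκ.abs_sum_sum_sub_le (K := Fin 2 × Fin 2) hν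
  obtain ⟨A, hA, hco⟩ := hφ.exists_eventually_coeff hD hθ ℓ
  refine ⟨τ, hτ, (4 * A) ^ 2 * (C * A ^ (2 * ν + τ)), by positivity, ?_⟩
  have hlim : Tendsto (fun n : ℕ => A / (n : ℝ)) atTop (𝓝 0) :=
    tendsto_const_div_atTop_nhds_zero_nat A
  filter_upwards [hco, hlim.eventually (gt_mem_nhds hδ), eventually_gt_atTop 0]
    with n hn hnδ hn0 i hi
  have hn0' : (0 : ℝ) < n := by exact_mod_cast hn0
  rw [mem_cells] at hi
  obtain ⟨h1, h2, h3⟩ := hn i.1 hi.1 i.2 hi.2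
  refine (h _ _ (sum_coeff φ n θ ℓ i.1 i.2) h1 _ hnδ h3).trans ?_
  have hs : ∑ k, |coeff φ n θ ℓ i.1 i.2 k| ≤ 4 * A * n := by
    refine (Finset.sum_le_sum fun k _ => h2 k).trans_eq ?_
    simp; ring
  calc _ ≤ (4 * A * n) ^ 2 * (C * (A / n) ^ (2 * ν + τ)) := by gcongr
    _ = (4 * A) ^ 2 * (C * A ^ (2 * ν + τ)) * ((n : ℝ) ^ 2 * (n : ℝ) ^ (-(2 * ν + τ))) := by
        rw [Real.div_rpow hA.le hn0'.le, Real.rpow_neg hn0'.le]; ring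
    _ = _ := by
        rw [← Real.rpow_natCast (n : ℝ) 2, ← Real.rpow_add hn0']
        congr 2; push_cast; ring

variable {Ω : Type*} [MeasurableSpace Ω] {P : Measure Ω} [IsProbabilityMeasure P]
  {X : Plane → Ω → ℝ}

theorem IsStationaryIsotropicGaussian.exists_integral_sub_fBar_le
    (hX : IsStationaryIsotropicGaussian P X) (hν : ν ∈ Ioo (0 : ℝ) 2)
    (hK : HasIrregularExpansion (covFun P X) ν β βs) (hφ : IsC2DiffeoOn φ D)
    (hD : unitSquare ⊆ D) (hθ : 0 < θ) (ℓ : Fin 2) :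
    ∃ τ > 0, ∃ C > 0, ∀ᶠ n : ℕ in atTop,
      |P[fieldQuadVar X φ n θ ℓ] - fBar φ ν βs n θ ℓ| ≤ C * (n : ℝ) ^ (4 - 2 * ν - τ) := by
  obtain ⟨τ, hτ, C, hC, h⟩ := hK.exists_cell_remainder hν hφ hD hθ ℓ
  refine ⟨τ, hτ, C, hC, ?_⟩
  filter_upwards [h, eventually_gt_atTop 0] with n hn hn0
  have hn0' : (0 : ℝ) < n := by exact_mod_cast hn0
  rw [hX.integral_fieldQuadVar, fBar_eq_sum_cells, ← Finset.sum_sub_distrib]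
  calc _ ≤ ∑ i ∈ cells n θ, C * (n : ℝ) ^ (2 - 2 * ν - τ) :=
        (Finset.abs_sum_le_sum_abs _ _).trans (Finset.sum_le_sum fun i hi => hn i hi)
    _ = (cells n θ).card * (C * (n : ℝ) ^ (2 - 2 * ν - τ)) := by
        rw [Finset.sum_const, nsmul_eq_mul]
    _ ≤ (n : ℝ) ^ 2 * (C * (n : ℝ) ^ (2 - 2 * ν - τ)) := by
        gcongr; exact card_cells_le n θ
    _ = C * ((n : ℝ) ^ 2 * (n : ℝ) ^ (2 - 2 * ν - τ)) := by ring
    _ = _ := by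
        rw [← Real.rpow_natCast, ← Real.rpow_add hn0']
        congr 2; push_cast; ring

theorem IsStationaryIsotropicGaussian.tendsto_integral_div_fBar
    (hX : IsStationaryIsotropicGaussian P X) (hν : ν ∈ Ioo (0 : ℝ) 2) (hβs : βs ≠ 0)
    (hK : HasIrregularExpansion (covFun P X) ν β βs) (hφ : IsC2DiffeoOn φ D)
    (hD : unitSquare ⊆ D) (hθ : 0 < θ) (ℓ : Fin 2) (hJ : ∃ p ∈ unitSquare, J φ ν ℓ p ≠ 0) :
    Tendsto (fun n : ℕ => P[fieldQuadVar X φ n θ ℓ] / fBar φ ν βs n θ ℓ) atTop (𝓝 1) := by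
  obtain ⟨c, hc, hlow⟩ := hK.exists_fBar_ge hν hβs hX.sum_sum_covFun_nonneg hφ hD hθ ℓ hJ
  obtain ⟨τ, hτ, C, hC, hdiff⟩ := hX.exists_integral_sub_fBar_le hν hK hφ hD hθ ℓ
  rw [tendsto_iff_dist_tendsto_zero]
  have hlim : Tendsto (fun n : ℕ => C / c * (n : ℝ) ^ (-τ)) atTop (𝓝 0) := by
    simpa using ((tendsto_rpow_neg_atTop hτ).comp tendsto_natCast_atTop_atTop).const_mul (C / c)
  refine squeeze_zero' (Eventually.of_forall fun _ => dist_nonneg) ?_ hlim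
  filter_upwards [hlow, hdiff, eventually_gt_atTop 0] with n h1 h2 hn0
  have hn0' : (0 : ℝ) < n := by exact_mod_cast hn0
  have hf : 0 < fBar φ ν βs n θ ℓ := lt_of_lt_of_le (by positivity) h1
  rw [Real.dist_eq, div_sub_one hf.ne', abs_div, abs_of_pos hf, div_le_iff₀ hf]
  calc _ ≤ C * (n : ℝ) ^ (4 - 2 * ν - τ) := h2
    _ = C / c * (n : ℝ) ^ (-τ) * (c * (n : ℝ) ^ (4 - 2 * ν)) := by
        rw [show 4 - 2 * ν - τ = -τ + (4 - 2 * ν) by ring, Real.rpow_add hn0']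
        field_simp
    _ ≤ _ := by gcongr

theorem IsStationaryIsotropicGaussian.exists_integral_ge
    (hX : IsStationaryIsotropicGaussian P X) (hν : ν ∈ Ioo (0 : ℝ) 2) (hβs : βs ≠ 0)
    (hK : HasIrregularExpansion (covFun P X) ν β βs) (hφ : IsC2DiffeoOn φ D)
    (hD : unitSquare ⊆ D) (hθ : 0 < θ) (ℓ : Fin 2) (hJ : ∃ p ∈ unitSquare, J φ ν ℓ p ≠ 0) :
    ∃ c > 0, ∀ᶠ n : ℕ in atTop, c * (n : ℝ) ^ (4 - 2 * ν) ≤ P[fieldQuadVar X φ n θ ℓ] := by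
  obtain ⟨c, hc, hlow⟩ := hK.exists_fBar_ge hν hβs hX.sum_sum_covFun_nonneg hφ hD hθ ℓ hJ
  refine ⟨c / 2, half_pos hc, ?_⟩
  filter_upwards [hlow, (hX.tendsto_integral_div_fBar hν hβs hK hφ hD hθ ℓ hJ).eventually
    (lt_mem_nhds (show (1 / 2 : ℝ) < 1 by norm_num)), eventually_gt_atTop 0] with n h1 h2 hn0
  have hn0' : (0 : ℝ) < n := by exact_mod_cast hn0
  have hf : 0 < fBar φ ν βs n θ ℓ := lt_of_lt_of_le (by positivity) h1
  rw [lt_div_iff₀ hf] at h2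
  linarith

theorem IsStationaryIsotropicGaussian.exists_integral_cellDiff_sq_le
    (hX : IsStationaryIsotropicGaussian P X) (hν : ν ∈ Ioo (0 : ℝ) 2)
    (hK : HasIrregularExpansion (covFun P X) ν β βs) (hφ : IsC2DiffeoOn φ D)
    (hD : unitSquare ⊆ D) (hθ : 0 < θ) (ℓ : Fin 2) :
    ∃ C > 0, ∀ᶠ n : ℕ in atTop, ∀ i ∈ cells n θ,
      Var[cellDiff X φ n θ ℓ i; P] ≤ C * (n : ℝ) ^ (2 - 2 * ν) := by
  obtain ⟨τ, hτ, C, hC, h⟩ := hK.exists_cell_remainder hν hφ hD hθ ℓ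
  obtain ⟨A, hA, hg⟩ := hφ.exists_gForm_le hν hD hθ ℓ
  refine ⟨|βs| * A + C, by positivity, ?_⟩
  filter_upwards [h, hg, eventually_ge_atTop 1] with n hn hgn hn1 i hi
  have hn1' : (1 : ℝ) ≤ n := by exact_mod_cast hn1
  have hm := (hX.hasGaussianLaw_fieldSum_single (coeff φ n θ ℓ i.1 i.2)
    (corners φ n θ i.1 i.2)).aemeasurable
  rw [cellDiff, ← covariance_self hm, hX.covariance_fieldSum]
  have h1 := (abs_le.1 (hn i hi)).2
  have h2 : βs * gForm ν (coeff φ n θ ℓ i.1 i.2) (corners φ n θ i.1 i.2) ≤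
      |βs| * (A * (n : ℝ) ^ (2 - 2 * ν)) := by
    refine (le_abs_self _).trans ?_
    rw [abs_mul]
    gcongr
    exact hgn i hi
  have h3 : (n : ℝ) ^ (2 - 2 * ν - τ) ≤ (n : ℝ) ^ (2 - 2 * ν) :=
    Real.rpow_le_rpow_of_exponent_le hn1' (by linarith)
  have h4 : C * (n : ℝ) ^ (2 - 2 * ν - τ) ≤ C * (n : ℝ) ^ (2 - 2 * ν) := by gcongr
  linarith

end Asymptotics

/-! ### Decay of the covariance between distant cells. -/

section CovarianceDecay

variable {Ω : Type*} [MeasurableSpace Ω] {P : Measure Ω} [IsProbabilityMeasure P]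
  {X : Plane → Ω → ℝ} {φ : Plane → Plane} {D : Set Plane} {ν βs : ℝ} {β : ℕ → ℝ} {θ : ℕ}

theorem abs_covariance_le_half_add {Y Z : Ω → ℝ} (hY : MemLp Y 2 P) (hZ : MemLp Z 2 P) :
    |cov[Y, Z; P]| ≤ (Var[Y; P] + Var[Z; P]) / 2 := by
  have h1 := variance_add hY hZ
  have h2 := variance_sub hY hZ
  have h3 := variance_nonneg (Y + Z) P
  have h4 := variance_nonneg (Y - Z) P
  rw [abs_le]
  constructor <;> linarith

/-- Existence, continuity and growth of the fourth-order partial derivatives of `f` on the set of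
differences of distinct points of `S`. -/
structure HasFourthDerivBound (f : Plane → ℝ) (S : Set Plane) (ν : ℝ) : Prop where
  regular : ∀ a₁ a₂ : ℕ, a₁ + a₂ = 4 → ∃ U : Set Plane, IsOpen U ∧
    (∀ x ∈ S, ∀ y ∈ S, x ≠ y → x - y ∈ U) ∧ HasContMixedPartialOn a₁ a₂ f U
  bound : ∃ C : ℝ, ∀ a₁ a₂ : ℕ, a₁ + a₂ = 4 → ∀ x ∈ S, ∀ y ∈ S, x ≠ y →
    |mixedPartial a₁ a₂ f (x - y)| ≤ C * ‖x - y‖ ^ (2 * ν - 4)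

/-- By connectedness of the image square, every length below an attained distance is attained too;
radial transfer then reaches all nonzero vectors of such length. -/
theorem HasFourthDerivBound.exists_line_bound {f : Plane → ℝ}
    (hf : ∀ x y, ‖x‖ = ‖y‖ → f x = f y) (h : HasFourthDerivBound f (imageSquare φ) ν)
    (hφ : IsC2DiffeoOn φ D) (hD : unitSquare ⊆ D) :
    ∃ C > 0, ∀ w : Plane, w ≠ 0 →
      (∃ x ∈ imageSquare φ, ∃ y ∈ imageSquare φ, ‖w‖ ≤ ‖x - y‖) →
      ContDiffAt ℝ 4 f w ∧ ∀ ζ : Plane,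
        |iteratedDeriv 4 (fun s : ℝ => f (w + s • ζ)) 0| ≤
          C * ‖w‖ ^ (2 * ν - 4) * ‖ζ‖ ^ 4 := by
  obtain ⟨C, hC⟩ := h.bound
  refine ⟨16 * (|C| + 1), by positivity, fun w hw ⟨x, hx, y, hy, hxy⟩ => ?_⟩
  obtain ⟨x', hx', hx'y⟩ := hφ.exists_norm_sub_eq hD hx hy (norm_nonneg w) hxy
  have hne : x' ≠ y := by
    rintro rfl
    rw [sub_self, norm_zero] at hx'y
    exact hw (norm_eq_zero.1 hx'y.symm)
  let S : Set Plane := {v | ∃ x ∈ imageSquare φ, ∃ y ∈ imageSquare φ, x ≠ y ∧ v = x - y}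
  have key := exists_radial_fourth_deriv_bound hf (S := S)
    (b := fun v => (|C| + 1) * ‖v‖ ^ (2 * ν - 4))
    (by rintro v ⟨x, -, y, -, hne, rfl⟩; exact sub_ne_zero.2 hne)
    (fun x y hxy => by simp only [hxy])
    (fun a₁ a₂ ha => by
      obtain ⟨U, hU, hUS, hreg⟩ := h.regular a₁ a₂ ha
      exact ⟨U, hU, by rintro v ⟨x, hx, y, hy, hne, rfl⟩; exact hUS x hx y hy hne, hreg⟩)
    (fun a₁ a₂ ha => by
      rintro v ⟨x, hx, y, hy, hne, rfl⟩
      refine (hC a₁ a₂ ha x hx y hy hne).trans ?_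
      gcongr
      linarith [le_abs_self C])
    (w := w) ⟨x' - y, ⟨x', hx', y, hy, hne, rfl⟩, hx'y.symm⟩
  refine ⟨key.1, fun ζ => (key.2 ζ).trans_eq ?_⟩
  ring

/-- The distance of two cells in the maximum norm. -/
noncomputable def cellDist (i j : ℕ × ℕ) : ℝ := max |(i.1 : ℝ) - j.1| |(i.2 : ℝ) - j.2|

theorem cellDist_nonneg (i j : ℕ × ℕ) : 0 ≤ cellDist i j := le_max_of_le_left (abs_nonneg _)

/-- Below the threshold `m₀` the bound by variances is of the right order. Beyond it, Taylor
expansion gives `n ^ 2` from the weights, `(m / n) ^ (2 * ν - 4)` from the fourth derivatives and `n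
^ (-4)` from the displacements. -/
theorem IsStationaryIsotropicGaussian.exists_covariance_cellDiff_le
    (hX : IsStationaryIsotropicGaussian P X) (hν : ν ∈ Ioo (0 : ℝ) 2)
    (hK : HasIrregularExpansion (covFun P X) ν β βs) (hφ : IsC2DiffeoOn φ D)
    (hD : unitSquare ⊆ D) (hθ : 0 < θ) (ℓ : Fin 2)
    (h4 : HasFourthDerivBound (covDiff P X) (imageSquare φ) ν) :
    ∃ C > 0, ∀ᶠ n : ℕ in atTop, ∀ i ∈ cells n θ, ∀ j ∈ cells n θ,
      |cov[cellDiff X φ n θ ℓ i, cellDiff X φ n θ ℓ j; P]| ≤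
        C * (n : ℝ) ^ (2 - 2 * ν) * (1 + cellDist i j) ^ (2 * ν - 4) := by
  obtain ⟨A, hA, hco⟩ := hφ.exists_eventually_coeff hD hθ ℓ
  obtain ⟨B, hB, hvar⟩ := hX.exists_integral_cellDiff_sq_le hν hK hφ hD hθ ℓ
  obtain ⟨c, hc, hsep⟩ := hφ.exists_corner_separation hD θ
  obtain ⟨M, hM, hline⟩ := h4.exists_line_bound hX.covDiff_radial hφ hD
  -- The first entry makes the displacement inside the cells at most half their separation; the
  -- second gives `1 + m ≤ 2 * m`.
  set m₀ : ℝ := max (4 * A / c) 1 with hm₀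
  have hm₀1 : 1 ≤ m₀ := le_max_right _ _
  have hexp : 2 * ν - 4 ≤ 0 := by linarith [hν.2]
  set C₁ := B * (1 + m₀) ^ (4 - 2 * ν) with hC₁
  set C₂ := (4 * A) ^ 2 * (M * (c / 4) ^ (2 * ν - 4) * (2 * A) ^ 4) with hC₂
  refine ⟨C₁ + C₂, by positivity, ?_⟩
  filter_upwards [hco, hvar, eventually_gt_atTop 0] with n hn hvn hn0 i hi j hj
  have hn0' : (0 : ℝ) < n := by exact_mod_cast hn0
  have hd0 := cellDist_nonneg i j
  have hnpow : 0 ≤ (n : ℝ) ^ (2 - 2 * ν) := by positivity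
  have hdpow : 0 ≤ (1 + cellDist i j) ^ (2 * ν - 4) := by positivity
  rcases lt_or_ge (cellDist i j) m₀ with hlt | hge
  · have hL2 : ∀ i : ℕ × ℕ, MemLp (cellDiff X φ n θ ℓ i) 2 P := fun i =>
      (hX.hasGaussianLaw_fieldSum_single _ _).memLp_two
    have h1 := abs_covariance_le_half_add (hL2 i) (hL2 j)
    have h2 := hvn i hi
    have h3 := hvn j hj
    have h5 : 1 ≤ (1 + m₀) ^ (4 - 2 * ν) * (1 + cellDist i j) ^ (2 * ν - 4) := by
      have e : (1 + m₀) ^ (4 - 2 * ν) * (1 + m₀) ^ (2 * ν - 4) = 1 := by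
        rw [← Real.rpow_add (by positivity), show 4 - 2 * ν + (2 * ν - 4) = 0 by ring,
          Real.rpow_zero]
      exact e.symm.le.trans (mul_le_mul_of_nonneg_left
        (Real.rpow_le_rpow_of_nonpos (by positivity) (by linarith) hexp) (by positivity))
    calc _ ≤ B * (n : ℝ) ^ (2 - 2 * ν) * 1 := by linarith
      _ ≤ B * (n : ℝ) ^ (2 - 2 * ν) *
          ((1 + m₀) ^ (4 - 2 * ν) * (1 + cellDist i j) ^ (2 * ν - 4)) := by gcongr
      _ = C₁ * (n : ℝ) ^ (2 - 2 * ν) * (1 + cellDist i j) ^ (2 * ν - 4) := by rw [hC₁]; ring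
      _ ≤ _ := by gcongr; linarith [show 0 ≤ C₂ by positivity]
  · have hi' := mem_cells.1 hi
    have hj' := mem_cells.1 hj
    obtain ⟨ci, cib, cid⟩ := hn i.1 hi'.1 i.2 hi'.2
    obtain ⟨cj, cjb, cjd⟩ := hn j.1 hj'.1 j.2 hj'.2
    set x := corners φ n θ i.1 i.2 with hx
    set y := corners φ n θ j.1 j.2 with hy
    set m := cellDist i j with hm
    have hm0 : 0 < m := by linarith
    set z := x (0, 0) - y (0, 0) with hz
    have hzl : c * m / n ≤ ‖z‖ := hsep n hn0 i.1 hi'.1 i.2 hi'.2 j.1 hj'.1 j.2 hj'.2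
    have h4A : 4 * A ≤ c * m := by
      have : 4 * A / c ≤ m := (le_max_left _ _).trans hge
      rw [div_le_iff₀ hc] at this
      linarith
    let ξ : Fin 2 × Fin 2 → Plane := fun k => x k - x (0, 0)
    let η : Fin 2 × Fin 2 → Plane := fun l => y l - y (0, 0)
    have hζ : ∀ k l, ‖ξ k - η l‖ ≤ 2 * A / n := fun k l => by
      refine (norm_sub_le _ _).trans ((add_le_add (cid k (0, 0)) (cjd l (0, 0))).trans_eq ?_)
      ring
    have hzeq : ∀ k l, z + (ξ k - η l) = x k - y l := fun k l => by
      simp only [hz, ξ, η]; abel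
    have hseg : ∀ k l, ∀ t ∈ Icc (0 : ℝ) 1, c * m / (2 * n) ≤ ‖z + t • (ξ k - η l)‖ ∧
        ∃ a ∈ imageSquare φ, ∃ b ∈ imageSquare φ, ‖z + t • (ξ k - η l)‖ ≤ ‖a - b‖ := by
      intro k l t ht
      constructor
      · have h1 : ‖t • (ξ k - η l)‖ ≤ 2 * A / n := by
          rw [norm_smul, Real.norm_eq_abs, abs_of_nonneg ht.1]
          exact (mul_le_of_le_one_left (norm_nonneg _) ht.2).trans (hζ k l)
        have h2 : 2 * A / n ≤ c * m / (2 * n) := by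
          rw [div_le_div_iff₀ hn0' (by positivity)]
          nlinarith
        have h3 : c * m / n = c * m / (2 * n) + c * m / (2 * n) := by field_simp; ring
        have h5 := norm_sub_le (z + t • (ξ k - η l)) (t • (ξ k - η l))
        rw [add_sub_cancel_right] at h5
        linarith
      -- The point is a convex combination of two genuine differences of image points, so it is no
      -- longer than one of them, though it need not be such a difference itself.
      · have e : z + t • (ξ k - η l) = (1 - t) • z + t • (x k - y l) := by
          rw [← hzeq k l]; module
        have hle : ‖z + t • (ξ k - η l)‖ ≤ max ‖z‖ ‖x k - y l‖ := by
          rw [e]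
          refine (norm_add_le _ _).trans ?_
          rw [norm_smul, norm_smul, Real.norm_eq_abs, Real.norm_eq_abs, abs_of_nonneg ht.1,
            abs_of_nonneg (by linarith [ht.2])]
          have a1 := le_max_left ‖z‖ ‖x k - y l‖
          have a2 := le_max_right ‖z‖ ‖x k - y l‖
          nlinarith [ht.1, ht.2]
        rcases le_max_iff.1 hle with h | h
        · exact ⟨_, corners_mem hi'.1 hi'.2 (0, 0), _, corners_mem hj'.1 hj'.2 (0, 0), h⟩
        · exact ⟨_, corners_mem hi'.1 hi'.2 k, _, corners_mem hj'.1 hj'.2 l, h⟩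
    have hpos : 0 < c * m / (2 * n) := by positivity
    have hkill : ∀ (d : Fin 2 × Fin 2 → ℝ) (v : Fin 2 × Fin 2 → Plane), ∑ k, d k = 0 →
        (∀ a, ∑ k, d k * v k a = 0) → ∀ a, ∑ k, d k * (v k - v (0, 0)) a = 0 := by
      intro d v hd hv a
      simp only [PiLp.sub_apply, mul_sub, Finset.sum_sub_distrib, hv, ← Finset.sum_mul, hd]
      ring
    have hz0 : ∀ k l, ∀ t ∈ Icc (0 : ℝ) 1, z + t • (ξ k - η l) ≠ 0 := fun k l t ht =>
      norm_pos_iff.1 (hpos.trans_le (hseg k l t ht).1)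
    have hmain := abs_sum_sum_le_of_fourth_deriv (f := covDiff P X) (z := z)
      (M := M * (c * m / (2 * n)) ^ (2 * ν - 4) * (2 * A / n) ^ 4)
      (coeff φ n θ ℓ i.1 i.2) (coeff φ n θ ℓ j.1 j.2) ξ η
      (sum_coeff φ n θ ℓ _ _) (hkill _ _ (sum_coeff φ n θ ℓ _ _) ci)
      (sum_coeff φ n θ ℓ _ _) (hkill _ _ (sum_coeff φ n θ ℓ _ _) cj)
      (by
        have := (hline _ (hz0 (0, 0) (0, 0) 0 (by simp)) (hseg (0, 0) (0, 0) 0 (by simp)).2).1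
        simpa using this)
      (fun k l t ht => (hline _ (hz0 k l t ht) (hseg k l t ht).2).1)
      (fun k l t ht => by
        refine ((hline _ (hz0 k l t ht) (hseg k l t ht).2).2 _).trans ?_
        have h1 := Real.rpow_le_rpow_of_nonpos hpos (hseg k l t ht).1 hexp
        have h2 := hζ k l
        gcongr)
    have hcov : cov[cellDiff X φ n θ ℓ i, cellDiff X φ n θ ℓ j; P] =
        ∑ k, ∑ l, coeff φ n θ ℓ i.1 i.2 k * coeff φ n θ ℓ j.1 j.2 l *
          covDiff P X (z + (ξ k - η l)) := by
      rw [cellDiff, cellDiff, hX.covariance_fieldSum]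
      refine Finset.sum_congr rfl fun k _ => Finset.sum_congr rfl fun l _ => ?_
      rw [hX.covFun_eq_covDiff, hzeq]
    rw [hcov]
    have hs : ∀ i : ℕ × ℕ, (∀ k, |coeff φ n θ ℓ i.1 i.2 k| ≤ A * n) →
        ∑ k, |coeff φ n θ ℓ i.1 i.2 k| ≤ 4 * A * n := fun i hi => by
      refine (Finset.sum_le_sum fun k _ => hi k).trans_eq ?_
      simp; ring
    have hmm : (c * m / (2 * n)) ^ (2 * ν - 4) ≤
        (c / 4) ^ (2 * ν - 4) * (1 + m) ^ (2 * ν - 4) * (n : ℝ) ^ (4 - 2 * ν) := by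
      have e1 : c / 4 * (1 + m) / n ≤ c * m / (2 * n) := by
        rw [div_le_div_iff₀ hn0' (by positivity)]
        have : 1 + m ≤ 2 * m := by linarith
        nlinarith [mul_pos hc hn0']
      refine (Real.rpow_le_rpow_of_nonpos (by positivity) e1 hexp).trans_eq ?_
      rw [Real.div_rpow (by positivity) hn0'.le, Real.mul_rpow (by positivity) (by positivity),
        div_eq_mul_inv, ← Real.rpow_neg hn0'.le]
      congr 2; ring
    calc _ ≤ (4 * A * n) * (4 * A * n) *
          (M * (c * m / (2 * n)) ^ (2 * ν - 4) * (2 * A / n) ^ 4) := by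
          refine hmain.trans ?_
          have := hs i cib
          have := hs j cjb
          gcongr
      _ ≤ (4 * A * n) * (4 * A * n) * (M * ((c / 4) ^ (2 * ν - 4) * (1 + m) ^ (2 * ν - 4) *
          (n : ℝ) ^ (4 - 2 * ν)) * (2 * A / n) ^ 4) := by gcongr
      _ = C₂ * ((n : ℝ) ^ (4 - 2 * ν) * (n : ℝ) ^ (-2 : ℝ)) * (1 + m) ^ (2 * ν - 4) := by
          rw [hC₂, Real.rpow_neg hn0'.le, Real.rpow_two]
          field_simp
      _ = C₂ * (n : ℝ) ^ (2 - 2 * ν) * (1 + m) ^ (2 * ν - 4) := by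
          rw [← Real.rpow_add hn0']
          congr 3; ring
      _ ≤ _ := by gcongr; linarith [show 0 ≤ C₁ by positivity]

end CovarianceDecay

/-! ### Counting cells by distance, and power sums. -/

section LatticeSums

/-- Each absolute difference is attained by at most two indices `j`. -/
theorem sum_natAbs_sub_le {n N i : ℕ} (hi : i < n) (hN : N < n) {g : ℕ → ℝ} (hg : ∀ a, 0 ≤ g a) :
    ∑ j ∈ Finset.Icc 1 N, g ((i : ℤ) - j).natAbs ≤ 2 * ∑ a ∈ Finset.range n, g a := by
  have hmap : ∀ j ∈ Finset.Icc 1 N, ((i : ℤ) - j).natAbs ∈ Finset.range n := by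
    intro j hj
    rw [Finset.mem_Icc] at hj
    rw [Finset.mem_range]
    omega
  rw [← Finset.sum_fiberwise_of_maps_to hmap, Finset.mul_sum]
  refine Finset.sum_le_sum fun a _ => ?_
  have hcard : ((Finset.Icc 1 N).filter fun j : ℕ => ((i : ℤ) - j).natAbs = a).card ≤ 2 := by
    refine (Finset.card_le_card (t := {i - a, i + a}) fun j hj => ?_).trans Finset.card_le_two
    rw [Finset.mem_filter] at hj
    rw [Finset.mem_insert, Finset.mem_singleton]
    omega
  calc _ = ∑ j ∈ (Finset.Icc 1 N).filter fun j : ℕ => ((i : ℤ) - j).natAbs = a, g a :=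
        Finset.sum_congr rfl fun j hj => by rw [(Finset.mem_filter.1 hj).2]
    _ = ((Finset.Icc 1 N).filter fun j : ℕ => ((i : ℤ) - j).natAbs = a).card * g a := by
        rw [Finset.sum_const, nsmul_eq_mul]
    _ ≤ 2 * g a := by
        refine mul_le_mul_of_nonneg_right ?_ (hg a)
        exact_mod_cast hcard

/-- There are `2 m + 1` pairs of naturals with maximum `m`. -/
theorem sum_range_sum_range_max (g : ℕ → ℝ) (n : ℕ) :
    ∑ a ∈ Finset.range n, ∑ b ∈ Finset.range n, g (max a b) =
      ∑ m ∈ Finset.range n, (2 * m + 1) * g m := by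
  induction n with
  | zero => simp
  | succ n ih =>
    have h1 : ∀ a ∈ Finset.range n, g (max a n) = g n := fun a ha => by
      rw [max_eq_right (Finset.mem_range.1 ha).le]
    have h2 : ∀ a ∈ Finset.range n, g (max n a) = g n := fun a ha => by
      rw [max_eq_left (Finset.mem_range.1 ha).le]
    simp only [Finset.sum_range_succ, Finset.sum_add_distrib]
    rw [ih, Finset.sum_congr rfl h1, Finset.sum_congr rfl h2]
    simp
    ring

theorem cellDist_eq (i j : ℕ × ℕ) : cellDist i j =
    ((max ((i.1 : ℤ) - j.1).natAbs ((i.2 : ℤ) - j.2).natAbs : ℕ) : ℝ) := by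
  rw [cellDist]
  push_cast [Nat.cast_natAbs]
  rfl

theorem sum_cells_cellDist_le {n θ : ℕ} (hθ : 0 < θ) {i : ℕ × ℕ} (hi : i ∈ cells n θ) {g : ℝ → ℝ}
    (hg : ∀ a, 0 ≤ a → 0 ≤ g a) :
    ∑ j ∈ cells n θ, g (cellDist i j) ≤ 8 * ∑ m ∈ Finset.range n, ((m : ℝ) + 1) * g m := by
  obtain ⟨h1, h2⟩ := mem_cells.1 hi
  rw [Finset.mem_Icc] at h1 h2
  have hN : n - θ < n := by omega
  have hg' : ∀ a : ℕ, 0 ≤ g a := fun a => hg _ a.cast_nonneg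
  simp only [cellDist_eq, cells, Finset.sum_product]
  calc _ ≤ ∑ j₁ ∈ Finset.Icc 1 (n - θ), 2 * ∑ b ∈ Finset.range n,
          g (max ((i.1 : ℤ) - j₁).natAbs b : ℕ) := by
        refine Finset.sum_le_sum fun j₁ _ => ?_
        exact sum_natAbs_sub_le (g := fun b => g (max ((i.1 : ℤ) - j₁).natAbs b : ℕ))
          (by omega) hN fun b => hg' _
    _ ≤ 2 * ∑ a ∈ Finset.range n, 2 * ∑ b ∈ Finset.range n, g (max a b : ℕ) :=
        sum_natAbs_sub_le (g := fun a => 2 * ∑ b ∈ Finset.range n, g (max a b : ℕ))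
          (by omega) hN fun a => mul_nonneg zero_le_two (Finset.sum_nonneg fun b _ => hg' _)
    _ = 4 * ∑ m ∈ Finset.range n, (2 * (m : ℝ) + 1) * g m := by
        rw [← Finset.mul_sum, sum_range_sum_range_max (fun a => g a)]; ring
    _ ≤ 4 * ∑ m ∈ Finset.range n, 2 * (((m : ℝ) + 1) * g m) := by
        refine mul_le_mul_of_nonneg_left (Finset.sum_le_sum fun m _ => ?_) (by norm_num)
        have := hg' m
        nlinarith
    _ = _ := by rw [← Finset.mul_sum]; ring

/-- `∑ m ^ p` over `1 ≤ m ≤ n`. -/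
noncomputable def powerSum (p : ℝ) (n : ℕ) : ℝ := ∑ m ∈ Finset.range n, ((m : ℝ) + 1) ^ p

theorem powerSum_nonneg (p : ℝ) (n : ℕ) : 0 ≤ powerSum p n :=
  Finset.sum_nonneg fun _ _ => by positivity

theorem exists_powerSum_le_const {p : ℝ} (hp : p < -1) : ∃ C > 0, ∀ n, powerSum p n ≤ C := by
  have hs : Summable fun m : ℕ => ((m : ℝ) + 1) ^ p := by
    have := (summable_nat_add_iff 1).2 (Real.summable_nat_rpow.2 hp)
    simpa using this
  refine ⟨∑' m : ℕ, ((m : ℝ) + 1) ^ p + 1, ?_, fun n => ?_⟩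
  · have : 0 ≤ ∑' m : ℕ, ((m : ℝ) + 1) ^ p := tsum_nonneg fun m => by positivity
    linarith
  · have := hs.sum_le_tsum (Finset.range n) fun m _ => by positivity
    rw [powerSum]
    linarith

theorem powerSum_neg_one_le (n : ℕ) : powerSum (-1) n ≤ 1 + Real.log n := by
  refine le_trans (le_of_eq ?_) (harmonic_le_one_add_log n)
  simp [powerSum, harmonic, Real.rpow_neg_one]

/-- For negative `p`, Bernoulli's inequality with exponent `p + 1` in `(0, 1)` gives `(p + 1) (n +
1) ^ p ≤ (n + 1) ^ (p + 1) - n ^ (p + 1)`, which telescopes. -/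
theorem exists_powerSum_le_rpow {p : ℝ} (hp : -1 < p) :
    ∃ C > 0, ∀ n, powerSum p n ≤ C * (n : ℝ) ^ (p + 1) := by
  rcases le_or_gt 0 p with h | h
  · refine ⟨1, one_pos, fun n => ?_⟩
    rcases Nat.eq_zero_or_pos n with rfl | hn
    · simp [powerSum, Real.zero_rpow (show p + 1 ≠ 0 by linarith)]
    have hn' : (0 : ℝ) < n := by exact_mod_cast hn
    calc powerSum p n ≤ ∑ _m ∈ Finset.range n, (n : ℝ) ^ p := by
          refine Finset.sum_le_sum fun m hm => ?_
          have : (m : ℝ) + 1 ≤ n := by exact_mod_cast Finset.mem_range.1 hm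
          gcongr
      _ = 1 * (n : ℝ) ^ (p + 1) := by
          rw [Finset.sum_const, Finset.card_range, nsmul_eq_mul, Real.rpow_add hn', Real.rpow_one]
          ring
  · have hq : 0 < p + 1 := by linarith
    refine ⟨(p + 1)⁻¹, by positivity, fun n => ?_⟩
    rw [inv_mul_eq_div, le_div_iff₀ hq, mul_comm]
    induction n with
    | zero => simp [powerSum, Real.zero_rpow hq.ne']
    | succ n ih =>
      have e : powerSum p (n + 1) = powerSum p n + ((n : ℝ) + 1) ^ p := by
        simp [powerSum, Finset.sum_range_succ]
      have hn : (0 : ℝ) < (n : ℝ) + 1 := by positivity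
      have hb := rpow_one_add_le_one_add_mul_self (s := -1 / ((n : ℝ) + 1))
        (by rw [le_div_iff₀ hn]; linarith [n.cast_nonneg (α := ℝ)]) hq.le (by linarith)
      have h1 : 1 + -1 / ((n : ℝ) + 1) = n / ((n : ℝ) + 1) := by field_simp; ring
      rw [h1, Real.div_rpow n.cast_nonneg hn.le, div_le_iff₀ (by positivity)] at hb
      have h2 : ((n : ℝ) + 1) ^ (p + 1) = ((n : ℝ) + 1) ^ p * ((n : ℝ) + 1) := by
        rw [Real.rpow_add hn, Real.rpow_one]
      have h3 : (1 + (p + 1) * (-1 / ((n : ℝ) + 1))) * ((n : ℝ) + 1) ^ (p + 1) =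
          ((n : ℝ) + 1) ^ (p + 1) - (p + 1) * ((n : ℝ) + 1) ^ p := by
        rw [h2]; field_simp; ring
      rw [h3] at hb
      rw [e]
      push_cast
      linarith

/-- A crude bound without case distinction at `-1`; for `p < 1` its exponent stays below `2`, which
suffices for almost sure convergence. -/
theorem powerSum_le_rpow (p : ℝ) {n : ℕ} (hn : 0 < n) :
    powerSum p n ≤ (n : ℝ) ^ (max p 0 + 1) := by
  have hn' : (0 : ℝ) < n := by exact_mod_cast hn
  calc powerSum p n ≤ ∑ _m ∈ Finset.range n, (n : ℝ) ^ max p 0 := by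
        refine Finset.sum_le_sum fun m hm => ?_
        have : (m : ℝ) + 1 ≤ n := by exact_mod_cast Finset.mem_range.1 hm
        calc ((m : ℝ) + 1) ^ p ≤ ((m : ℝ) + 1) ^ max p 0 :=
              Real.rpow_le_rpow_of_exponent_le (by linarith [m.cast_nonneg (α := ℝ)])
                (le_max_left _ _)
          _ ≤ _ := by gcongr
    _ = _ := by
        rw [Finset.sum_const, Finset.card_range, nsmul_eq_mul, Real.rpow_add hn', Real.rpow_one]
        ring

end LatticeSums

/-! ### Almost sure convergence from stretched exponential tails. -/

section AlmostSure

variable {Ω : Type*} [MeasurableSpace Ω] {P : Measure Ω} [IsProbabilityMeasure P]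

theorem summable_exp_neg_mul_rpow {a r : ℝ} (ha : 0 < a) (hr : 0 < r) :
    Summable fun n : ℕ => Real.exp (-a * (n : ℝ) ^ r) := by
  have h1 : Tendsto (fun n : ℕ => (n : ℝ) ^ r) atTop atTop :=
    (tendsto_rpow_atTop hr).comp tendsto_natCast_atTop_atTop
  have h2 := ((isLittleO_exp_neg_mul_rpow_atTop ha (-2 / r)).comp_tendsto h1).isBigO
  refine summable_of_isBigO_nat (Real.summable_nat_rpow.2 (show (-2 : ℝ) < -1 by norm_num))
    (h2.congr (fun _ => rfl) fun n => ?_)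
  simp only [Function.comp]
  rw [← Real.rpow_mul n.cast_nonneg, mul_div_cancel₀ _ hr.ne']

/-- Borel–Cantelli along the countable family of tolerances `1 / (k + 1)`. -/
theorem ae_tendsto_of_measureReal_le_exp {Z : ℕ → Ω → ℝ} {a c r : ℝ} (hc : 0 < c) (hr : 0 < r)
    (h : ∀ᶠ n : ℕ in atTop, ∀ ε > 0,
      P.real {ω | ε ≤ |Z n ω - a|} ≤ 4 * Real.exp (-(c * ε) * (n : ℝ) ^ r)) :
    ∀ᵐ ω ∂P, Tendsto (fun n => Z n ω) atTop (𝓝 a) := by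
  have key : ∀ k : ℕ, ∀ᵐ ω ∂P, ∀ᶠ n in atTop, |Z n ω - a| < 1 / ((k : ℝ) + 1) := by
    intro k
    have hk : (0 : ℝ) < 1 / ((k : ℝ) + 1) := Nat.one_div_pos_of_nat
    have hs : Summable fun n => P.real {ω | 1 / ((k : ℝ) + 1) ≤ |Z n ω - a|} := by
      refine ((summable_exp_neg_mul_rpow (mul_pos hc hk) hr).mul_left
        4).of_norm_bounded_eventually_nat ?_
      filter_upwards [h] with n hn
      rw [Real.norm_of_nonneg measureReal_nonneg]
      exact hn _ hk
    have hne : ∑' n, P {ω | 1 / ((k : ℝ) + 1) ≤ |Z n ω - a|} ≠ ⊤ := by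
      have e : ∀ s : Set Ω, ENNReal.ofReal (P.real s) = P s := fun s => ofReal_measureReal
      simpa only [e] using hs.tsum_ofReal_ne_top
    filter_upwards [ae_eventually_notMem hne] with ω hω
    filter_upwards [hω] with n hn
    exact not_le.1 hn
  filter_upwards [ae_all_iff.2 key] with ω hω
  rw [Metric.tendsto_nhds]
  intro ε hε
  obtain ⟨k, hk⟩ := exists_nat_one_div_lt hε
  filter_upwards [hω k] with n hn
  rw [Real.dist_eq]
  exact hn.trans hk

end AlmostSure

/-! ### Relative variance and almost sure convergence of the quadratic variation. -/

section Concentration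

variable {Ω : Type*} [MeasurableSpace Ω] {P : Measure Ω} [IsProbabilityMeasure P]
  {X : Plane → Ω → ℝ} {φ : Plane → Plane} {D : Set Plane} {ν βs : ℝ} {β : ℕ → ℝ} {θ : ℕ}

/-- A shell at distance `m` holds `O(m)` cells, so a row contributes `n ^ (4 - 4 * ν)` times the sum
of `m * m ^ (4 * ν - 8)`; there are at most `n ^ 2` rows. -/
theorem IsStationaryIsotropicGaussian.exists_sum_covariance_sq_le
    (hX : IsStationaryIsotropicGaussian P X) (hν : ν ∈ Ioo (0 : ℝ) 2)
    (hK : HasIrregularExpansion (covFun P X) ν β βs) (hφ : IsC2DiffeoOn φ D)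
    (hD : unitSquare ⊆ D) (hθ : 0 < θ) (ℓ : Fin 2)
    (h4 : HasFourthDerivBound (covDiff P X) (imageSquare φ) ν) :
    ∃ C > 0, ∀ᶠ n : ℕ in atTop,
      ∑ i : cells n θ, ∑ j : cells n θ,
        cov[cellDiff X φ n θ ℓ i, cellDiff X φ n θ ℓ j; P] ^ 2 ≤
        C * (n : ℝ) ^ (6 - 4 * ν) * powerSum (4 * ν - 7) n := by
  obtain ⟨C, hC, h⟩ := hX.exists_covariance_cellDiff_le hν hK hφ hD hθ ℓ h4
  refine ⟨8 * C ^ 2, by positivity, ?_⟩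
  filter_upwards [h, eventually_gt_atTop 0] with n hn hn0
  have hn0' : (0 : ℝ) < n := by exact_mod_cast hn0
  set q := (C * (n : ℝ) ^ (2 - 2 * ν)) ^ 2 with hq
  have hrow : ∀ i ∈ cells n θ, ∑ j ∈ cells n θ,
      cov[cellDiff X φ n θ ℓ i, cellDiff X φ n θ ℓ j; P] ^ 2 ≤
        q * (8 * powerSum (4 * ν - 7) n) := by
    intro i hi
    calc _ ≤ ∑ j ∈ cells n θ, q * ((1 + cellDist i j) ^ (2 * ν - 4)) ^ 2 := by
          refine Finset.sum_le_sum fun j hj => ?_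
          rw [hq, ← mul_pow, ← sq_abs (cov[_, _; P])]
          gcongr
          exact hn i hi j hj
      _ ≤ q * (8 * ∑ m ∈ Finset.range n, ((m : ℝ) + 1) * ((1 + m : ℝ) ^ (2 * ν - 4)) ^ 2) := by
          rw [← Finset.mul_sum]
          gcongr
          exact sum_cells_cellDist_le hθ hi (g := fun x => ((1 + x) ^ (2 * ν - 4)) ^ 2)
            fun a _ => sq_nonneg _
      _ = _ := by
          rw [powerSum]
          congr 2
          refine Finset.sum_congr rfl fun m _ => ?_
          have hm : (0 : ℝ) < m + 1 := by positivity
          rw [add_comm (1 : ℝ), ← Real.rpow_natCast, ← Real.rpow_mul hm.le]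
          nth_rw 1 [← Real.rpow_one ((m : ℝ) + 1)]
          rw [← Real.rpow_add hm]
          congr 1
          push_cast
          ring
  rw [Finset.sum_coe_sort (cells n θ) fun i => ∑ j : cells n θ,
    cov[cellDiff X φ n θ ℓ i, cellDiff X φ n θ ℓ j; P] ^ 2]
  have hps := powerSum_nonneg (4 * ν - 7) n
  calc _ ≤ ∑ i ∈ cells n θ, q * (8 * powerSum (4 * ν - 7) n) := by
        refine Finset.sum_le_sum fun i hi => ?_
        rw [Finset.sum_coe_sort (cells n θ) fun j =>
          cov[cellDiff X φ n θ ℓ i, cellDiff X φ n θ ℓ j; P] ^ 2]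
        exact hrow i hi
    _ ≤ (n : ℝ) ^ 2 * (q * (8 * powerSum (4 * ν - 7) n)) := by
        rw [Finset.sum_const, nsmul_eq_mul]
        gcongr
        exact card_cells_le n θ
    _ = _ := by
        have e : (n : ℝ) ^ 2 * ((n : ℝ) ^ (2 - 2 * ν)) ^ 2 = (n : ℝ) ^ (6 - 4 * ν) := by
          rw [← Real.rpow_natCast, ← Real.rpow_natCast, ← Real.rpow_mul hn0'.le,
            ← Real.rpow_add hn0']
          congr 1
          push_cast
          ring
        rw [hq, ← e]
        ring

theorem IsStationaryIsotropicGaussian.exists_variance_div_le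
    (hX : IsStationaryIsotropicGaussian P X) (hν : ν ∈ Ioo (0 : ℝ) 2) (hβs : βs ≠ 0)
    (hK : HasIrregularExpansion (covFun P X) ν β βs) (hφ : IsC2DiffeoOn φ D)
    (hD : unitSquare ⊆ D) (hθ : 0 < θ) (ℓ : Fin 2) (hJ : ∃ p ∈ unitSquare, J φ ν ℓ p ≠ 0)
    (h4 : HasFourthDerivBound (covDiff P X) (imageSquare φ) ν) :
    ∃ C > 0, ∀ᶠ n : ℕ in atTop,
      Var[fun ω => fieldQuadVar X φ n θ ℓ ω / P[fieldQuadVar X φ n θ ℓ]; P] ≤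
        C * ((n : ℝ) ^ (-2 : ℝ) * powerSum (4 * ν - 7) n) := by
  obtain ⟨C, hC, h⟩ := hX.exists_sum_covariance_sq_le hν hK hφ hD hθ ℓ h4
  obtain ⟨c, hc, hE⟩ := hX.exists_integral_ge hν hβs hK hφ hD hθ ℓ hJ
  refine ⟨2 * C / c ^ 2, by positivity, ?_⟩
  filter_upwards [h, hE, eventually_gt_atTop 0] with n hn hEn hn0
  have hn0' : (0 : ℝ) < n := by exact_mod_cast hn0
  set E := P[fieldQuadVar X φ n θ ℓ] with hEdef
  have hE0 : 0 < E := lt_of_lt_of_le (by positivity) hEn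
  have hvar : Var[fieldQuadVar X φ n θ ℓ; P] =
      2 * ∑ i : cells n θ, ∑ j : cells n θ,
        cov[cellDiff X φ n θ ℓ i, cellDiff X φ n θ ℓ j; P] ^ 2 := by
    rw [← variance_sum_sq (hX.hasGaussianLaw_cellDiff φ n θ ℓ)
      fun i => hX.integral_cellDiff φ n θ ℓ i]
    exact congrArg (fun f => Var[f; P]) (funext (fieldQuadVar_eq_sum_cells X φ n θ ℓ))
  have hps := powerSum_nonneg (4 * ν - 7) n
  have e : (fun ω => fieldQuadVar X φ n θ ℓ ω / E) = fun ω => E⁻¹ * fieldQuadVar X φ n θ ℓ ω := by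
    funext ω
    rw [div_eq_inv_mul]
  have e2 : (n : ℝ) ^ (6 - 4 * ν) = (n : ℝ) ^ (-2 : ℝ) * ((n : ℝ) ^ (4 - 2 * ν)) ^ 2 := by
    rw [← Real.rpow_natCast, ← Real.rpow_mul hn0'.le, ← Real.rpow_add hn0']
    congr 1
    push_cast
    ring
  rw [e, variance_const_mul, hvar, inv_pow, ← div_eq_inv_mul, div_le_iff₀ (by positivity)]
  calc _ ≤ 2 * (C * (n : ℝ) ^ (6 - 4 * ν) * powerSum (4 * ν - 7) n) := by gcongr
    _ = 2 * C / c ^ 2 * ((n : ℝ) ^ (-2 : ℝ) * powerSum (4 * ν - 7) n) *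
        (c * (n : ℝ) ^ (4 - 2 * ν)) ^ 2 := by
        rw [e2]
        field_simp
    _ ≤ _ := by gcongr

theorem IsStationaryIsotropicGaussian.isBigO_variance_div
    (hX : IsStationaryIsotropicGaussian P X) (hν : ν ∈ Ioo (0 : ℝ) 2) (hβs : βs ≠ 0)
    (hK : HasIrregularExpansion (covFun P X) ν β βs) (hφ : IsC2DiffeoOn φ D)
    (hD : unitSquare ⊆ D) (hθ : 0 < θ) (ℓ : Fin 2) (hJ : ∃ p ∈ unitSquare, J φ ν ℓ p ≠ 0)
    (h4 : HasFourthDerivBound (covDiff P X) (imageSquare φ) ν) {g : ℕ → ℝ} {B : ℝ}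
    (hg : ∀ᶠ n : ℕ in atTop, (n : ℝ) ^ (-2 : ℝ) * powerSum (4 * ν - 7) n ≤ B * g n) :
    (fun n : ℕ => Var[fun ω => fieldQuadVar X φ n θ ℓ ω / P[fieldQuadVar X φ n θ ℓ]; P])
      =O[atTop] g := by
  obtain ⟨C, hC, h⟩ := hX.exists_variance_div_le hν hβs hK hφ hD hθ ℓ hJ h4
  refine IsBigO.of_bound (C * |B|) ?_
  filter_upwards [h, hg] with n hn hgn
  rw [Real.norm_of_nonneg (variance_nonneg _ _), Real.norm_eq_abs, mul_assoc, ← abs_mul]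
  exact hn.trans (mul_le_mul_of_nonneg_left (hgn.trans (le_abs_self _)) hC.le)

/-- The exponential tail is used at level `ε * E`, where `E` is of order at least `n ^ (4 - 2 * ν)`
and the Frobenius scale is `n ^ (3 - 2 * ν + γ / 2)` up to a constant. Their ratio grows as `n ^ (1
- γ / 2)`. -/
theorem IsStationaryIsotropicGaussian.ae_tendsto_div
    (hX : IsStationaryIsotropicGaussian P X) (hν : ν ∈ Ioo (0 : ℝ) 2) (hβs : βs ≠ 0)
    (hK : HasIrregularExpansion (covFun P X) ν β βs) (hφ : IsC2DiffeoOn φ D)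
    (hD : unitSquare ⊆ D) (hθ : 0 < θ) (ℓ : Fin 2) (hJ : ∃ p ∈ unitSquare, J φ ν ℓ p ≠ 0)
    (h4 : HasFourthDerivBound (covDiff P X) (imageSquare φ) ν) :
    ∀ᵐ ω ∂P, Tendsto (fun n : ℕ =>
      fieldQuadVar X φ n θ ℓ ω / P[fieldQuadVar X φ n θ ℓ]) atTop (𝓝 1) := by
  obtain ⟨C, hC, h⟩ := hX.exists_sum_covariance_sq_le hν hK hφ hD hθ ℓ h4
  obtain ⟨c, hc, hE⟩ := hX.exists_integral_ge hν hβs hK hφ hD hθ ℓ hJ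
  -- `γ` is the exponent supplied by `powerSum_le_rpow`; `ν < 2` is exactly what makes it smaller
  -- than `2`.
  set γ := max (4 * ν - 7) 0 + 1 with hγ
  have hγ2 : 0 < 1 - γ / 2 := by
    have : max (4 * ν - 7) 0 < 1 := max_lt (by linarith [hν.2]) one_pos
    linarith
  have hsC : 0 < √C := Real.sqrt_pos.2 hC
  refine ae_tendsto_of_measureReal_le_exp (c := c / (4 * √C)) (by positivity) hγ2 ?_
  filter_upwards [h, hE, eventually_gt_atTop 0] with n hn hEn hn0 ε hε
  have hn0' : (0 : ℝ) < n := by exact_mod_cast hn0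
  set E := P[fieldQuadVar X φ n θ ℓ] with hEdef
  have hE0 : 0 < E := lt_of_lt_of_le (by positivity) hEn
  set F := √C * (n : ℝ) ^ (3 - 2 * ν + γ / 2) with hF
  have hF0 : 0 < F := by positivity
  have hcov : ∑ i : cells n θ, ∑ j : cells n θ,
      cov[cellDiff X φ n θ ℓ i, cellDiff X φ n θ ℓ j; P] ^ 2 ≤ F ^ 2 := by
    calc _ ≤ C * (n : ℝ) ^ (6 - 4 * ν) * powerSum (4 * ν - 7) n := hn
      _ ≤ C * (n : ℝ) ^ (6 - 4 * ν) * (n : ℝ) ^ γ := by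
          gcongr
          exact powerSum_le_rpow _ hn0
      _ = F ^ 2 := by
          rw [hF, mul_pow, Real.sq_sqrt hC.le, ← Real.rpow_natCast, ← Real.rpow_mul hn0'.le,
            mul_assoc, ← Real.rpow_add hn0']
          congr 2
          push_cast
          ring
  have hexp : c * (n : ℝ) ^ (4 - 2 * ν) / F = c / √C * (n : ℝ) ^ (1 - γ / 2) := by
    rw [hF, mul_div_mul_comm, ← Real.rpow_sub hn0']
    congr 2
    ring
  have htail := measureReal_abs_sum_sq_sub_integral_ge_le (hX.hasGaussianLaw_cellDiff φ n θ ℓ)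
    (fun i => hX.integral_cellDiff φ n θ ℓ i) hF0 hcov (ε * E)
  simp_rw [← fieldQuadVar_eq_sum_cells] at htail
  refine (measureReal_mono ?_).trans (htail.trans ?_)
  · intro ω hω
    have hω' : ε ≤ |fieldQuadVar X φ n θ ℓ ω / E - 1| := hω
    rw [div_sub_one hE0.ne', abs_div, abs_of_pos hE0, le_div_iff₀ hE0] at hω'
    exact hω'
  · gcongr
    have : c / √C * (n : ℝ) ^ (1 - γ / 2) ≤ E / F := by
      rw [← hexp]
      gcongr
    calc -(ε * E) / (4 * F) = -(ε / 4 * (E / F)) := by field_simp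
      _ ≤ -(ε / 4 * (c / √C * (n : ℝ) ^ (1 - γ / 2))) := by gcongr
      _ = _ := by field_simp

theorem eventually_powerSum_le_const {p : ℝ} (hp : p < -1) :
    ∃ B : ℝ, ∀ᶠ n : ℕ in atTop, (n : ℝ) ^ (-2 : ℝ) * powerSum p n ≤ B * (n : ℝ) ^ (-2 : ℝ) := by
  obtain ⟨B, _, h⟩ := exists_powerSum_le_const hp
  refine ⟨B, Eventually.of_forall fun n => ?_⟩
  rw [mul_comm B]
  exact mul_le_mul_of_nonneg_left (h n) (by positivity)

theorem eventually_powerSum_neg_one_le :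
    ∀ᶠ n : ℕ in atTop, (n : ℝ) ^ (-2 : ℝ) * powerSum (-1) n ≤
      2 * ((n : ℝ) ^ (-2 : ℝ) * Real.log n) := by
  filter_upwards [eventually_ge_atTop 3] with n hn
  have hn' : (3 : ℝ) ≤ n := by exact_mod_cast hn
  have hlog : 1 ≤ Real.log n := by
    rw [Real.le_log_iff_exp_le (by linarith)]
    linarith [Real.exp_one_lt_d9]
  have := powerSum_neg_one_le n
  calc _ ≤ (n : ℝ) ^ (-2 : ℝ) * (2 * Real.log n) := by gcongr; linarith
    _ = _ := by ring

theorem eventually_powerSum_le_rpow {p : ℝ} (hp : -1 < p) :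
    ∃ B : ℝ, ∀ᶠ n : ℕ in atTop, (n : ℝ) ^ (-2 : ℝ) * powerSum p n ≤ B * (n : ℝ) ^ (p - 1) := by
  obtain ⟨B, _, h⟩ := exists_powerSum_le_rpow hp
  refine ⟨B, ?_⟩
  filter_upwards [eventually_gt_atTop 0] with n hn0
  have hn0' : (0 : ℝ) < n := by exact_mod_cast hn0
  calc _ ≤ (n : ℝ) ^ (-2 : ℝ) * (B * (n : ℝ) ^ (p + 1)) := by gcongr; exact h n
    _ = B * ((n : ℝ) ^ (-2 : ℝ) * (n : ℝ) ^ (p + 1)) := by ring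
    _ = _ := by
        rw [← Real.rpow_add hn0']
        congr 2
        ring

end Concentration

end DeformedLattice

/-! ### The theorem, assembled. -/

theorem theorem4p1 {Ω : Type*} [MeasurableSpace Ω] (P : Measure Ω) [IsProbabilityMeasure P]
    (X : DeformedLattice.Plane → Ω → ℝ)
    (hX : DeformedLattice.IsStationaryIsotropicGaussian P X)
    (ν : ℝ) (hν : ν ∈ Ioo (0 : ℝ) 2) (β : ℕ → ℝ) (βs : ℝ) (hβs : βs ≠ 0)
    (hK : DeformedLattice.HasIrregularExpansion (DeformedLattice.covFun P X) ν β βs)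
    (φ : DeformedLattice.Plane → DeformedLattice.Plane) (D : Set DeformedLattice.Plane)
    (hD : DeformedLattice.unitSquare ⊆ D) (hφ : DeformedLattice.IsC2DiffeoOn φ D)
    (θ : ℕ) (hθ : θ = 1 ∨ θ = 2) (ℓ : Fin 2)
    (hJ : ∃ p ∈ DeformedLattice.unitSquare, DeformedLattice.J φ ν ℓ p ≠ 0) :
    (∀ n : ℕ, MemLp (DeformedLattice.fieldQuadVar X φ n θ ℓ) 2 P) ∧
    Tendsto (fun n : ℕ => P[DeformedLattice.fieldQuadVar X φ n θ ℓ] /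
        DeformedLattice.fBar φ ν βs n θ ℓ) atTop (𝓝 1) ∧
    (∃ c > 0, ∃ C : ℝ, ∀ᶠ n : ℕ in atTop,
      c * (n : ℝ) ^ (4 - 2 * ν) ≤ DeformedLattice.fBar φ ν βs n θ ℓ ∧
      DeformedLattice.fBar φ ν βs n θ ℓ ≤ C * (n : ℝ) ^ (4 - 2 * ν)) ∧
    ((∀ a₁ a₂ : ℕ, a₁ + a₂ = 4 → ∃ U : Set DeformedLattice.Plane, IsOpen U ∧
        (∀ x ∈ DeformedLattice.imageSquare φ, ∀ y ∈ DeformedLattice.imageSquare φ,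
          x ≠ y → x - y ∈ U) ∧
        DeformedLattice.HasContMixedPartialOn a₁ a₂ (DeformedLattice.covDiff P X) U) →
      (∃ C : ℝ, ∀ a₁ a₂ : ℕ, a₁ + a₂ = 4 →
        ∀ x ∈ DeformedLattice.imageSquare φ, ∀ y ∈ DeformedLattice.imageSquare φ, x ≠ y →
          |DeformedLattice.mixedPartial a₁ a₂ (DeformedLattice.covDiff P X) (x - y)|
            ≤ C * ‖x - y‖ ^ (2 * ν - 4)) →
      (ν < 3 / 2 →
        (fun n : ℕ => Var[fun ω => DeformedLattice.fieldQuadVar X φ n θ ℓ ω /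
            P[DeformedLattice.fieldQuadVar X φ n θ ℓ]; P])
          =O[atTop] fun n : ℕ => (n : ℝ) ^ (-2 : ℝ)) ∧
      (ν = 3 / 2 →
        (fun n : ℕ => Var[fun ω => DeformedLattice.fieldQuadVar X φ n θ ℓ ω /
            P[DeformedLattice.fieldQuadVar X φ n θ ℓ]; P])
          =O[atTop] fun n : ℕ => (n : ℝ) ^ (-2 : ℝ) * Real.log n) ∧
      (3 / 2 < ν →
        (fun n : ℕ => Var[fun ω => DeformedLattice.fieldQuadVar X φ n θ ℓ ω /
            P[DeformedLattice.fieldQuadVar X φ n θ ℓ]; P])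
          =O[atTop] fun n : ℕ => (n : ℝ) ^ (-8 + 4 * ν)) ∧
      ∀ᵐ ω ∂P, Tendsto (fun n : ℕ => DeformedLattice.fieldQuadVar X φ n θ ℓ ω /
          P[DeformedLattice.fieldQuadVar X φ n θ ℓ]) atTop (𝓝 1)) := by
  have hθ0 : 0 < θ := by omega
  obtain ⟨c, hc, hlow⟩ := hK.exists_fBar_ge hν hβs hX.sum_sum_covFun_nonneg hφ hD hθ0 ℓ hJ
  obtain ⟨C, hup⟩ := hφ.exists_fBar_le hν hD hθ0 ℓ βs
  refine ⟨fun n => hX.memLp_fieldQuadVar φ n θ ℓ,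
    hX.tendsto_integral_div_fBar hν hβs hK hφ hD hθ0 ℓ hJ, ⟨c, hc, C, hlow.and hup⟩,
    fun hreg hbound => ?_⟩
  have h4 : DeformedLattice.HasFourthDerivBound (DeformedLattice.covDiff P X)
    (DeformedLattice.imageSquare φ) ν := ⟨hreg, hbound⟩
  -- The exponent `4 * ν - 7` crosses the summability threshold `-1` at `ν = 3 / 2`.
  refine ⟨fun h => ?_, fun h => ?_, fun h => ?_,
    hX.ae_tendsto_div hν hβs hK hφ hD hθ0 ℓ hJ h4⟩
  · obtain ⟨B, hB⟩ := DeformedLattice.eventually_powerSum_le_const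
      (show 4 * ν - 7 < -1 by linarith)
    exact hX.isBigO_variance_div hν hβs hK hφ hD hθ0 ℓ hJ h4 hB
  · refine hX.isBigO_variance_div hν hβs hK hφ hD hθ0 ℓ hJ h4 (B := 2) ?_
    rw [show 4 * ν - 7 = -1 by rw [h]; norm_num]
    exact DeformedLattice.eventually_powerSum_neg_one_le
  · obtain ⟨B, hB⟩ := DeformedLattice.eventually_powerSum_le_rpow
      (show -1 < 4 * ν - 7 by linarith)
    rw [show 4 * ν - 7 - 1 = -8 + 4 * ν by ring] at hB
    exact hX.isBigO_variance_div hν hβs hK hφ hD hθ0 ℓ hJ h4 hB
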